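/- Let $I=\{0,1,2,3\}$ with its usual order $0<1<2<3$, let $\Gamma$ be the Dynkin diagram of type $F_4$ labelled along the diagram by $0,1,2,3$ so that $\alpha_0,\alpha_1$ are the short and $\alpha_2,\alpha_3$ the long simple roots, and let $(\cdot,\cdot)$ be the symmetric bilinear form on the root lattice with $(\alpha_0,\alpha_0)=(\alpha_1,\alpha_1)=2$, $(\alpha_2,\alpha_2)=(\alpha_3,\alpha_3)=4$, $(\alpha_0,\alpha_1)=-1$, $(\alpha_1,\alpha_2)=(\alpha_2,\alpha_3)=-2$, and $(\alpha_i,\alpha_j)=0$ for all other $i\ne j$. Let $\mathcal F$ be the $\mathbb Q(q)$-vector space whose basis is the set of all words $[i_1,\dots,i_k]$ in the letters of $I$ ($k\ge 0$), graded by $|[i_1,\dots,i_k]|=\alpha_{i_1}+\cdots+\alpha_{i_k}$, and write $\cdot$ for concatenation. Let $*$ be the quantum shuffle product on $\mathcal F$, the bilinear product with unit the empty word $[\,]$ such that $$(x\cdot[i])*(y\cdot[j])=(x*(y\cdot[j]))\cdot[i]+q^{-(|x|+\alpha_i,\alpha_j)}\,((x\cdot[i])*y)\cdot[j]$$ for all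 words $x,y$ and letters $i,j$, and let $\mathcal W\subseteq(\mathcal F,*)$ be the subalgebra generated by the letters $[i]$, $i\in I$. Order words lexicographically from right to left, with the empty word larger than every letter; that is, $u<v$ if either $v$ is a proper right factor of $u$, or, at the first position from the right where $u$ and $v$ differ, the letter of $u$ is smaller than that of $v$. A word is *good* if it is the smallest word occurring with non-zero coefficient in some homogeneous non-zero element of $\mathcal W$. A non-empty word is *Lyndon* if it is larger than each of its proper non-empty left factors. The height of a word is its length. Then the good Lyndon words of type $F_4$ are exactly the words in the following table (written $[i_1i_2\cdots i_k]$ for $[i_1,i_2,\dots,i_k]$); in particular there are none of height greater than $11$. $$\begin{array}{c|l} \text{Height} & \text{Good Lyndon words}\\ \hline 1 & [0],\ [1],\ [2],\ [3]\\ 2 & [01],\ [12],\ [23]\\ 3 & [012],\ [123],\ [112]\\ 4 & [0123],\ [1012],\ [1123]\\ 5 & [01012],\ [21123],\ [10123]\\ 6 & [010123],\ [210123]\\ 7 & [1210123],\ [2010123]\\ 8 & [12010123]\\ 9 & [112010123]\\ 10 & [2112010123]\\ 11 & [21012310123] \end{array}$$ -/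

import Mathlib

/-! Words, the quantum shuffle algebra, and good Lyndon words for the right-to-left order. -/

namespace QuantumShuffle

/-- The base field `ℚ(q)`; its generator `q` is `RatFunc.X`. -/
abbrev K : Type := RatFunc ℚ

/-- The underlying `ℚ(q)`-vector space of the free associative algebra on the letters `[i]`,
`i ∈ I`: its basis is the set of all words `[i₁, …, i_k]`, and `[]` is the empty word. -/
abbrev FreeSpace (I : Type) : Type := List I →₀ K

section Shuffle

variable {I : Type}

/-- `pairing B x j = (|x|, α_j)`, where `|x|` is the weight of the word `x` and
`B i j = (α_i, α_j)`. -/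
def pairing (B : I → I → ℤ) (x : List I) (j : I) : ℤ :=
  (x.map fun i => B i j).sum

/-- The linear map that appends the letter `[i]` on the right of every word. -/
noncomputable def appendLetter (i : I) : FreeSpace I →ₗ[K] FreeSpace I :=
  Finsupp.lmapDomain K K fun u => u ++ [i]

/-- The quantum shuffle product of two words that are handed over in reversed spelling, so that
the head of a list is the last letter of the word. The result is spelled normally. -/
noncomputable def shuffleRev (B : I → I → ℤ) : List I → List I → FreeSpace I
  | [], v => Finsupp.single v.reverse 1
  | u, [] => Finsupp.single u.reverse 1
  | i :: u, j :: v =>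
      appendLetter i (shuffleRev B u (j :: v)) +
        (RatFunc.X : K) ^ (-(pairing B (i :: u) j)) • appendLetter j (shuffleRev B (i :: u) v)
  termination_by u v => u.length + v.length

/-- The quantum shuffle product of two words. -/
noncomputable def shuffleWord (B : I → I → ℤ) (u v : List I) : FreeSpace I :=
  shuffleRev B u.reverse v.reverse

theorem shuffleWord_nil_left (B : I → I → ℤ) (v : List I) :
    shuffleWord B [] v = Finsupp.single v 1 := by
  simp [shuffleWord, shuffleRev]

theorem shuffleWord_nil_right (B : I → I → ℤ) (u : List I) :
    shuffleWord B u [] = Finsupp.single u 1 := by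
  unfold shuffleWord
  cases h : u.reverse with
  | nil => simp_all [shuffleRev]
  | cons a t =>
    have : u = (a :: t).reverse := by rw [← h, List.reverse_reverse]
    simp [shuffleRev, this]

/-- The defining recursion of the quantum shuffle product:
`(x·[i]) * (y·[j]) = (x * (y·[j]))·[i] + q^{-(|x| + α_i, α_j)} ((x·[i]) * y)·[j]`. -/
theorem shuffleWord_append (B : I → I → ℤ) (x y : List I) (i j : I) :
    shuffleWord B (x ++ [i]) (y ++ [j]) =
      appendLetter i (shuffleWord B x (y ++ [j])) +
        (RatFunc.X : K) ^ (-(pairing B (x ++ [i]) j)) •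
          appendLetter j (shuffleWord B (x ++ [i]) y) := by
  have h : pairing B (i :: x.reverse) j = pairing B (x ++ [i]) j := by
    simp [pairing, List.sum_reverse, add_comm]
  simp only [shuffleWord, List.reverse_append, List.reverse_cons, List.reverse_nil, List.nil_append,
    List.cons_append]
  rw [shuffleRev, h]

/-- The quantum shuffle product `*`, extended bilinearly to the whole space. -/
noncomputable def shuffle (B : I → I → ℤ) : FreeSpace I →ₗ[K] FreeSpace I →ₗ[K] FreeSpace I :=
  Finsupp.linearCombination K fun u => Finsupp.linearCombination K (shuffleWord B u)

/-- The subalgebra `𝒲` of the quantum shuffle algebra generated by the letters: the smallest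
subspace that contains the unit `[]` and all letters `[i]` and is closed under `*`. -/
noncomputable def letterSubalgebra (B : I → I → ℤ) : Submodule K (FreeSpace I) :=
  sInf {S | Finsupp.single [] 1 ∈ S ∧ (∀ i : I, Finsupp.single [i] 1 ∈ S) ∧
    ∀ x ∈ S, ∀ y ∈ S, shuffle B x y ∈ S}

end Shuffle

section Words

variable {I : Type} [LinearOrder I]

/-- `f` is homogeneous of degree `∑ i, ν i • α_i`: every word in `f` contains each letter `i`
exactly `ν i` times. -/
def IsHomogeneous (f : FreeSpace I) (ν : I → ℕ) : Prop :=
  ∀ u ∈ f.support, ∀ i, u.count i = ν i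

/-- `u < v` in the lexicographic order read from right to left, the empty word being larger than
every letter: either `v` is a proper right factor of `u`, or at the first place from the right
where `u` and `v` differ, the letter of `u` is the smaller one. -/
def WordLT (u v : List I) : Prop :=
  (∃ p, p ≠ [] ∧ u = p ++ v) ∨
    ∃ (p p' s : List I) (a b : I), a < b ∧ u = p ++ a :: s ∧ v = p' ++ b :: s

/-- `g = min(f)`: the word `g` occurs in `f` and is the smallest word that occurs in `f`. -/
def IsMinWord (f : FreeSpace I) (g : List I) : Prop :=
  g ∈ f.support ∧ ∀ v ∈ f.support, v ≠ g → WordLT g v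

/-- `g` is a (lower) good word: `g = min(w)` for some homogeneous `w ∈ 𝒲`. -/
def IsGood (B : I → I → ℤ) (g : List I) : Prop :=
  ∃ w ∈ letterSubalgebra B, (∃ ν, IsHomogeneous w ν) ∧ IsMinWord w g

/-- `l` is Lyndon (on the right): it is non-empty and larger than each of its proper non-empty
left factors. -/
def IsLyndon (l : List I) : Prop :=
  l ≠ [] ∧ ∀ p s : List I, p ≠ [] → s ≠ [] → l = p ++ s → WordLT p l

/-- The set of good Lyndon words of height (that is, length) `d`. -/
def goodLyndon (B : I → I → ℤ) (d : ℕ) : Set (List I) :=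
  {l | IsGood B l ∧ IsLyndon l ∧ l.length = d}

end Words

/-- The bilinear form of type `F₄` on simple roots, `(α_i, α_j) = d_i a_{ij}`, where `(a_{ij})` is
the Cartan matrix and `d_i = (α_i, α_i) / 2`. The diagram is `0 — 1 ⇐ 2 — 3`, with short simple
roots `α₀, α₁` and long simple roots `α₂, α₃`. -/
def formF4 (i j : Fin 4) : ℤ :=
  (![1, 1, 2, 2] : Fin 4 → ℤ) i * CartanMatrix.F₄ i j

/-- The form, written out. -/
theorem formF4_eq : Matrix.of formF4 =
    !![ 2, -1,  0,  0;
       -1,  2, -2,  0;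
        0, -2,  4, -2;
        0,  0, -2,  4] := by
  decide

end QuantumShuffle

/-! Spell words backwards and reverse the order of the letters. Then the given order becomes the
opposite of the usual lexicographic order: smallest words become largest ("leading") words, and
Lyndon words become the words smaller than each of their proper suffixes. The theorem says that the
Lyndon words among the leading words of homogeneous elements of `𝒲` are 24 given words, one for each
positive root. It follows from comparing a lower and an upper bound for the weight spaces of `𝒲`.

Lower bound. Each of the 24 words is the leading word of an explicit element of `𝒲`: a letter, a
`q`-commutator of shorter such elements divided by some `q ^ a - q ^ (-a)`, or, for the word of
height 11, a plain commutator. These are finite computations (`goodRec_spec`, `goodTerms_top`). The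
coefficients in a shuffle of two words are sums of powers of `q`, so nothing cancels, and the
largest shuffle of a Lyndon word with a non-increasing product of Lyndon words that do not exceed it
is the concatenation (`Interleave.le_append`). Hence ordered products of the 24 elements have as
leading words the non-increasing concatenations of the 24 words (`isLeading_prod`), and these are
distinct by uniqueness of the Lyndon factorization (`IsLyndonChain.ext`).

Upper bound. The letters satisfy the quantum Serre relations. In the specialization at `q = 1` these
become the Serre relations of type `F₄`, from which all commutators of generators with 24 chosen
root vectors can be computed (`adCoeff_spec`). So the root vectors span a space closed under
commutators, and their ordered products span the specialization. Nakayama's lemma at the ideal `(q -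
1)`, applied in each weight, lifts this to `ℚ(q)` (`mem_span_ordered`): the weight space of `ν` is
spanned by as many elements as `ν` has partitions into positive roots. Neither the independence of
these products nor the identification of the specialization with an enveloping algebra is needed.

Conclusion. A further Lyndon word that is a leading word in weight `ν` would differ from all the
concatenations, and would give one independent element more than the upper bound allows
(`exists_eq_of_isLeading`). -/

namespace QuantumShuffle

open Finsupp

/-! ### The quantum shuffle algebra is an associative algebra -/

section ShuffleAlgebra

variable {I : Type} (B : I → I → ℤ)

/-- The quantum shuffle algebra with all words spelled backwards: the head of a list is the last
letter of the word. -/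
def ShuffleAlgebra (_B : I → I → ℤ) : Type := List I →₀ K

namespace ShuffleAlgebra

noncomputable instance : AddCommGroup (ShuffleAlgebra B) :=
  inferInstanceAs (AddCommGroup (List I →₀ K))

noncomputable instance : Module K (ShuffleAlgebra B) :=
  inferInstanceAs (Module K (List I →₀ K))

/-- A word, as an element of the shuffle algebra. -/
noncomputable def word (u : List I) : ShuffleAlgebra B := Finsupp.single u (1 : K)

/-- The coefficient of a word. -/
noncomputable def coeff (u : List I) : ShuffleAlgebra B →ₗ[K] K := Finsupp.lapply u

/-- The linear map that is given on words. -/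
noncomputable def lift {M : Type*} [AddCommGroup M] [Module K M] (f : List I → M) :
    ShuffleAlgebra B →ₗ[K] M :=
  Finsupp.linearCombination K f

variable {B}

@[simp] theorem lift_word {M : Type*} [AddCommGroup M] [Module K M] (f : List I → M)
    (u : List I) : lift B f (word B u) = f u :=
  (Finsupp.linearCombination_single K (1 : K) u).trans (one_smul K (f u))

theorem hom_ext {M : Type*} [AddCommGroup M] [Module K M] {f g : ShuffleAlgebra B →ₗ[K] M}
    (h : ∀ u, f (word B u) = g (word B u)) : f = g :=
  Finsupp.lhom_ext' fun u => LinearMap.ext_ring (h u)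

theorem induction_words {p : ShuffleAlgebra B → Prop} (f : ShuffleAlgebra B) (h0 : p 0)
    (hadd : ∀ f g, p f → p g → p (f + g)) (hword : ∀ (c : K) u, p (c • word B u)) : p f := by
  refine Finsupp.induction_linear (motive := p) f h0 hadd fun u c => ?_
  have : (Finsupp.single u c : List I →₀ K) = c • Finsupp.single u (1 : K) := by simp
  rw [this]
  exact hword c u

theorem coeff_word [DecidableEq I] (u v : List I) :
    coeff B u (word B v) = if v = u then 1 else 0 :=
  Finsupp.single_apply

variable (B)

/-- Adds a letter at the head of every word. -/
noncomputable def consL (i : I) : ShuffleAlgebra B →ₗ[K] ShuffleAlgebra B :=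
  lift B fun u => word B (i :: u)

/-- The quantum shuffle product of two words in reversed spelling. -/
noncomputable def shuffleList (u v : List I) : ShuffleAlgebra B :=
  Finsupp.lmapDomain K K List.reverse (shuffleRev B u v)

/-- The diagonal operator that scales the word `u` by `q ^ (-(|u|, α_j))`. -/
noncomputable def twist (j : I) : ShuffleAlgebra B →ₗ[K] ShuffleAlgebra B :=
  lift B fun u => (RatFunc.X : K) ^ (-(pairing B u j)) • word B u

variable {B}

@[simp] theorem consL_word (i : I) (u : List I) : consL B i (word B u) = word B (i :: u) := by
  simp [consL]

@[simp] theorem twist_word (j : I) (u : List I) :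
    twist B j (word B u) = (RatFunc.X : K) ^ (-(pairing B u j)) • word B u := by
  simp [twist]

@[simp] theorem shuffleList_nil_left (v : List I) : shuffleList B [] v = word B v := by
  simp [shuffleList, shuffleRev]; rfl

@[simp] theorem shuffleList_nil_right (u : List I) : shuffleList B u [] = word B u := by
  cases u <;> simp [shuffleList, shuffleRev] <;> rfl

theorem reverse_appendLetter (i : I) (f : FreeSpace I) :
    (Finsupp.lmapDomain K K List.reverse (appendLetter i f) : List I →₀ K) =
      consL B i (Finsupp.lmapDomain K K List.reverse f : List I →₀ K) := by
  induction f using Finsupp.induction_linear with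
  | zero => simp only [map_zero]; exact (map_zero _).symm
  | add f g hf hg => simp only [map_add, hf, hg]; exact (map_add (consL B i) _ _).symm
  | single u c =>
    have h1 : (Finsupp.single u.reverse c : List I →₀ K) = c • word B u.reverse := by
      simp only [word]; exact (Finsupp.smul_single_one _ _).symm
    simp only [appendLetter, Finsupp.lmapDomain_apply, Finsupp.mapDomain_single]
    rw [h1, map_smul, consL_word]
    simp only [word, List.reverse_append, List.reverse_cons, List.reverse_nil, List.nil_append,
      List.cons_append]
    exact (Finsupp.smul_single_one _ _).symm

theorem shuffleList_cons_cons (i j : I) (u v : List I) :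
    shuffleList B (i :: u) (j :: v) =
      consL B i (shuffleList B u (j :: v)) +
        (RatFunc.X : K) ^ (-(pairing B (i :: u) j)) • consL B j (shuffleList B (i :: u) v) := by
  simp only [shuffleList]
  rw [← reverse_appendLetter, ← reverse_appendLetter, shuffleRev, map_add, map_smul]
  rfl

variable (B)

/-- The quantum shuffle product as a bilinear map. -/
noncomputable def mulL : ShuffleAlgebra B →ₗ[K] ShuffleAlgebra B →ₗ[K] ShuffleAlgebra B :=
  lift B fun u => lift B (shuffleList B u)

variable {B}

@[simp] theorem mulL_word_word (u v : List I) :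
    mulL B (word B u) (word B v) = shuffleList B u v := by
  simp [mulL]

@[simp] theorem mulL_nil_left (f : ShuffleAlgebra B) : mulL B (word B []) f = f := by
  have : mulL B (word B []) = LinearMap.id := hom_ext fun u => by simp
  rw [this]; rfl

@[simp] theorem mulL_nil_right (f : ShuffleAlgebra B) : mulL B f (word B []) = f := by
  have : (mulL B).flip (word B []) = LinearMap.id := hom_ext fun u => by simp
  exact LinearMap.congr_fun this f

/-- The power of `q` in the recursion depends on the weight of the left word. Absorbing it into the
diagonal operator `twist` makes the recursion bilinear, so that it applies to products as well as to
words; associativity needs this. -/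
theorem mulL_consL_consL (i j : I) (f g : ShuffleAlgebra B) :
    mulL B (consL B i f) (consL B j g) =
      consL B i (mulL B f (consL B j g)) + consL B j (mulL B (twist B j (consL B i f)) g) := by
  induction f using induction_words with
  | h0 => simp
  | hadd f f' hf hf' =>
    simp only [map_add, LinearMap.add_apply, hf, hf']; abel
  | hword c u =>
    induction g using induction_words with
    | h0 => simp
    | hadd g g' hg hg' => simp only [map_add, hg, hg']; abel
    | hword d v =>
      simp only [map_smul, LinearMap.smul_apply, consL_word, twist_word, mulL_word_word,
        shuffleList_cons_cons, smul_add]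

theorem X_zpow_add (a b : ℤ) :
    (RatFunc.X : K) ^ (a + b) = RatFunc.X ^ a * RatFunc.X ^ b :=
  zpow_add₀ RatFunc.X_ne_zero a b

theorem pairing_cons (i : I) (u : List I) (j : I) :
    pairing B (i :: u) j = B i j + pairing B u j := by
  simp [pairing]

theorem twist_consL (i j : I) (f : ShuffleAlgebra B) :
    twist B j (consL B i f) = (RatFunc.X : K) ^ (-(B i j)) • consL B i (twist B j f) := by
  induction f using induction_words with
  | h0 => simp
  | hadd f f' hf hf' => simp only [map_add, hf, hf', smul_add]
  | hword c u =>
    simp only [map_smul, consL_word, twist_word, pairing_cons, neg_add,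
      X_zpow_add, smul_smul]
    congr 1
    ring

/-- All words in a shuffle of `u` and `v` have weight `|u| + |v|`, so the diagonal operator acts by
a scalar. -/
theorem twist_shuffleList (k : I) (u v : List I) :
    twist B k (shuffleList B u v) =
      (RatFunc.X : K) ^ (-(pairing B u k) - pairing B v k) • shuffleList B u v := by
  induction u generalizing v with
  | nil => simp [pairing]
  | cons i u ihu =>
    induction v with
    | nil => simp [pairing]
    | cons j v ihv =>
      rw [shuffleList_cons_cons, map_add, map_smul, twist_consL, twist_consL, ihu, ihv, smul_add]
      simp only [map_smul, smul_smul, pairing_cons]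
      simp only [← X_zpow_add]
      congr 2 <;> congr 1 <;> ring

theorem twist_mulL (k : I) (f g : ShuffleAlgebra B) :
    twist B k (mulL B f g) = mulL B (twist B k f) (twist B k g) := by
  induction f using induction_words with
  | h0 => simp
  | hadd f f' hf hf' => simp only [map_add, LinearMap.add_apply, hf, hf']
  | hword c u =>
    induction g using induction_words with
    | h0 => simp
    | hadd g g' hg hg' => simp only [map_add, hg, hg']
    | hword d v =>
      simp only [map_smul, LinearMap.smul_apply, twist_word, mulL_word_word, twist_shuffleList,
        smul_smul]
      congr 1
      rw [sub_eq_add_neg, X_zpow_add]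
      ring

/-- Induction on the total length. Both bracketings split into three sums according to whether the
head comes from `u`, `v` or `w`; the sums match by induction, the third one because `twist` is
multiplicative. -/
theorem mulL_assoc_words (u v w : List I) :
    mulL B (mulL B (word B u) (word B v)) (word B w) =
      mulL B (word B u) (mulL B (word B v) (word B w)) := by
  induction hn : u.length + v.length + w.length using Nat.strong_induction_on
    generalizing u v w with
  | _ n ih =>
    rcases u with _ | ⟨i, u⟩
    · rw [mulL_nil_left, mulL_nil_left]
    rcases v with _ | ⟨j, v⟩
    · rw [mulL_nil_right, mulL_nil_left]
    rcases w with _ | ⟨k, w⟩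
    · rw [mulL_nil_right, mulL_nil_right]
    simp only [List.length_cons] at hn
    have h1 := ih _ (by simp only [List.length_cons]; omega) u (j :: v) (k :: w) rfl
    have h2 := ih _ (by simp only [List.length_cons]; omega) (i :: u) v (k :: w) rfl
    have h3 := ih _ (by simp only [List.length_cons]; omega) (i :: u) (j :: v) w rfl
    simp only [← consL_word] at h1 h2 h3 ⊢
    have e1 : mulL B (mulL B (consL B i (word B u)) (consL B j (word B v)))
        (consL B k (word B w)) =
        consL B i (mulL B (mulL B (word B u) (consL B j (word B v))) (consL B k (word B w))) +
        consL B j (mulL B (mulL B (twist B j (consL B i (word B u))) (word B v))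
          (consL B k (word B w))) +
        consL B k (mulL B (twist B k (mulL B (consL B i (word B u)) (consL B j (word B v))))
          (word B w)) := by
      rw [mulL_consL_consL i j, map_add, LinearMap.add_apply, mulL_consL_consL i k,
        mulL_consL_consL j k]
      simp only [map_add, LinearMap.add_apply]
      abel
    have e2 : mulL B (consL B i (word B u)) (mulL B (consL B j (word B v))
        (consL B k (word B w))) =
        consL B i (mulL B (word B u) (mulL B (consL B j (word B v)) (consL B k (word B w)))) +
        consL B j (mulL B (twist B j (consL B i (word B u))) (mulL B (word B v)
          (consL B k (word B w)))) +
        consL B k (mulL B (twist B k (consL B i (word B u)))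
          (mulL B (twist B k (consL B j (word B v))) (word B w))) := by
      rw [mulL_consL_consL j k, map_add, mulL_consL_consL i j, mulL_consL_consL i k]
      simp only [map_add]
      abel
    rw [e1, e2, h1, twist_mulL]
    congr 2
    · simp only [consL_word, twist_word, map_smul, LinearMap.smul_apply] at h2 ⊢
      rw [h2]
    · simp only [consL_word, twist_word, map_smul, LinearMap.smul_apply] at h3 ⊢
      rw [h3]

theorem mulL_assoc (f g h : ShuffleAlgebra B) :
    mulL B (mulL B f g) h = mulL B f (mulL B g h) := by
  induction f using induction_words with
  | h0 => simp
  | hadd f f' hf hf' => simp only [map_add, LinearMap.add_apply, hf, hf']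
  | hword c u =>
    induction g using induction_words with
    | h0 => simp
    | hadd g g' hg hg' => simp only [map_add, LinearMap.add_apply, hg, hg']
    | hword d v =>
      induction h using induction_words with
      | h0 => simp
      | hadd h h' hh hh' => simp only [map_add, hh, hh']
      | hword e w => simp only [map_smul, LinearMap.smul_apply, mulL_assoc_words]

noncomputable instance : Ring (ShuffleAlgebra B) :=
  { (inferInstance : AddCommGroup (ShuffleAlgebra B)) with
    mul := fun f g => mulL B f g
    one := word B []
    mul_assoc := mulL_assoc
    one_mul := mulL_nil_left
    mul_one := mulL_nil_right
    left_distrib := fun f g h => map_add (mulL B f) g h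
    right_distrib := fun f g h => by
      change mulL B (f + g) h = mulL B f h + mulL B g h
      rw [map_add, LinearMap.add_apply]
    zero_mul := fun f => by
      change mulL B 0 f = 0
      rw [map_zero, LinearMap.zero_apply]
    mul_zero := fun f => map_zero (mulL B f) }

theorem mul_def (f g : ShuffleAlgebra B) : f * g = mulL B f g := rfl

theorem one_def : (1 : ShuffleAlgebra B) = word B [] := rfl

noncomputable instance : Algebra K (ShuffleAlgebra B) :=
  Algebra.ofModule
    (fun r x y => by rw [mul_def, map_smul, LinearMap.smul_apply, mul_def])
    (fun r x y => by rw [mul_def, map_smul, mul_def])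

theorem word_mul_word (u v : List I) : word B u * word B v = shuffleList B u v :=
  mulL_word_word u v

variable (B)

/-- Spelling words backwards. -/
noncomputable def reverseEquiv : FreeSpace I ≃ₗ[K] ShuffleAlgebra B :=
  Finsupp.domLCongr List.reverse_involutive.toPerm

variable {B}

theorem reverseEquiv_single (u : List I) :
    reverseEquiv B (Finsupp.single u 1) = word B u.reverse :=
  Finsupp.domLCongr_single _ _ _

theorem coeff_reverseEquiv (u : List I) (f : FreeSpace I) :
    coeff B u (reverseEquiv B f) = f u.reverse :=
  rfl

theorem reverseEquiv_eq (f : FreeSpace I) :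
    reverseEquiv B f = (Finsupp.lmapDomain K K List.reverse f : List I →₀ K) :=
  Finsupp.equivMapDomain_eq_mapDomain _ f

theorem reverseEquiv_shuffle (f g : FreeSpace I) :
    reverseEquiv B (shuffle B f g) = reverseEquiv B f * reverseEquiv B g := by
  have key : (shuffle B).compr₂ (reverseEquiv B).toLinearMap =
      ((mulL B).comp (reverseEquiv B).toLinearMap).compl₂ (reverseEquiv B).toLinearMap := by
    refine Finsupp.lhom_ext' fun u => LinearMap.ext_ring (Finsupp.lhom_ext' fun v =>
      LinearMap.ext_ring ?_)
    simp only [LinearMap.compr₂_apply, LinearMap.compl₂_apply, LinearMap.comp_apply,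
      Finsupp.lsingle_apply, LinearEquiv.coe_coe, reverseEquiv_single, mulL_word_word]
    simp only [shuffle, Finsupp.linearCombination_single, one_smul, shuffleWord]
    rw [reverseEquiv_eq]
    rfl
  exact LinearMap.congr_fun₂ key f g

variable (B)

/-- The subalgebra generated by the letters. -/
noncomputable def letters : Subalgebra K (ShuffleAlgebra B) :=
  Algebra.adjoin K (Set.range fun i => word B [i])

variable {B}

/-- Both sides are the smallest subspace containing the unit and the letters and closed under the
product, transported along the reversal of words. -/
theorem mem_letterSubalgebra {f : FreeSpace I} :
    f ∈ letterSubalgebra B ↔ reverseEquiv B f ∈ letters B := by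
  constructor
  · intro h
    rw [letterSubalgebra, Submodule.mem_sInf] at h
    refine h ((Subalgebra.toSubmodule (letters B)).comap (reverseEquiv B).toLinearMap)
      ⟨?_, fun i => ?_, fun x hx y hy => ?_⟩
    · change reverseEquiv B _ ∈ letters B
      rw [reverseEquiv_single]
      exact (letters B).one_mem
    · change reverseEquiv B _ ∈ letters B
      rw [reverseEquiv_single]
      exact Algebra.subset_adjoin ⟨i, rfl⟩
    · change reverseEquiv B _ ∈ letters B
      rw [reverseEquiv_shuffle]
      exact (letters B).mul_mem hx hy
  · intro h
    rw [letterSubalgebra, Submodule.mem_sInf]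
    rintro S ⟨h1, hl, hm⟩
    have key : ∀ x ∈ letters B, (reverseEquiv B).symm x ∈ S := by
      intro x hx
      induction hx using Algebra.adjoin_induction with
      | mem x hx =>
        obtain ⟨i, rfl⟩ := hx
        have : word B [i] = reverseEquiv B (Finsupp.single [i] 1) := by
          rw [reverseEquiv_single]; rfl
        simp only [this, LinearEquiv.symm_apply_apply]
        exact hl i
      | algebraMap r =>
        rw [Algebra.algebraMap_eq_smul_one, map_smul]
        refine S.smul_mem _ ?_
        have : (1 : ShuffleAlgebra B) = reverseEquiv B (Finsupp.single [] 1) := by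
          rw [reverseEquiv_single]; rfl
        rw [this, LinearEquiv.symm_apply_apply]
        exact h1
      | add x y _ _ hx hy => rw [map_add]; exact S.add_mem hx hy
      | mul x y _ _ hx hy =>
        have : x * y = reverseEquiv B (shuffle B ((reverseEquiv B).symm x)
            ((reverseEquiv B).symm y)) := by
          rw [reverseEquiv_shuffle, LinearEquiv.apply_symm_apply, LinearEquiv.apply_symm_apply]
        rw [this, LinearEquiv.symm_apply_apply]
        exact hm _ hx _ hy
    simpa using key _ h

end ShuffleAlgebra

end ShuffleAlgebra

end QuantumShuffle

namespace QuantumShuffle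

/-! ### Lyndon words and the Lyndon factorization -/

section LexWords

variable {α : Type*} [LinearOrder α]

theorem nil_le_word (u : List α) : [] ≤ u := not_lt.1 (List.not_lt_nil u)

theorem le_append_right (u t : List α) : u ≤ u ++ t := by
  induction u with
  | nil => exact nil_le_word _
  | cons a u ih => exact List.cons_le_cons a ih

theorem append_lt_append_left (p : List α) {u v : List α} (h : u < v) : p ++ u < p ++ v := by
  induction p with
  | nil => exact h
  | cons a p ih => exact List.cons_lt_cons_iff.2 (Or.inr ⟨rfl, ih⟩)

theorem append_le_append_left (p : List α) {u v : List α} (h : u ≤ v) : p ++ u ≤ p ++ v := by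
  rcases h.lt_or_eq with h | rfl
  · exact (append_lt_append_left p h).le
  · exact le_rfl

theorem append_lt_append {u v : List α} (h : u < v) (hp : ¬ u <+: v) (x y : List α) :
    u ++ x < v ++ y := by
  induction u generalizing v with
  | nil => exact absurd (List.nil_prefix) hp
  | cons a u ih =>
    cases v with
    | nil => exact absurd h (List.not_lt_nil _)
    | cons b v =>
      rcases List.cons_lt_cons_iff.1 h with h' | ⟨rfl, h'⟩
      · exact List.cons_lt_cons_iff.2 (Or.inl h')
      · refine List.cons_lt_cons_iff.2 (Or.inr ⟨rfl, ih h' fun hp' => hp ?_⟩)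
        exact (List.cons_prefix_cons).2 ⟨rfl, hp'⟩

theorem append_lt_append_of_length_le {u v : List α} (h : u < v) (hl : v.length ≤ u.length)
    (x y : List α) : u ++ x < v ++ y := by
  refine append_lt_append h (fun hp => ?_) x y
  exact h.ne (hp.eq_of_length (le_antisymm hp.length_le hl))

theorem append_le_append_of_length_eq {u v : List α} (h : u ≤ v) (hl : v.length = u.length)
    (x : List α) : u ++ x ≤ v ++ x := by
  rcases h.lt_or_eq with h | rfl
  · exact (append_lt_append_of_length_le h hl.le x x).le
  · exact le_rfl

/-- A non-empty word is a Lyndon word if it is smaller than each of its proper non-empty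
suffixes. -/
def IsLyndonWord (l : List α) : Prop :=
  l ≠ [] ∧ ∀ p s : List α, p ≠ [] → s ≠ [] → l = p ++ s → l < s

/-- The crucial case is `u ++ v < v`. If `v = u ++ t`, it follows from `v < t`; otherwise `u` and
`v` already differ inside `u`. Other suffixes are compared through `v` or through a proper suffix of
`u`. -/
theorem IsLyndonWord.append {u v : List α} (hu : IsLyndonWord u) (hv : IsLyndonWord v)
    (h : u < v) : IsLyndonWord (u ++ v) := by
  have huv : u ++ v < v := by
    by_cases hp : u <+: v
    · obtain ⟨t, rfl⟩ := hp
      have ht : t ≠ [] := by rintro rfl; simp at h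
      exact append_lt_append_left u (hv.2 u t hu.1 ht rfl)
    · simpa using append_lt_append h hp v []
  refine ⟨by simp [hu.1], fun p s hp hs he => ?_⟩
  rcases List.append_eq_append_iff.1 he with ⟨p', rfl, hv'⟩ | ⟨s', hu', rfl⟩
  · rcases eq_or_ne p' [] with rfl | hp'
    · simp only [List.nil_append] at hv'
      rw [← hv']; exact huv
    · exact huv.trans (hv.2 p' s hp' hs hv')
  · rcases eq_or_ne s' [] with rfl | hs'
    · simpa using huv
    · refine append_lt_append_of_length_le (hu.2 p s' hp hs' hu') ?_ _ _
      simp [hu']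

/-- If `o = p ++ t` with `t` non-empty, then `o < t` gives `p ++ o ≤ p ++ t ++ p`. If `p` is not a
prefix of `o`, the two words differ within `p`. -/
theorem append_comm_le {p y o : List α} (hp : p ≠ []) (ho : IsLyndonWord o) (h : p ++ y < o) :
    p ++ o ≤ o ++ p := by
  by_cases hpo : p <+: o
  · obtain ⟨t, rfl⟩ := hpo
    rcases eq_or_ne t [] with rfl | ht
    · simp
    · have := (ho.2 p t hp ht rfl).le.trans (le_append_right t p)
      simpa using append_le_append_left p this
  · exact (append_lt_append ((le_append_right p y).trans_lt h) hpo _ _).le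

theorem flatten_append_comm_le {l : List α} (hl : IsLyndonWord l) (A : List (List α))
    (hA : ∀ a ∈ A, a ≠ [] ∧ a ≤ l) : A.flatten ++ l ≤ l ++ A.flatten := by
  induction A with
  | nil => simp
  | cons a A ih =>
    have h1 := append_le_append_left a (ih fun b hb => hA b (List.mem_cons_of_mem a hb))
    have h2 : a ++ l ≤ l ++ a := by
      rcases (hA a List.mem_cons_self).2.lt_or_eq with h | rfl
      · exact append_comm_le (y := []) (hA a List.mem_cons_self).1 hl (by simpa using h)
      · exact le_rfl
    have h3 := append_le_append_of_length_eq h2 (by simp [add_comm]) A.flatten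
    simp only [List.flatten_cons, List.append_assoc] at h1 h3 ⊢
    exact h1.trans h3

/-- A non-increasing list of Lyndon words. -/
def IsLyndonChain (L : List (List α)) : Prop :=
  L.Pairwise (· ≥ ·) ∧ ∀ l ∈ L, IsLyndonWord l

theorem IsLyndonChain.nil : IsLyndonChain ([] : List (List α)) := by
  simp [IsLyndonChain]

theorem isLyndonChain_cons {l : List α} {L : List (List α)} :
    IsLyndonChain (l :: L) ↔ IsLyndonWord l ∧ (∀ x ∈ L, x ≤ l) ∧ IsLyndonChain L := by
  simp only [IsLyndonChain, List.pairwise_cons, List.mem_cons, forall_eq_or_imp, ge_iff_le]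
  tauto

/-- The non-increasing order gives the largest product of a list of Lyndon words. -/
theorem flatten_le_of_perm {L L' : List (List α)} (hL : IsLyndonChain L) (h : L'.Perm L) :
    L'.flatten ≤ L.flatten := by
  induction L generalizing L' with
  | nil => rw [h.eq_nil]
  | cons l L ih =>
    obtain ⟨hl, hle, hL⟩ := isLyndonChain_cons.1 hL
    obtain ⟨A, C, rfl⟩ := List.append_of_mem (h.symm.subset List.mem_cons_self)
    have hp : (A ++ C).Perm L := (List.perm_cons l).1 (List.perm_middle.symm.trans h)
    have h1 := append_le_append_left l (ih hL hp)
    have h2 : A.flatten ++ l ≤ l ++ A.flatten := by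
      refine flatten_append_comm_le hl A fun a ha => ?_
      have : a ∈ L := hp.subset (List.mem_append_left _ ha)
      exact ⟨(hL.2 a this).1, hle a this⟩
    have h3 := append_le_append_of_length_eq h2 (by simp [add_comm]) C.flatten
    simp only [List.flatten_cons, List.flatten_append, List.append_assoc] at h1 h3 ⊢
    exact h3.trans h1

/-- As long as `u` is smaller than the first factor, the two merge into a longer Lyndon word; once
it is not, the list is already non-increasing. -/
theorem exists_isLyndonChain_append (L : List (List α)) (hL : IsLyndonChain L) (u : List α)
    (hu : IsLyndonWord u) : ∃ L', IsLyndonChain L' ∧ L'.flatten = u ++ L.flatten := by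
  induction L generalizing u with
  | nil => exact ⟨[u], isLyndonChain_cons.2 ⟨hu, by simp, hL⟩, by simp⟩
  | cons x L ih =>
    obtain ⟨hx, hle, hL'⟩ := isLyndonChain_cons.1 hL
    rcases lt_or_ge u x with h | h
    · obtain ⟨L', h1, h2⟩ := ih hL' (u ++ x) (hu.append hx h)
      exact ⟨L', h1, by simp [h2]⟩
    · refine ⟨u :: x :: L, isLyndonChain_cons.2 ⟨hu, ?_, hL⟩, rfl⟩
      intro y hy
      rcases List.mem_cons.1 hy with rfl | hy
      · exact h
      · exact (hle y hy).trans h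

theorem exists_isLyndonChain (w : List α) : ∃ L, IsLyndonChain L ∧ L.flatten = w := by
  induction w with
  | nil => exact ⟨[], IsLyndonChain.nil, rfl⟩
  | cons a w ih =>
    obtain ⟨L, hL, rfl⟩ := ih
    refine exists_isLyndonChain_append L hL [a] ⟨by simp, fun p s hp hs he => ?_⟩
    have := congrArg List.length he
    have := List.length_pos_iff.2 hp
    have := List.length_pos_iff.2 hs
    simp at *
    omega

/-- The suffix is the last, hence smallest, factor. -/
theorem IsLyndonChain.exists_suffix_le {L : List (List α)} (hL : IsLyndonChain L) {y : List α}
    (hy : y ∈ L) : ∃ p s, s ≠ [] ∧ L.flatten = p ++ s ∧ s ≤ y := by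
  induction L generalizing y with
  | nil => simp at hy
  | cons x L ih =>
    obtain ⟨hx, hle, hL⟩ := isLyndonChain_cons.1 hL
    rcases L with _ | ⟨z, L⟩
    · obtain rfl : y = x := by simpa using hy
      exact ⟨[], y, hx.1, by simp, le_rfl⟩
    · obtain ⟨z', hz', hzy⟩ : ∃ z' ∈ z :: L, z' ≤ y := by
        rcases List.mem_cons.1 hy with rfl | hy
        · exact ⟨z, List.mem_cons_self, hle z List.mem_cons_self⟩
        · exact ⟨y, hy, le_rfl⟩
      obtain ⟨p, s, hs, he, hle'⟩ := ih hL hz'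
      exact ⟨x ++ p, s, hs, by rw [List.flatten_cons, he, List.append_assoc], hle'.trans hzy⟩

theorem exists_suffix_prefix_mem {M : List (List α)} {r t : List α} (hr : r ≠ [])
    (h : M.flatten = r ++ t) : ∃ p r', r' ≠ [] ∧ r = p ++ r' ∧ ∃ x ∈ M, r' ≤ x := by
  induction M generalizing r with
  | nil => simp [hr] at h
  | cons x M ih =>
    rw [List.flatten_cons] at h
    rcases List.append_eq_append_iff.1 h with ⟨r1, rfl, h1⟩ | ⟨y, rfl, -⟩
    · rcases eq_or_ne r1 [] with rfl | hr1
      · exact ⟨[], x, by simpa using hr, by simp, x, by simp, le_rfl⟩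
      · obtain ⟨p, r', hr', rfl, z, hz, hle⟩ := ih hr1 h1
        exact ⟨x ++ p, r', hr', by simp, z, List.mem_cons_of_mem _ hz, hle⟩
    · exact ⟨[], r, hr, by simp, _, List.mem_cons_self, le_append_right r y⟩

/-- If `l` were longer than `m`, some proper suffix of `l` would be a prefix of a factor `x ≤ m`,
hence at most `m ≤ l`; but a Lyndon word is smaller than its proper suffixes. -/
theorem IsLyndonChain.length_head_le {l m : List α} {L M : List (List α)}
    (hl : IsLyndonWord l) (hM : IsLyndonChain (m :: M))
    (h : l ++ L.flatten = m ++ M.flatten) : l.length ≤ m.length := by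
  obtain ⟨hm, hle, hM⟩ := isLyndonChain_cons.1 hM
  by_contra! hlt
  rcases List.append_eq_append_iff.1 h with ⟨r, rfl, -⟩ | ⟨r, rfl, h1⟩
  · simp at hlt
  · have hr : r ≠ [] := by rintro rfl; simp at hlt
    obtain ⟨p, r', hr', rfl, x, hx, hrx⟩ := exists_suffix_prefix_mem hr h1
    have h2 := hl.2 (m ++ p) r' (by simp [hm.1]) hr' (by simp)
    exact absurd (h2.trans_le (hrx.trans ((hle x hx).trans (le_append_right m _)))) (lt_irrefl _)

/-- Uniqueness of the factorization into a non-increasing product of Lyndon words. -/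
theorem IsLyndonChain.ext {L M : List (List α)} (hL : IsLyndonChain L) (hM : IsLyndonChain M)
    (h : L.flatten = M.flatten) : L = M := by
  induction L generalizing M with
  | nil =>
    rcases M with _ | ⟨m, M⟩
    · rfl
    · have := (hM.2 m List.mem_cons_self).1
      simp [this] at h
  | cons l L ih =>
    rcases M with _ | ⟨m, M⟩
    · have := (hL.2 l List.mem_cons_self).1
      simp [this] at h
    · rw [List.flatten_cons, List.flatten_cons] at h
      have hL' := isLyndonChain_cons.1 hL
      have hM' := isLyndonChain_cons.1 hM
      have hlen : l.length = m.length :=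
        le_antisymm (length_head_le hL'.1 hM h) (length_head_le hM'.1 hL h.symm)
      obtain ⟨rfl, h2⟩ := List.append_inj h hlen
      rw [ih hL'.2.2 hM'.2.2 h2]

end LexWords

/-! ### Combinatorial shuffles and their monotonicity -/

section Interleave

variable {β : Type*}

/-- `s` is a shuffle of `u` and `v`. -/
inductive Interleave : List β → List β → List β → Prop
  | nil : Interleave [] [] []
  | left {u v s : List β} (a : β) : Interleave u v s → Interleave (a :: u) v (a :: s)
  | right {u v s : List β} (a : β) : Interleave u v s → Interleave u (a :: v) (a :: s)

theorem Interleave.perm {u v s : List β} (h : Interleave u v s) : s.Perm (u ++ v) := by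
  induction h with
  | nil => exact List.Perm.refl _
  | left a _ ih => exact ih.cons a
  | right a _ ih => exact (ih.cons a).trans List.perm_middle.symm

theorem interleave_nil_left (v : List β) : Interleave [] v v := by
  induction v with
  | nil => exact .nil
  | cons a v ih => exact .right a ih

theorem interleave_nil_right (u : List β) : Interleave u [] u := by
  induction u with
  | nil => exact .nil
  | cons a v ih => exact .left a ih

theorem interleave_append (u v : List β) : Interleave u v (u ++ v) := by
  induction u with
  | nil => exact interleave_nil_left v
  | cons a u ih => exact .left a ih

theorem Interleave.symm {u v s : List β} (h : Interleave u v s) : Interleave v u s := by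
  induction h with
  | nil => exact .nil
  | left a _ ih => exact .right a ih
  | right a _ ih => exact .left a ih

theorem Interleave.map {γ : Type*} (f : β → γ) {u v s : List β} (h : Interleave u v s) :
    Interleave (u.map f) (v.map f) (s.map f) := by
  induction h with
  | nil => exact .nil
  | left a _ ih => exact .left (f a) ih
  | right a _ ih => exact .right (f a) ih

theorem Interleave.eq_right {v s : List β} (h : Interleave [] v s) : v = s := by
  generalize hu : ([] : List β) = u at h
  induction h with
  | nil => rfl
  | left a _ _ => simp at hu
  | right a _ ih => rw [ih hu]

variable [LinearOrder β]

theorem exists_interleave_sorted (u v : List β) (hu : u.Pairwise (· ≥ ·))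
    (hv : v.Pairwise (· ≥ ·)) : ∃ s, Interleave u v s ∧ s.Pairwise (· ≥ ·) := by
  induction u generalizing v with
  | nil => exact ⟨v, interleave_nil_left v, hv⟩
  | cons a u ihu =>
    induction v with
    | nil => exact ⟨a :: u, interleave_nil_right _, hu⟩
    | cons b v ihv =>
      have hu' := List.pairwise_cons.1 hu
      have hv' := List.pairwise_cons.1 hv
      rcases le_total b a with h | h
      · obtain ⟨s, h1, h2⟩ := ihu (b :: v) hu'.2 hv
        refine ⟨a :: s, .left a h1, List.pairwise_cons.2 ⟨fun x hx => ?_, h2⟩⟩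
        rcases List.mem_append.1 (h1.perm.subset hx) with hx | hx
        · exact hu'.1 x hx
        · rcases List.mem_cons.1 hx with rfl | hx
          · exact h
          · exact (hv'.1 x hx).le.trans h
      · obtain ⟨s, h1, h2⟩ := ihv hv'.2
        refine ⟨b :: s, .right b h1, List.pairwise_cons.2 ⟨fun x hx => ?_, h2⟩⟩
        rcases List.mem_append.1 (h1.perm.subset hx) with hx | hx
        · rcases List.mem_cons.1 hx with rfl | hx
          · exact h
          · exact (hu'.1 x hx).le.trans h
        · exact hv'.1 x hx

theorem exists_perm_sorted (u : List β) : ∃ s : List β, s.Perm u ∧ s.Pairwise (· ≥ ·) := by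
  induction u with
  | nil => exact ⟨[], .refl _, .nil⟩
  | cons a u ih =>
    obtain ⟨s, h1, h2⟩ := ih
    obtain ⟨t, h3, h4⟩ := exists_interleave_sorted [a] s (List.pairwise_singleton _ _) h2
    exact ⟨t, h3.perm.trans (h1.cons a), h4⟩

/-- Shuffling is strictly monotone in both words. -/
theorem Interleave.exists_le {u v s : List β} (h : Interleave u v s) {u' v' : List β}
    (hu : u.length = u'.length) (hv : v.length = v'.length) (hu' : u ≤ u') (hv' : v ≤ v') :
    ∃ s', Interleave u' v' s' ∧ s ≤ s' ∧ (s = s' → u = u' ∧ v = v') := by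
  induction h generalizing u' v' with
  | nil =>
    obtain rfl := List.length_eq_zero_iff.1 hu.symm
    obtain rfl := List.length_eq_zero_iff.1 hv.symm
    exact ⟨[], .nil, le_rfl, fun _ => ⟨rfl, rfl⟩⟩
  | @left u v s a h ih =>
    rcases u' with _ | ⟨a', u'⟩
    · simp at hu
    · rcases hu'.lt_or_eq with hlt | heq
      · rcases List.cons_lt_cons_iff.1 hlt with h1 | ⟨rfl, h1⟩
        · refine ⟨a' :: (u' ++ v'), .left a' (interleave_append u' v'),
            (List.cons_lt_cons_iff.2 (Or.inl h1)).le, fun he => ?_⟩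
          exact absurd (List.cons.inj he).1 h1.ne
        · obtain ⟨s', h2, h3, h4⟩ := ih (by simpa using hu) hv h1.le hv'
          refine ⟨a :: s', .left a h2, List.cons_le_cons a h3, fun he => ?_⟩
          obtain ⟨h5, h6⟩ := h4 (List.cons.inj he).2
          exact ⟨by rw [h5], h6⟩
      · obtain ⟨rfl, rfl⟩ := List.cons.inj heq
        obtain ⟨s', h2, h3, h4⟩ := ih rfl hv le_rfl hv'
        exact ⟨a :: s', .left a h2, List.cons_le_cons a h3,
          fun he => ⟨rfl, (h4 (List.cons.inj he).2).2⟩⟩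
  | @right u v s a h ih =>
    rcases v' with _ | ⟨a', v'⟩
    · simp at hv
    · rcases hv'.lt_or_eq with hlt | heq
      · rcases List.cons_lt_cons_iff.1 hlt with h1 | ⟨rfl, h1⟩
        · refine ⟨a' :: (u' ++ v'), .right a' (interleave_append u' v'),
            (List.cons_lt_cons_iff.2 (Or.inl h1)).le, fun he => ?_⟩
          exact absurd (List.cons.inj he).1 h1.ne
        · obtain ⟨s', h2, h3, h4⟩ := ih hu (by simpa using hv) hu' h1.le
          refine ⟨a :: s', .right a h2, List.cons_le_cons a h3, fun he => ?_⟩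
          obtain ⟨h5, h6⟩ := h4 (List.cons.inj he).2
          exact ⟨h5, by rw [h6]⟩
      · obtain ⟨rfl, rfl⟩ := List.cons.inj heq
        obtain ⟨s', h2, h3, h4⟩ := ih hu rfl hu' le_rfl
        exact ⟨a :: s', .right a h2, List.cons_le_cons a h3,
          fun he => ⟨(h4 (List.cons.inj he).2).1, rfl⟩⟩

end Interleave

/-! ### The largest shuffle of products of Lyndon words -/

section LyndonShuffle

variable {α : Type*} [LinearOrder α]

/-- Let `p` travel to the right through `Z`. It absorbs the factors from `Y`, which complete it to
`l`, and passes the factors `o > l` from `O` by `append_comm_le`. At the first `o ≤ l` no factor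
from `Y` can remain, since those exceed `l` and `Z` is non-increasing; so `p` has become `l`. -/
theorem exists_perm_append_flatten_le {Y O Z : List (List α)} (h : Interleave Y O Z)
    (hZ : IsLyndonChain Z) {p l : List α} (hp : p ≠ []) (hl : l = p ++ Y.flatten)
    (hY : ∀ y ∈ Y, l < y) : ∃ Z' : List (List α), Z'.Perm (l :: O) ∧
      p ++ Z.flatten ≤ Z'.flatten := by
  induction h generalizing p with
  | nil => exact ⟨[l], .refl _, by simp [hl]⟩
  | @left Y O Z y h ih =>
    have hZ' := isLyndonChain_cons.1 hZ
    obtain ⟨Z', h1, h2⟩ := ih hZ'.2.2 (p := p ++ y) (by simp [hp]) (by simp [hl])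
      fun z hz => hY z (List.mem_cons_of_mem _ hz)
    exact ⟨Z', h1, by simpa using h2⟩
  | @right Y O Z o h ih =>
    have hZ' := isLyndonChain_cons.1 hZ
    rcases lt_or_ge l o with hlo | hol
    · obtain ⟨Z', h1, h2⟩ := ih hZ'.2.2 hp hl hY
      refine ⟨o :: Z', (h1.cons o).trans (List.Perm.swap _ _ _), ?_⟩
      have h3 := append_le_append_of_length_eq
        (append_comm_le (y := Y.flatten) hp hZ'.1 (hl ▸ hlo)) (by simp [add_comm]) Z.flatten
      have h4 := append_le_append_left o h2
      simp only [List.flatten_cons, List.append_assoc] at h3 h4 ⊢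
      exact h3.trans h4
    · have hYnil : Y = [] := by
        refine List.eq_nil_iff_forall_not_mem.2 fun y hy => ?_
        have h5 := hZ'.2.1 y (h.perm.symm.subset (List.mem_append_left _ hy))
        exact absurd (hY y hy) (not_lt.2 (h5.trans hol))
      subst hYnil
      have hO := h.eq_right
      subst hO
      exact ⟨l :: o :: O, .refl _, by simp [hl]⟩

/-- The inductive step when the first letter `a` of the shuffle comes from the first factor `a :: y`
of `U`. The Lyndon factors of `y` are all larger than `a :: y`, being at least as large as a proper
suffix of it. So they can be put in front of `U` to give the factorization of what remains after
removing `a`; afterwards `exists_perm_append_flatten_le` reassembles `a :: y`. -/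
theorem cons_le_flatten {a : α} {y : List α} {u' s' : List α} {U V Z : List (List α)}
    (hU : IsLyndonChain ((a :: y) :: U)) (hV : IsLyndonChain V) (hu' : u' = y ++ U.flatten)
    (ih : ∀ U' Z', IsLyndonChain U' → U'.flatten = u' → IsLyndonChain Z' →
      Z'.Perm (U' ++ V) → s' ≤ Z'.flatten)
    (hZ : IsLyndonChain Z) (hp : Z.Perm (((a :: y) :: U) ++ V)) : a :: s' ≤ Z.flatten := by
  obtain ⟨hl, hle, hU'⟩ := isLyndonChain_cons.1 hU
  obtain ⟨Y, hY, hYy⟩ := exists_isLyndonChain y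
  have hlt : ∀ x ∈ Y, a :: y < x := by
    intro x hx
    obtain ⟨p, s, hs, he, hsx⟩ := hY.exists_suffix_le hx
    exact (hl.2 (a :: p) s (by simp) hs (by simp [← hYy, he])).trans_le hsx
  have hYU : IsLyndonChain (Y ++ U) := by
    refine ⟨List.pairwise_append.2 ⟨hY.1, hU'.1, fun x hx z hz => ?_⟩, fun x hx => ?_⟩
    · exact (hle z hz).trans (hlt x hx).le
    · rcases List.mem_append.1 hx with hx | hx
      · exact hY.2 x hx
      · exact hU'.2 x hx
  obtain ⟨O, hOp, hO⟩ := exists_perm_sorted (U ++ V)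
  obtain ⟨Z', hZi, hZs⟩ := exists_interleave_sorted Y O hY.1 hO
  have hZp : Z'.Perm (Y ++ U ++ V) := by
    rw [List.append_assoc]
    exact hZi.perm.trans (hOp.append_left Y)
  have hZ' : IsLyndonChain Z' := by
    refine ⟨hZs, fun x hx => ?_⟩
    rcases List.mem_append.1 (hZp.subset hx) with hx | hx
    · exact hYU.2 x hx
    · exact hV.2 x hx
  have h1 : s' ≤ Z'.flatten := ih (Y ++ U) Z' hYU (by simp [hu', hYy]) hZ' hZp
  obtain ⟨Z'', h2, h3⟩ := exists_perm_append_flatten_le hZi hZ' (p := [a]) (l := a :: y)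
    (by simp) (by simp [hYy]) hlt
  have h4 : Z''.Perm Z := h2.trans ((hOp.cons _).trans hp.symm)
  exact (List.cons_le_cons a h1).trans (h3.trans (flatten_le_of_perm hZ h4))

/-- A shuffle of two non-increasing products of Lyndon words is at most the non-increasing product
of all the factors. -/
theorem Interleave.le_flatten {u v s : List α} (h : Interleave u v s) {U V Z : List (List α)}
    (hU : IsLyndonChain U) (hV : IsLyndonChain V) (hZ : IsLyndonChain Z) (hu : U.flatten = u)
    (hv : V.flatten = v) (hp : Z.Perm (U ++ V)) : s ≤ Z.flatten := by
  induction h generalizing U V Z with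
  | nil => exact nil_le_word _
  | @left u v s a h ih =>
    rcases U with _ | ⟨l, U⟩
    · simp at hu
    · rcases l with _ | ⟨b, y⟩
      · exact absurd rfl (isLyndonChain_cons.1 hU).1.1
      · simp only [List.flatten_cons, List.cons_append, List.cons.injEq] at hu
        obtain ⟨rfl, hu⟩ := hu
        exact cons_le_flatten hU hV hu.symm
          (fun U' Z' h1 h2 h3 h4 => ih h1 hV h3 h2 hv h4) hZ hp
  | @right u v s a h ih =>
    rcases V with _ | ⟨l, V⟩
    · simp at hv
    · rcases l with _ | ⟨b, y⟩
      · exact absurd rfl (isLyndonChain_cons.1 hV).1.1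
      · simp only [List.flatten_cons, List.cons_append, List.cons.injEq] at hv
        obtain ⟨rfl, hv⟩ := hv
        exact cons_le_flatten hV hU hv.symm
          (fun V' Z' h1 h2 h3 h4 => ih hU h1 h3 hu h2 (h4.trans List.perm_append_comm)) hZ
          (hp.trans List.perm_append_comm)

/-- The largest shuffle of a Lyndon word `l` with a non-increasing product of Lyndon words that
are at most `l` is the concatenation; with smaller words of the same lengths it is not reached. -/
theorem Interleave.le_append {l : List α} {L : List (List α)} (hL : IsLyndonChain (l :: L))
    {u v s : List α} (h : Interleave u v s) (hul : u.length = l.length)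
    (hvl : v.length = L.flatten.length) (hu : u ≤ l) (hv : v ≤ L.flatten) :
    s ≤ l ++ L.flatten ∧ (s = l ++ L.flatten → u = l ∧ v = L.flatten) := by
  obtain ⟨s', h1, h2, h3⟩ := h.exists_le hul hvl hu hv
  obtain ⟨hl, hle, hL'⟩ := isLyndonChain_cons.1 hL
  have h4 : s' ≤ l ++ L.flatten :=
    h1.le_flatten (isLyndonChain_cons.2 ⟨hl, by simp, IsLyndonChain.nil⟩) hL' hL (by simp) rfl
      (.refl _)
  exact ⟨h2.trans h4, fun he => h3 (le_antisymm h2 (he ▸ h4))⟩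

end LyndonShuffle

end QuantumShuffle

namespace QuantumShuffle

/-! ### Spanning by ordered products, as in the Poincaré–Birkhoff–Witt theorem -/

section OrderedProducts

variable {k C ι G : Type*} [CommRing k] [Ring C] [Algebra k C] [AddCommMonoid G]

theorem mul_prod_mem_span {x : ι → C} {wt : ι → G} {P Q : List ι → Prop} {a : ι} {ν ν' : G}
    (hν : ν' = wt a + ν) (hPQ : ∀ l, P l → Q (a :: l)) {c : C}
    (hc : c ∈ Submodule.span k
      {y | ∃ l : List ι, P l ∧ (l.map wt).sum = ν ∧ y = (l.map x).prod}) :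
    x a * c ∈ Submodule.span k
      {y | ∃ l : List ι, Q l ∧ (l.map wt).sum = ν' ∧ y = (l.map x).prod} := by
  induction hc using Submodule.span_induction with
  | mem y hy =>
    obtain ⟨l, h1, h2, rfl⟩ := hy
    exact Submodule.subset_span ⟨a :: l, hPQ l h1, by simp [h2, hν], by simp⟩
  | zero => simp
  | add y z _ _ hy hz => rw [mul_add]; exact Submodule.add_mem _ hy hz
  | smul r y _ hy => rw [mul_smul_comm]; exact Submodule.smul_mem _ r hy

/-- Changing the order of a product of elements whose commutators are linear combinations of them
changes the product by a linear combination of shorter products. -/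
theorem prod_sub_prod_mem_span_of_perm {x : ι → C} {wt : ι → G}
    (h : ∀ a b, x a * x b - x b * x a ∈
      Submodule.span k {y | ∃ c, wt c = wt a + wt b ∧ y = x c}) {l l' : List ι} (hl : l.Perm l') :
    (l.map x).prod - (l'.map x).prod ∈ Submodule.span k
      {y | ∃ m : List ι, m.length < l.length ∧ (m.map wt).sum = (l.map wt).sum ∧
        y = (m.map x).prod} := by
  induction hl with
  | nil => simp
  | @cons a l l' _ ih =>
    have e : ((a :: l).map x).prod - ((a :: l').map x).prod =
        x a * ((l.map x).prod - (l'.map x).prod) := by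
      simp only [List.map_cons, List.prod_cons, mul_sub]
    rw [e]
    exact mul_prod_mem_span (by simp) (fun m hm => by simpa using hm) ih
  | swap a b l =>
    have e : ((b :: a :: l).map x).prod - ((a :: b :: l).map x).prod =
        (x b * x a - x a * x b) * (l.map x).prod := by
      simp only [List.map_cons, List.prod_cons]; noncomm_ring
    rw [e]
    have hz := h b a
    generalize x b * x a - x a * x b = z at hz ⊢
    induction hz using Submodule.span_induction with
    | mem y hy =>
      obtain ⟨c, hc, rfl⟩ := hy
      exact Submodule.subset_span ⟨c :: l, by simp, by simp [hc, add_assoc], by simp⟩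
    | zero => simp
    | add y z _ _ hy hz => rw [add_mul]; exact Submodule.add_mem _ hy hz
    | smul r y _ hy => rw [smul_mul_assoc]; exact Submodule.smul_mem _ r hy
  | @trans l₁ l₂ l₃ h12 _ ih1 ih2 =>
    rw [← sub_add_sub_cancel _ (l₂.map x).prod]
    refine Submodule.add_mem _ ih1 ?_
    rw [h12.length_eq, (h12.map wt).sum_eq]
    exact ih2

/-- The ordered products span, as in the Poincaré–Birkhoff–Witt theorem. -/
theorem prod_mem_span_sorted [LinearOrder ι] {x : ι → C} {wt : ι → G}
    (h : ∀ a b, x a * x b - x b * x a ∈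
      Submodule.span k {y | ∃ c, wt c = wt a + wt b ∧ y = x c}) (l : List ι) :
    (l.map x).prod ∈ Submodule.span k
      {y | ∃ m : List ι, m.Pairwise (· ≤ ·) ∧ (m.map wt).sum = (l.map wt).sum ∧
        y = (m.map x).prod} := by
  -- Sorting the factors costs only products with fewer factors, to which the induction hypothesis
  -- applies.
  induction hn : l.length using Nat.strong_induction_on generalizing l with
  | _ n ih =>
    have hp := List.perm_insertionSort (· ≤ ·) l
    have h1 := prod_sub_prod_mem_span_of_perm h hp.symm
    have h2 : ((l.insertionSort (· ≤ ·)).map x).prod ∈ Submodule.span k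
      {y | ∃ m : List ι, m.Pairwise (· ≤ ·) ∧ (m.map wt).sum = (l.map wt).sum ∧
        y = (m.map x).prod} :=
      Submodule.subset_span ⟨_, List.pairwise_insertionSort (· ≤ ·) l, (hp.map wt).sum_eq, rfl⟩
    rw [← sub_add_cancel (l.map x).prod ((l.insertionSort (· ≤ ·)).map x).prod]
    refine Submodule.add_mem _ (Submodule.span_le.2 ?_ h1) h2
    rintro y ⟨m, hm, hw, rfl⟩
    rw [← hw]
    exact ih m.length (hn ▸ hm) m rfl

end OrderedProducts

/-! ### The table of words, and the adjoint action on root vectors -/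

section RootVectors

/-- The good Lyndon words of type `F₄`, in increasing order. -/
def lyndonTable : Fin 24 → List (Fin 4) :=
  ![[0],
    [0, 1],
    [1],
    [0, 1, 0, 1, 2],
    [1, 0, 1, 2],
    [0, 1, 2],
    [1, 1, 2],
    [1, 2],
    [2],
    [2, 1, 1, 2, 0, 1, 0, 1, 2, 3],
    [1, 1, 2, 0, 1, 0, 1, 2, 3],
    [1, 2, 0, 1, 0, 1, 2, 3],
    [2, 0, 1, 0, 1, 2, 3],
    [0, 1, 0, 1, 2, 3],
    [1, 2, 1, 0, 1, 2, 3],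
    [2, 1, 0, 1, 2, 3],
    [2, 1, 0, 1, 2, 3, 1, 0, 1, 2, 3],
    [1, 0, 1, 2, 3],
    [0, 1, 2, 3],
    [2, 1, 1, 2, 3],
    [1, 1, 2, 3],
    [1, 2, 3],
    [2, 3],
    [3]]

/-- The simple roots, as indices into `lyndonTable`. -/
def simpleIndex : Fin 4 → Fin 24 := ![0, 2, 8, 23]

/-- The letters of an iterated commutator of Chevalley generators that is a root vector for the
weight of the corresponding word of `lyndonTable`. -/
def rootPath (b : Fin 24) : List (Fin 4) :=
  -- The commutator along the word of index 16 itself would vanish at `q = 1`: it contains the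
  -- commutator of the generator 3 with the root vector of index 17, and `adCoeff 3 17 = 0`.
  if b = 16 then 3 :: lyndonTable 9 else lyndonTable b

/-- The index of the sum of a simple root and a positive root, if that is a root. -/
def adTarget : Fin 4 → Fin 24 → Fin 24 :=
  ![![0, 0, 1, 0, 3, 0, 4, 5, 0, 0, 0, 0, 0, 0, 11, 12, 0, 13, 0, 15, 17, 18, 0, 0],
    ![1, 0, 0, 0, 0, 4, 0, 6, 7, 0, 0, 10, 11, 0, 0, 14, 0, 0, 17, 0, 0, 20, 21, 0],
    ![0, 5, 7, 0, 0, 0, 0, 0, 0, 0, 9, 0, 0, 12, 0, 0, 0, 15, 0, 0, 19, 0, 0, 22],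
    ![0, 0, 0, 13, 17, 18, 20, 21, 22, 16, 0, 0, 0, 0, 0, 0, 0, 0, 0, 0, 0, 0, 0, 0]]

/-- The structure constants for commutators of Chevalley generators with root vectors. -/
def adCoeff : Fin 4 → Fin 24 → ℚ :=
  ![![0, 0, 1, 0, 1, 0, 2, 1, 0, 0, 0, 0, 0, 0, 1/2, 1, 0, 1, 0, 2, 2, 1, 0, 0],
    ![-1, 0, 0, 0, 0, 1, 0, 1, 1, 0, 0, 1, 1, 0, 0, 1, 0, 0, 1, 0, 0, 1, 1, 0],
    ![0, -1, -1, 0, 0, 0, 0, 0, 0, 0, 1, 0, 0, 1, 0, 0, 0, 1, 0, 0, 1, 0, 0, 1],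
    ![0, 0, 0, -1, -1, -1, -1, -1, -1, 1, 0, 0, 0, 0, 0, 0, 0, 0, 0, 0, 0, 0, 0, 0]]

/-- The weight of a word, as the multiplicities of the letters. -/
def weight (u : List (Fin 4)) : Fin 4 → ℕ := fun i => u.count i

theorem weight_append (u v : List (Fin 4)) : weight (u ++ v) = weight u + weight v := by
  funext i
  simp [weight]

theorem weight_cons (i : Fin 4) (u : List (Fin 4)) : weight (i :: u) = weight [i] + weight u :=
  weight_append [i] u

theorem weight_reverse (u : List (Fin 4)) : weight u.reverse = weight u := by
  funext i
  simp [weight]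

/-- The weight of a root, as a function of its index. -/
def rootWeight (b : Fin 24) : Fin 4 → ℕ := weight (lyndonTable b)

theorem weight_rootPath (b : Fin 24) : weight (rootPath b) = rootWeight b := by
  revert b
  decide +kernel

theorem rootPath_simpleIndex (i : Fin 4) : rootPath (simpleIndex i) = [i] := by
  revert i
  decide +kernel

/-- Where the sum is not a root, `adTarget` has the placeholder 0 and the coefficient vanishes. -/
theorem adCoeff_eq_zero_or (i : Fin 4) (b : Fin 24) :
    adCoeff i b = 0 ∨ rootWeight (adTarget i b) = weight [i] + rootWeight b := by
  revert i b
  decide +kernel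

/-- Here `A i` stands for the commutator with the `i`-th generator. The hypotheses `hi_b` either
define a root vector as a commutator or involve simple roots and a single relation. Each remaining
value follows by applying one Serre or commutation relation to a root vector for which the other
terms are already known. Vanishing values are written `0 • x 0` to agree with the placeholder in
`adTarget`. -/
theorem adCoeff_spec {V : Type*} [AddCommGroup V] [Module ℚ V] (A : Fin 4 → V →ₗ[ℚ] V)
    (c02 : ∀ z, A 0 (A 2 z) = A 2 (A 0 z)) (c03 : ∀ z, A 0 (A 3 z) = A 3 (A 0 z))
    (c13 : ∀ z, A 1 (A 3 z) = A 3 (A 1 z))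
    (s01 : ∀ z, A 0 (A 0 (A 1 z)) - (2 : ℚ) • A 0 (A 1 (A 0 z)) + A 1 (A 0 (A 0 z)) = 0)
    (s10 : ∀ z, A 1 (A 1 (A 0 z)) - (2 : ℚ) • A 1 (A 0 (A 1 z)) + A 0 (A 1 (A 1 z)) = 0)
    (s21 : ∀ z, A 2 (A 2 (A 1 z)) - (2 : ℚ) • A 2 (A 1 (A 2 z)) + A 1 (A 2 (A 2 z)) = 0)
    (s23 : ∀ z, A 2 (A 2 (A 3 z)) - (2 : ℚ) • A 2 (A 3 (A 2 z)) + A 3 (A 2 (A 2 z)) = 0)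
    (s32 : ∀ z, A 3 (A 3 (A 2 z)) - (2 : ℚ) • A 3 (A 2 (A 3 z)) + A 2 (A 3 (A 3 z)) = 0)
    (s12 : ∀ z, A 1 (A 1 (A 1 (A 2 z))) - (3 : ℚ) • A 1 (A 1 (A 2 (A 1 z))) +
      (3 : ℚ) • A 1 (A 2 (A 1 (A 1 z))) - A 2 (A 1 (A 1 (A 1 z))) = 0)
    (x : Fin 24 → V)
    (h0_0 : A 0 (x 0) = (0 : ℚ) • x 0)
    (h0_1 : A 0 (x 1) = (0 : ℚ) • x 0)
    (h0_2 : A 0 (x 2) = (1 : ℚ) • x 1)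
    (h0_4 : A 0 (x 4) = (1 : ℚ) • x 3)
    (h0_7 : A 0 (x 7) = (1 : ℚ) • x 5)
    (h0_8 : A 0 (x 8) = (0 : ℚ) • x 0)
    (h0_17 : A 0 (x 17) = (1 : ℚ) • x 13)
    (h0_21 : A 0 (x 21) = (1 : ℚ) • x 18)
    (h0_23 : A 0 (x 23) = (0 : ℚ) • x 0)
    (h1_0 : A 1 (x 0) = (-1 : ℚ) • x 1)
    (h1_1 : A 1 (x 1) = (0 : ℚ) • x 0)
    (h1_2 : A 1 (x 2) = (0 : ℚ) • x 0)
    (h1_5 : A 1 (x 5) = (1 : ℚ) • x 4)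
    (h1_6 : A 1 (x 6) = (0 : ℚ) • x 0)
    (h1_7 : A 1 (x 7) = (1 : ℚ) • x 6)
    (h1_8 : A 1 (x 8) = (1 : ℚ) • x 7)
    (h1_11 : A 1 (x 11) = (1 : ℚ) • x 10)
    (h1_12 : A 1 (x 12) = (1 : ℚ) • x 11)
    (h1_15 : A 1 (x 15) = (1 : ℚ) • x 14)
    (h1_18 : A 1 (x 18) = (1 : ℚ) • x 17)
    (h1_21 : A 1 (x 21) = (1 : ℚ) • x 20)
    (h1_22 : A 1 (x 22) = (1 : ℚ) • x 21)
    (h1_23 : A 1 (x 23) = (0 : ℚ) • x 0)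
    (h2_0 : A 2 (x 0) = (0 : ℚ) • x 0)
    (h2_2 : A 2 (x 2) = (-1 : ℚ) • x 7)
    (h2_7 : A 2 (x 7) = (0 : ℚ) • x 0)
    (h2_8 : A 2 (x 8) = (0 : ℚ) • x 0)
    (h2_10 : A 2 (x 10) = (1 : ℚ) • x 9)
    (h2_13 : A 2 (x 13) = (1 : ℚ) • x 12)
    (h2_17 : A 2 (x 17) = (1 : ℚ) • x 15)
    (h2_20 : A 2 (x 20) = (1 : ℚ) • x 19)
    (h2_22 : A 2 (x 22) = (0 : ℚ) • x 0)
    (h2_23 : A 2 (x 23) = (1 : ℚ) • x 22)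
    (h3_0 : A 3 (x 0) = (0 : ℚ) • x 0)
    (h3_2 : A 3 (x 2) = (0 : ℚ) • x 0)
    (h3_8 : A 3 (x 8) = (-1 : ℚ) • x 22)
    (h3_9 : A 3 (x 9) = (1 : ℚ) • x 16)
    (h3_22 : A 3 (x 22) = (0 : ℚ) • x 0)
    (h3_23 : A 3 (x 23) = (0 : ℚ) • x 0)
    (i : Fin 4) (b : Fin 24) : A i (x b) = adCoeff i b • x (adTarget i b) := by
  have h2_1 : A 2 (x 1) = (-1 : ℚ) • x 5 := by
    have h := c02 (x 2)
    simp only [h0_2, h0_7, h2_2, map_smul] at h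
    linear_combination (norm := module) (-1 : ℚ) • h
  have h3_1 : A 3 (x 1) = (0 : ℚ) • x 0 := by
    have h := c03 (x 2)
    simp only [h0_2, h3_2, map_smul] at h
    linear_combination (norm := module) (-1 : ℚ) • h
  have h3_7 : A 3 (x 7) = (-1 : ℚ) • x 21 := by
    have h := c13 (x 8)
    simp only [h1_8, h1_22, h3_8, map_smul] at h
    linear_combination (norm := module) (-1 : ℚ) • h
  have h0_22 : A 0 (x 22) = (0 : ℚ) • x 0 := by
    have h := c02 (x 23)
    simp only [h0_23, h2_23, map_smul] at h
    linear_combination (norm := module) (1 : ℚ) • h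
  have h0_5 : A 0 (x 5) = (0 : ℚ) • x 0 := by
    have h := s01 (x 8)
    simp only [h0_7, h0_8, h1_8, map_smul] at h
    linear_combination (norm := module) (1 : ℚ) • h
  have h2_5 : A 2 (x 5) = (0 : ℚ) • x 0 := by
    have h := c02 (x 7)
    simp only [h0_7, h2_7, map_smul] at h
    linear_combination (norm := module) (-1 : ℚ) • h
  have h3_5 : A 3 (x 5) = (-1 : ℚ) • x 18 := by
    have h := c03 (x 7)
    simp only [h0_7, h0_21, h3_7, map_smul] at h
    linear_combination (norm := module) (-1 : ℚ) • h
  have h0_6 : A 0 (x 6) = (2 : ℚ) • x 4 := by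
    have h := s10 (x 8)
    simp only [h0_7, h0_8, h1_5, h1_7, h1_8, map_smul] at h
    linear_combination (norm := module) (1 : ℚ) • h
  have h2_6 : A 2 (x 6) = (0 : ℚ) • x 0 := by
    have h := s21 (x 2)
    simp only [h1_2, h1_7, h2_2, h2_7, map_smul] at h
    linear_combination (norm := module) (1/2 : ℚ) • h
  have h3_6 : A 3 (x 6) = (-1 : ℚ) • x 20 := by
    have h := c13 (x 7)
    simp only [h1_7, h1_21, h3_7, map_smul] at h
    linear_combination (norm := module) (-1 : ℚ) • h
  have h2_21 : A 2 (x 21) = (0 : ℚ) • x 0 := by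
    have h := s21 (x 23)
    simp only [h1_22, h1_23, h2_22, h2_23, map_smul] at h
    linear_combination (norm := module) (-1/2 : ℚ) • h
  have h3_21 : A 3 (x 21) = (0 : ℚ) • x 0 := by
    have h := c13 (x 22)
    simp only [h1_22, h3_22, map_smul] at h
    linear_combination (norm := module) (-1 : ℚ) • h
  have h1_4 : A 1 (x 4) = (0 : ℚ) • x 0 := by
    have h := s10 (x 7)
    simp only [h0_6, h0_7, h1_5, h1_6, h1_7, map_smul] at h
    -- The unknown value occurs with total coefficient `1 - 2 * 2 + 0 = -3`; here and below it is
    -- found by dividing by such an integer.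
    linear_combination (norm := module) ((-1/3) : ℚ) • h
  have h2_4 : A 2 (x 4) = (0 : ℚ) • x 0 := by
    have h := c02 (x 6)
    simp only [h0_6, h2_6, map_smul] at h
    linear_combination (norm := module) (-1/2 : ℚ) • h
  have h3_4 : A 3 (x 4) = (-1 : ℚ) • x 17 := by
    have h := c13 (x 5)
    simp only [h1_5, h1_18, h3_5, map_smul] at h
    linear_combination (norm := module) (-1 : ℚ) • h
  have h0_18 : A 0 (x 18) = (0 : ℚ) • x 0 := by
    have h := s01 (x 22)
    simp only [h0_21, h0_22, h1_22, map_smul] at h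
    linear_combination (norm := module) (1 : ℚ) • h
  have h2_18 : A 2 (x 18) = (0 : ℚ) • x 0 := by
    have h := c02 (x 21)
    simp only [h0_21, h2_21, map_smul] at h
    linear_combination (norm := module) (-1 : ℚ) • h
  have h3_18 : A 3 (x 18) = (0 : ℚ) • x 0 := by
    have h := c03 (x 21)
    simp only [h0_21, h3_21, map_smul] at h
    linear_combination (norm := module) (-1 : ℚ) • h
  have h0_20 : A 0 (x 20) = (2 : ℚ) • x 17 := by
    have h := c03 (x 6)
    simp only [h0_6, h3_4, h3_6, map_smul] at h
    linear_combination (norm := module) (-1 : ℚ) • h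
  have h1_20 : A 1 (x 20) = (0 : ℚ) • x 0 := by
    have h := s12 (x 23)
    simp only [h1_21, h1_22, h1_23, h2_23, map_smul] at h
    linear_combination (norm := module) (1 : ℚ) • h
  have h3_20 : A 3 (x 20) = (0 : ℚ) • x 0 := by
    have h := c13 (x 21)
    simp only [h1_21, h3_21, map_smul] at h
    linear_combination (norm := module) (-1 : ℚ) • h
  have h0_3 : A 0 (x 3) = (0 : ℚ) • x 0 := by
    have h := s01 (x 5)
    simp only [h0_4, h0_5, h1_5, map_smul] at h
    linear_combination (norm := module) (1 : ℚ) • h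
  have h1_3 : A 1 (x 3) = (0 : ℚ) • x 0 := by
    have h := s01 (x 6)
    simp only [h0_4, h0_6, h1_4, h1_6, map_smul] at h
    linear_combination (norm := module) (1/2 : ℚ) • h
  have h2_3 : A 2 (x 3) = (0 : ℚ) • x 0 := by
    have h := c02 (x 4)
    simp only [h0_4, h2_4, map_smul] at h
    linear_combination (norm := module) (-1 : ℚ) • h
  have h3_3 : A 3 (x 3) = (-1 : ℚ) • x 13 := by
    have h := c03 (x 4)
    simp only [h0_4, h0_17, h3_4, map_smul] at h
    linear_combination (norm := module) (-1 : ℚ) • h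
  have h1_17 : A 1 (x 17) = (0 : ℚ) • x 0 := by
    have h := s10 (x 21)
    simp only [h0_20, h0_21, h1_18, h1_20, h1_21, map_smul] at h
    linear_combination (norm := module) ((-1/3) : ℚ) • h
  have h3_17 : A 3 (x 17) = (0 : ℚ) • x 0 := by
    have h := c03 (x 20)
    simp only [h0_20, h3_20, map_smul] at h
    linear_combination (norm := module) (-1/2 : ℚ) • h
  have h0_19 : A 0 (x 19) = (2 : ℚ) • x 15 := by
    have h := c02 (x 20)
    simp only [h0_20, h2_17, h2_20, map_smul] at h
    linear_combination (norm := module) (1 : ℚ) • h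
  have h1_19 : A 1 (x 19) = (0 : ℚ) • x 0 := by
    have h := s12 (x 22)
    simp only [h1_20, h1_21, h1_22, h2_20, h2_21, h2_22, map_smul] at h
    linear_combination (norm := module) ((1/3) : ℚ) • h
  have h2_19 : A 2 (x 19) = (0 : ℚ) • x 0 := by
    have h := s21 (x 21)
    simp only [h1_21, h2_20, h2_21, map_smul] at h
    linear_combination (norm := module) (1 : ℚ) • h
  have h3_19 : A 3 (x 19) = (0 : ℚ) • x 0 := by
    have h := s32 (x 6)
    simp only [h2_6, h2_20, h3_6, h3_20, map_smul] at h
    linear_combination (norm := module) (1/2 : ℚ) • h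
  have h0_13 : A 0 (x 13) = (0 : ℚ) • x 0 := by
    have h := s01 (x 18)
    simp only [h0_17, h0_18, h1_18, map_smul] at h
    linear_combination (norm := module) (1 : ℚ) • h
  have h1_13 : A 1 (x 13) = (0 : ℚ) • x 0 := by
    have h := s01 (x 20)
    simp only [h0_17, h0_20, h1_17, h1_20, map_smul] at h
    linear_combination (norm := module) (1/2 : ℚ) • h
  have h3_13 : A 3 (x 13) = (0 : ℚ) • x 0 := by
    have h := c03 (x 17)
    simp only [h0_17, h3_17, map_smul] at h
    linear_combination (norm := module) (-1 : ℚ) • h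
  have h0_15 : A 0 (x 15) = (1 : ℚ) • x 12 := by
    have h := c02 (x 17)
    simp only [h0_17, h2_13, h2_17, map_smul] at h
    linear_combination (norm := module) (1 : ℚ) • h
  have h2_15 : A 2 (x 15) = (0 : ℚ) • x 0 := by
    have h := c02 (x 19)
    simp only [h0_19, h2_19, map_smul] at h
    linear_combination (norm := module) (-1/2 : ℚ) • h
  have h3_15 : A 3 (x 15) = (0 : ℚ) • x 0 := by
    have h := c03 (x 19)
    simp only [h0_19, h3_19, map_smul] at h
    linear_combination (norm := module) (-1/2 : ℚ) • h
  have h0_12 : A 0 (x 12) = (0 : ℚ) • x 0 := by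
    have h := c02 (x 13)
    simp only [h0_13, h2_13, map_smul] at h
    linear_combination (norm := module) (1 : ℚ) • h
  have h2_12 : A 2 (x 12) = (0 : ℚ) • x 0 := by
    have h := c02 (x 15)
    simp only [h0_15, h2_15, map_smul] at h
    linear_combination (norm := module) (-1 : ℚ) • h
  have h3_12 : A 3 (x 12) = (0 : ℚ) • x 0 := by
    have h := c03 (x 15)
    simp only [h0_15, h3_15, map_smul] at h
    linear_combination (norm := module) (-1 : ℚ) • h
  have h0_14 : A 0 (x 14) = (1/2 : ℚ) • x 11 := by
    have h := s01 (x 19)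
    simp only [h0_15, h0_19, h1_12, h1_15, h1_19, map_smul] at h
    linear_combination (norm := module) ((-1/4) : ℚ) • h
  have h1_14 : A 1 (x 14) = (0 : ℚ) • x 0 := by
    have h := s10 (x 19)
    simp only [h0_19, h1_15, h1_19, map_smul] at h
    linear_combination (norm := module) (1/2 : ℚ) • h
  have h2_14 : A 2 (x 14) = (0 : ℚ) • x 0 := by
    have h := s21 (x 17)
    simp only [h1_15, h1_17, h2_15, h2_17, map_smul] at h
    linear_combination (norm := module) (-1/2 : ℚ) • h
  have h3_14 : A 3 (x 14) = (0 : ℚ) • x 0 := by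
    have h := c13 (x 15)
    simp only [h1_15, h3_15, map_smul] at h
    linear_combination (norm := module) (-1 : ℚ) • h
  have h0_11 : A 0 (x 11) = (0 : ℚ) • x 0 := by
    have h := s01 (x 15)
    simp only [h0_12, h0_14, h0_15, h1_12, h1_15, map_smul] at h
    linear_combination (norm := module) ((-2/3) : ℚ) • h
  have h2_11 : A 2 (x 11) = (0 : ℚ) • x 0 := by
    have h := c02 (x 14)
    simp only [h0_14, h2_14, map_smul] at h
    linear_combination (norm := module) ((-2) : ℚ) • h
  have h3_11 : A 3 (x 11) = (0 : ℚ) • x 0 := by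
    have h := c03 (x 14)
    simp only [h0_14, h3_14, map_smul] at h
    linear_combination (norm := module) ((-2) : ℚ) • h
  have h0_10 : A 0 (x 10) = (0 : ℚ) • x 0 := by
    have h := s01 (x 14)
    simp only [h0_11, h0_14, h1_11, h1_14, map_smul] at h
    linear_combination (norm := module) (-1 : ℚ) • h
  have h1_10 : A 1 (x 10) = (0 : ℚ) • x 0 := by
    have h := s10 (x 14)
    simp only [h0_14, h1_11, h1_14, map_smul] at h
    linear_combination (norm := module) (2 : ℚ) • h
  have h3_10 : A 3 (x 10) = (0 : ℚ) • x 0 := by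
    have h := c13 (x 11)
    simp only [h1_11, h3_11, map_smul] at h
    linear_combination (norm := module) (-1 : ℚ) • h
  have h0_9 : A 0 (x 9) = (0 : ℚ) • x 0 := by
    have h := c02 (x 10)
    simp only [h0_10, h2_10, map_smul] at h
    linear_combination (norm := module) (1 : ℚ) • h
  have h1_9 : A 1 (x 9) = (0 : ℚ) • x 0 := by
    have h := s12 (x 12)
    simp only [h1_10, h1_11, h1_12, h2_10, h2_11, h2_12, map_smul] at h
    linear_combination (norm := module) ((1/3) : ℚ) • h
  have h2_9 : A 2 (x 9) = (0 : ℚ) • x 0 := by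
    have h := s21 (x 11)
    simp only [h1_11, h2_10, h2_11, map_smul] at h
    linear_combination (norm := module) (1 : ℚ) • h
  have h0_16 : A 0 (x 16) = (0 : ℚ) • x 0 := by
    have h := c03 (x 9)
    simp only [h0_9, h3_9, map_smul] at h
    linear_combination (norm := module) (1 : ℚ) • h
  have h1_16 : A 1 (x 16) = (0 : ℚ) • x 0 := by
    have h := c13 (x 9)
    simp only [h1_9, h3_9, map_smul] at h
    linear_combination (norm := module) (1 : ℚ) • h
  have h2_16 : A 2 (x 16) = (0 : ℚ) • x 0 := by
    have h := s23 (x 10)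
    simp only [h2_9, h2_10, h3_9, h3_10, map_smul] at h
    linear_combination (norm := module) (-1/2 : ℚ) • h
  have h3_16 : A 3 (x 16) = (0 : ℚ) • x 0 := by
    have h := s32 (x 10)
    simp only [h2_10, h3_9, h3_10, map_smul] at h
    linear_combination (norm := module) (1 : ℚ) • h
  fin_cases i
  · fin_cases b
    exacts [h0_0, h0_1, h0_2, h0_3, h0_4, h0_5, h0_6, h0_7, h0_8, h0_9, h0_10, h0_11, h0_12,
      h0_13, h0_14, h0_15, h0_16, h0_17, h0_18, h0_19, h0_20, h0_21, h0_22, h0_23]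
  · fin_cases b
    exacts [h1_0, h1_1, h1_2, h1_3, h1_4, h1_5, h1_6, h1_7, h1_8, h1_9, h1_10, h1_11, h1_12,
      h1_13, h1_14, h1_15, h1_16, h1_17, h1_18, h1_19, h1_20, h1_21, h1_22, h1_23]
  · fin_cases b
    exacts [h2_0, h2_1, h2_2, h2_3, h2_4, h2_5, h2_6, h2_7, h2_8, h2_9, h2_10, h2_11, h2_12,
      h2_13, h2_14, h2_15, h2_16, h2_17, h2_18, h2_19, h2_20, h2_21, h2_22, h2_23]
  · fin_cases b
    exacts [h3_0, h3_1, h3_2, h3_3, h3_4, h3_5, h3_6, h3_7, h3_8, h3_9, h3_10, h3_11, h3_12,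
      h3_13, h3_14, h3_15, h3_16, h3_17, h3_18, h3_19, h3_20, h3_21, h3_22, h3_23]


end RootVectors

end QuantumShuffle

namespace QuantumShuffle

open ShuffleAlgebra

/-! ### Computation in the shuffle algebra with lists of monomials -/

section Terms

/-- The quantum shuffle algebra of type `F₄`. -/
abbrev ShuffleF4 : Type := ShuffleAlgebra formF4

/-- The bilinear form of type `F₄`, as a table. -/
def formTable (i j : Fin 4) : ℤ :=
  ([[2, -1, 0, 0], [-1, 2, -2, 0], [0, -2, 4, -2], [0, 0, -2, 4]].getD i []).getD j 0

theorem formTable_eq (i j : Fin 4) : formTable i j = formF4 i j := by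
  revert i j
  decide

/-- A monomial `c q ^ e [u]`, encoded as `((u, e), c)`. -/
abbrev Term : Type := (List (Fin 4) × ℤ) × ℤ

/-- The element of the shuffle algebra that a sum of monomials stands for. -/
noncomputable def evalTerms (t : List Term) : ShuffleF4 :=
  (t.map fun x => ((x.2 : K) * (RatFunc.X : K) ^ x.1.2) • word formF4 x.1.1).sum

/-- The shuffles of `i :: u` with a word, given the shuffles `F` of `u` with all words. -/
def shuffleTermsCons (F : List (Fin 4) → List (List (Fin 4) × ℤ)) (i : Fin 4) (u : List (Fin 4)) :
    List (Fin 4) → List (List (Fin 4) × ℤ)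
  | [] => [(i :: u, 0)]
  | j :: v => (F (j :: v)).map (fun x => (i :: x.1, x.2)) ++
      (shuffleTermsCons F i u v).map fun x =>
        (j :: x.1, x.2 - ((i :: u).map fun a => formTable a j).sum)

/-- The shuffles of two words, with the exponents of `q` that they come with. -/
def shuffleTerms : List (Fin 4) → List (Fin 4) → List (List (Fin 4) × ℤ)
  | [] => fun v => [(v, 0)]
  | i :: u => shuffleTermsCons (shuffleTerms u) i u

/-- The product of two sums of monomials. -/
def mulTerms (s t : List Term) : List Term :=
  s.flatMap fun x => t.flatMap fun y =>
    (shuffleTerms x.1.1 y.1.1).map fun z => ((z.1, z.2 + x.1.2 + y.1.2), x.2 * y.2)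

/-- The product of a sum of monomials with the scalar `c q ^ e`. -/
def scaleTerms (e c : ℤ) (t : List Term) : List Term :=
  t.map fun x => ((x.1.1, x.1.2 + e), c * x.2)

/-- The comparison of words. -/
def wordBeq : List (Fin 4) → List (Fin 4) → Bool
  | [], [] => true
  | i :: u, j :: v => Nat.beq i.val j.val && wordBeq u v
  | _, _ => false

theorem eq_of_wordBeq {u v : List (Fin 4)} (h : wordBeq u v = true) : u = v := by
  induction u generalizing v with
  | nil =>
    cases v with
    | nil => rfl
    | cons j v => simp [wordBeq] at h
  | cons i u ih =>
    cases v with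
    | nil => simp [wordBeq] at h
    | cons j v =>
      rw [wordBeq, Bool.and_eq_true] at h
      rw [ih h.2, Fin.ext (Nat.eq_of_beq_eq_true h.1)]

/-- Adds a monomial to a sum of monomials. -/
def addTerm (k : List (Fin 4) × ℤ) (c : ℤ) : List Term → List Term
  | [] => [(k, c)]
  | x :: t => if wordBeq x.1.1 k.1 && decide (x.1.2 = k.2) then (k, c + x.2) :: t
      else x :: addTerm k c t

/-- Collects equal monomials. -/
def collectTerms (t : List Term) : List Term :=
  (t.foldr (fun x acc => addTerm x.1 x.2 acc) []).filter fun x => x.2 ≠ 0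

@[simp] theorem evalTerms_nil : evalTerms [] = 0 := rfl

theorem evalTerms_cons (x : Term) (t : List Term) :
    evalTerms (x :: t) =
      ((x.2 : K) * (RatFunc.X : K) ^ x.1.2) • word formF4 x.1.1 + evalTerms t := by
  simp [evalTerms]

theorem evalTerms_append (s t : List Term) : evalTerms (s ++ t) = evalTerms s + evalTerms t := by
  simp [evalTerms]

theorem evalTerms_scaleTerms (e c : ℤ) (t : List Term) :
    evalTerms (scaleTerms e c t) = ((c : K) * (RatFunc.X : K) ^ e) • evalTerms t := by
  induction t with
  | nil => simp [scaleTerms]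
  | cons x t ih =>
    rw [scaleTerms, List.map_cons, evalTerms_cons, ← scaleTerms, ih, evalTerms_cons, smul_add,
      smul_smul, X_zpow_add]
    congr 2
    push_cast
    ring

theorem evalTerms_addTerm (k : List (Fin 4) × ℤ) (c : ℤ) (t : List Term) :
    evalTerms (addTerm k c t) =
      ((c : K) * (RatFunc.X : K) ^ k.2) • word formF4 k.1 + evalTerms t := by
  induction t with
  | nil => simp [addTerm, evalTerms_cons]
  | cons x t ih =>
    rw [addTerm]
    split_ifs with h
    · rw [Bool.and_eq_true, decide_eq_true_eq] at h
      obtain rfl : x.1 = k := Prod.ext (eq_of_wordBeq h.1) h.2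
      rw [evalTerms_cons, evalTerms_cons, ← add_assoc, ← add_smul]
      push_cast
      rw [add_mul]
    · rw [evalTerms_cons, ih, evalTerms_cons]
      abel

theorem evalTerms_filter_ne_zero (t : List Term) :
    evalTerms (t.filter fun x => x.2 ≠ 0) = evalTerms t := by
  induction t with
  | nil => simp
  | cons x t ih =>
    rw [List.filter_cons]
    split_ifs with h
    · rw [evalTerms_cons, ih, evalTerms_cons]
    · have : x.2 = 0 := by simpa using h
      rw [ih, evalTerms_cons, this]
      simp

theorem evalTerms_collectTerms (t : List Term) : evalTerms (collectTerms t) = evalTerms t := by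
  rw [collectTerms, evalTerms_filter_ne_zero]
  induction t with
  | nil => rfl
  | cons x t ih => rw [List.foldr_cons, evalTerms_addTerm, ih, evalTerms_cons]

theorem evalTerms_map_add_exponent {t : List (List (Fin 4) × ℤ)} (j : Fin 4) (d : ℤ) :
    evalTerms (t.map fun x => ((j :: x.1, x.2 + d), 1)) =
      (RatFunc.X : K) ^ d • consL formF4 j (evalTerms (t.map fun x => (x, 1))) := by
  induction t with
  | nil => simp
  | cons x t ih =>
    simp only [List.map_cons, evalTerms_cons] at ih ⊢
    rw [ih, map_add, smul_add, map_smul, consL_word, smul_smul, X_zpow_add]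
    congr 2
    ring

/-- Connects the structurally recursive enumeration, suited to evaluation by `decide +kernel`, with
the actual product. -/
theorem evalTerms_shuffleTerms (u v : List (Fin 4)) :
    evalTerms ((shuffleTerms u v).map fun x => (x, 1)) = shuffleList formF4 u v := by
  induction u generalizing v with
  | nil => simp [shuffleTerms, evalTerms]
  | cons i u ihu =>
    induction v with
    | nil => simp [shuffleTerms, shuffleTermsCons, evalTerms]
    | cons j v ihv =>
      have e1 := evalTerms_map_add_exponent (t := shuffleTerms u (j :: v)) i 0
      have e2 := evalTerms_map_add_exponent (t := shuffleTerms (i :: u) v) j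
        (-(pairing formF4 (i :: u) j))
      have e3 : ((i :: u).map fun a => formTable a j).sum = pairing formF4 (i :: u) j := by
        simp only [formTable_eq, pairing]
      rw [shuffleList_cons_cons, ← ihu, ← ihv, ← e2]
      rw [zpow_zero, one_smul] at e1
      rw [← e1, shuffleTerms, shuffleTermsCons, List.map_append, evalTerms_append, List.map_map,
        List.map_map, e3, ← shuffleTerms]
      simp only [add_zero, Function.comp_def, sub_eq_add_neg]

theorem evalTerms_mulTerms (s t : List Term) :
    evalTerms (mulTerms s t) = evalTerms s * evalTerms t := by
  have h1 : ∀ (x y : Term), evalTerms ((shuffleTerms x.1.1 y.1.1).map fun z =>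
      ((z.1, z.2 + x.1.2 + y.1.2), x.2 * y.2)) =
      (((x.2 : K) * (RatFunc.X : K) ^ x.1.2) • word formF4 x.1.1) *
        (((y.2 : K) * (RatFunc.X : K) ^ y.1.2) • word formF4 y.1.1) := by
    intro x y
    have e : ((shuffleTerms x.1.1 y.1.1).map fun z =>
        (((z.1, z.2 + x.1.2 + y.1.2), x.2 * y.2) : Term)) =
        scaleTerms (x.1.2 + y.1.2) (x.2 * y.2)
          ((shuffleTerms x.1.1 y.1.1).map fun z => (z, 1)) := by
      simp [scaleTerms, add_assoc, Function.comp_def]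
    rw [e, evalTerms_scaleTerms, evalTerms_shuffleTerms, smul_mul_smul_comm, word_mul_word,
      X_zpow_add]
    congr 1
    push_cast
    ring
  have h2 : ∀ (x : Term) (t : List Term), evalTerms (t.flatMap fun y =>
      (shuffleTerms x.1.1 y.1.1).map fun z => ((z.1, z.2 + x.1.2 + y.1.2), x.2 * y.2)) =
      (((x.2 : K) * (RatFunc.X : K) ^ x.1.2) • word formF4 x.1.1) * evalTerms t := by
    intro x t
    induction t with
    | nil => simp
    | cons y t ih =>
      rw [List.flatMap_cons, evalTerms_append, h1, ih, evalTerms_cons, mul_add]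
  induction s with
  | nil => simp [mulTerms]
  | cons x s ih =>
    rw [mulTerms, List.flatMap_cons, evalTerms_append, h2, ← mulTerms, ih, evalTerms_cons, add_mul]

/-- Turns an identity in the shuffle algebra into a decidable statement about lists; only this
direction is needed. -/
theorem evalTerms_eq_zero {t : List Term} (h : collectTerms t = []) : evalTerms t = 0 := by
  rw [← evalTerms_collectTerms, h, evalTerms_nil]

end Terms

/-! ### The quantum Serre relations between the letters -/

section QuantumSerre

/-- The letter `[i]`, as a sum of monomials. -/
def letterTerm (i : Fin 4) : List Term := [(([i], 0), 1)]

/-- The product of letters, as a sum of monomials. -/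
def letterTerms : List (Fin 4) → List Term
  | [] => [(([], 0), 1)]
  | i :: u => mulTerms (letterTerm i) (letterTerms u)

theorem evalTerms_letterTerms (u : List (Fin 4)) :
    evalTerms (letterTerms u) = (u.map fun i => word formF4 [i]).prod := by
  induction u with
  | nil => simp [letterTerms, evalTerms, one_def]
  | cons i u ih =>
    rw [letterTerms, evalTerms_mulTerms, ih, List.map_cons, List.prod_cons]
    congr 1
    simp [letterTerm, evalTerms]

theorem word_mul_comm_of_terms {i j : Fin 4}
    (h : collectTerms (letterTerms [i, j] ++ scaleTerms 0 (-1) (letterTerms [j, i])) = []) :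
    word formF4 [i] * word formF4 [j] = word formF4 [j] * word formF4 [i] := by
  have := evalTerms_eq_zero h
  rw [evalTerms_append, evalTerms_scaleTerms, evalTerms_letterTerms, evalTerms_letterTerms] at this
  rw [← sub_eq_zero, ← this]
  simp [sub_eq_add_neg]

/-- With `d = (α_i, α_i) / 2`, this is the quantum Serre relation for Cartan integer `-1`,
multiplied by `q ^ d` so that all coefficients lie in `ℚ[q]` and can be evaluated at `q = 1`. -/
theorem quantumSerre_of_terms {i j : Fin 4} (d : ℕ)
    (h : collectTerms (scaleTerms d 1 (letterTerms [i, i, j]) ++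
      (scaleTerms (2 * d : ℕ) (-1) (letterTerms [i, j, i]) ++
      (scaleTerms 0 (-1) (letterTerms [i, j, i]) ++
      scaleTerms d 1 (letterTerms [j, i, i])))) = []) :
    (RatFunc.X : K) ^ d • (word formF4 [i] * (word formF4 [i] * word formF4 [j])) -
      ((RatFunc.X : K) ^ (2 * d) + 1) • (word formF4 [i] * (word formF4 [j] * word formF4 [i])) +
      (RatFunc.X : K) ^ d • (word formF4 [j] * (word formF4 [i] * word formF4 [i])) = 0 := by
  have := evalTerms_eq_zero h
  simp only [evalTerms_append, evalTerms_scaleTerms, evalTerms_letterTerms, zpow_natCast,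
    List.map_cons, List.map_nil, List.prod_cons, List.prod_nil, mul_one, zpow_zero, Int.cast_neg,
    Int.cast_one] at this
  rw [← this]
  simp only [one_mul, neg_mul, neg_smul, one_smul, add_smul]
  abel

/-- The relation for the double bond, with Cartan integer `-2`. The quantum integer `q ^ 2 + 1 + q ^
(-2)` has been multiplied by `q ^ 2`. -/
theorem quantumSerre_quartic :
    (RatFunc.X : K) ^ 2 • (word formF4 [1] * (word formF4 [1] * (word formF4 [1] *
        word formF4 [2]))) -
      ((RatFunc.X : K) ^ 4 + RatFunc.X ^ 2 + 1) • (word formF4 [1] * (word formF4 [1] *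
        (word formF4 [2] * word formF4 [1]))) +
      ((RatFunc.X : K) ^ 4 + RatFunc.X ^ 2 + 1) • (word formF4 [1] * (word formF4 [2] *
        (word formF4 [1] * word formF4 [1]))) -
      (RatFunc.X : K) ^ 2 • (word formF4 [2] * (word formF4 [1] * (word formF4 [1] *
        word formF4 [1]))) = 0 := by
  have h : collectTerms (scaleTerms (2 : ℕ) 1 (letterTerms [1, 1, 1, 2]) ++
      (scaleTerms (4 : ℕ) (-1) (letterTerms [1, 1, 2, 1]) ++
      (scaleTerms (2 : ℕ) (-1) (letterTerms [1, 1, 2, 1]) ++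
      (scaleTerms 0 (-1) (letterTerms [1, 1, 2, 1]) ++
      (scaleTerms (4 : ℕ) 1 (letterTerms [1, 2, 1, 1]) ++
      (scaleTerms (2 : ℕ) 1 (letterTerms [1, 2, 1, 1]) ++
      (scaleTerms 0 1 (letterTerms [1, 2, 1, 1]) ++
      scaleTerms (2 : ℕ) (-1) (letterTerms [2, 1, 1, 1])))))))) = [] := by
    decide +kernel
  have := evalTerms_eq_zero h
  simp only [evalTerms_append, evalTerms_scaleTerms, evalTerms_letterTerms, zpow_natCast,
    List.map_cons, List.map_nil, List.prod_cons, List.prod_nil, mul_one, zpow_zero, Int.cast_neg,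
    Int.cast_one] at this
  rw [← this]
  simp only [one_mul, neg_mul, neg_smul, one_smul, add_smul]
  abel

end QuantumSerre

/-! ### Certificates for the good elements -/

section GoodElements

/-- The Laurent polynomial `(q + q⁻¹) ^ n` for `n ≤ 2`, as a list of exponents and coefficients. -/
def twoPow : ℕ → List (ℤ × ℤ)
  | 0 => [(0, 1)]
  | 1 => [(-1, 1), (1, 1)]
  | _ => [(-2, 1), (0, 2), (2, 1)]

/-- Elements of the subalgebra generated by the letters whose smallest words are the good Lyndon
words, except the longest one: `(u, n)` stands for `(q + q⁻¹) ^ n u`. -/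
def goodTable : Fin 24 → List (List (Fin 4) × ℕ) :=
  ![[([0], 0)],
    [([0, 1], 0)],
    [([1], 0)],
    [([0, 1, 0, 1, 2], 0), ([0, 0, 1, 1, 2], 1)],
    [([1, 0, 1, 2], 0), ([0, 1, 1, 2], 1)],
    [([0, 1, 2], 0)],
    [([1, 1, 2], 0)],
    [([1, 2], 0)],
    [([2], 0)],
    [([2, 1, 1, 2, 0, 1, 0, 1, 2, 3], 1), ([2, 1, 1, 0, 2, 1, 0, 1, 2, 3], 1),
      ([2, 1, 0, 1, 2, 1, 0, 1, 2, 3], 0), ([2, 1, 1, 2, 0, 0, 1, 1, 2, 3], 2),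
      ([2, 1, 1, 0, 2, 0, 1, 1, 2, 3], 2), ([2, 1, 0, 1, 2, 0, 1, 1, 2, 3], 1),
      ([2, 1, 1, 0, 0, 2, 1, 1, 2, 3], 2), ([2, 1, 0, 1, 0, 2, 1, 1, 2, 3], 1)],
    [([1, 1, 2, 0, 1, 0, 1, 2, 3], 1), ([1, 1, 0, 2, 1, 0, 1, 2, 3], 1),
      ([1, 0, 1, 2, 1, 0, 1, 2, 3], 0), ([1, 1, 2, 0, 0, 1, 1, 2, 3], 2),
      ([1, 1, 0, 2, 0, 1, 1, 2, 3], 2), ([1, 0, 1, 2, 0, 1, 1, 2, 3], 1),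
      ([1, 1, 0, 0, 2, 1, 1, 2, 3], 2), ([1, 0, 1, 0, 2, 1, 1, 2, 3], 1)],
    [([1, 2, 0, 1, 0, 1, 2, 3], 1), ([1, 0, 2, 1, 0, 1, 2, 3], 1),
      ([0, 1, 2, 1, 0, 1, 2, 3], 0), ([1, 2, 0, 0, 1, 1, 2, 3], 2),
      ([1, 0, 2, 0, 1, 1, 2, 3], 2), ([0, 1, 2, 0, 1, 1, 2, 3], 1),
      ([1, 0, 0, 2, 1, 1, 2, 3], 2), ([0, 1, 0, 2, 1, 1, 2, 3], 1)],
    [([2, 0, 1, 0, 1, 2, 3], 0), ([0, 2, 1, 0, 1, 2, 3], 0),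
      ([2, 0, 0, 1, 1, 2, 3], 1), ([0, 2, 0, 1, 1, 2, 3], 1),
      ([0, 0, 2, 1, 1, 2, 3], 1)],
    [([0, 1, 0, 1, 2, 3], 0), ([0, 0, 1, 1, 2, 3], 1)],
    [([1, 2, 1, 0, 1, 2, 3], 0), ([1, 2, 0, 1, 1, 2, 3], 1),
      ([1, 0, 2, 1, 1, 2, 3], 1)],
    [([2, 1, 0, 1, 2, 3], 0), ([2, 0, 1, 1, 2, 3], 1),
      ([0, 2, 1, 1, 2, 3], 1)],
    [],
    [([1, 0, 1, 2, 3], 0), ([0, 1, 1, 2, 3], 1)],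
    [([0, 1, 2, 3], 0)],
    [([2, 1, 1, 2, 3], 0)],
    [([1, 1, 2, 3], 0)],
    [([1, 2, 3], 0)],
    [([2, 3], 0)],
    [([3], 0)]]

/-- An entry `(b, c, k, a)` means that the corresponding good element is
`(q ^ a - q ^ (-a))⁻¹ (x_b x_c - q ^ k x_c x_b)`, where `x_b` and `x_c` are good elements. -/
def goodRec : Fin 24 → Fin 24 × Fin 24 × ℤ × ℤ :=
  ![(0, 0, 0, 0), (0, 2, -1, 1), (2, 2, 0, 0), (0, 4, 0, 2), (2, 5, -1, 1),
    (0, 7, -1, 1), (2, 7, 0, 2), (2, 8, -2, 2), (8, 8, 0, 0), (8, 10, -2, 2),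
    (2, 11, 0, 2), (2, 12, -2, 1), (8, 13, -2, 2), (0, 17, 0, 2), (2, 15, -1, 1),
    (8, 17, -2, 2), (16, 16, 0, 0), (2, 18, -1, 1), (0, 21, -1, 1), (8, 20, -2, 2),
    (2, 21, 0, 2), (2, 22, -2, 2), (8, 23, -2, 2), (23, 23, 0, 0)]

/-- The sum of monomials that an entry of `goodTable` stands for. -/
def goodTableTerms (b : Fin 24) : List Term :=
  (goodTable b).flatMap fun x => (twoPow x.2).map fun y => ((x.1.reverse, y.1), y.2)

/-- The `q`-commutator of two sums of monomials. -/
def commTerms (k : ℤ) (s t : List Term) : List Term :=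
  mulTerms s t ++ scaleTerms k (-1) (mulTerms t s)

/-- The good elements, as sums of monomials. -/
def goodTerms (b : Fin 24) : List Term :=
  if b = 16 then commTerms 0 (goodTableTerms 15) (goodTableTerms 17) else goodTableTerms b

/-- The recursion is checked with the denominator `q ^ a - q ^ (-a)` cleared. For the four letters
the entry has `a = 0` and reads `0 = 0`. Index 16 is excluded because its element is defined
directly as a commutator. -/
theorem goodRec_spec (b : Fin 24) (hb : b ≠ 16) :
    collectTerms (commTerms (goodRec b).2.2.1 (goodTableTerms (goodRec b).1)
        (goodTableTerms (goodRec b).2.1) ++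
      (scaleTerms (goodRec b).2.2.2 (-1) (goodTableTerms b) ++
        scaleTerms (-(goodRec b).2.2.2) 1 (goodTableTerms b))) = [] := by
  revert b
  decide +kernel

end GoodElements

end QuantumShuffle

namespace QuantumShuffle

open ShuffleAlgebra Polynomial

/-! ### Commutators of root vectors under the Serre relations -/

section Brackets

variable {C : Type*} [Ring C]

/-- The iterated commutator of the letters of a word, associated to the right. -/
def nestedBracket {ι : Type*} (e : ι → C) : List ι → C
  | [] => 0
  | [i] => e i
  | i :: j :: u => ⁅e i, nestedBracket e (j :: u)⁆

theorem nestedBracket_cons {ι : Type*} (e : ι → C) (i : ι) {u : List ι} (hu : u ≠ []) :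
    nestedBracket e (i :: u) = ⁅e i, nestedBracket e u⁆ := by
  cases u with
  | nil => exact absurd rfl hu
  | cons j u => rfl

theorem map_nestedBracket {D ι : Type*} [Ring D] (f : C →+* D) (e : ι → C) (u : List ι) :
    f (nestedBracket e u) = nestedBracket (fun i => f (e i)) u := by
  induction u with
  | nil => simp [nestedBracket]
  | cons i u ih =>
    rcases eq_or_ne u [] with rfl | hu
    · rfl
    · rw [nestedBracket_cons _ _ hu, nestedBracket_cons _ _ hu, ← ih]
      simp [Ring.lie_def]

/-- The root vectors, as iterated commutators of Chevalley generators. -/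
def rootVector (e : Fin 4 → C) (b : Fin 24) : C := nestedBracket e (rootPath b)

theorem lie_lie_left (a b z : C) : ⁅⁅a, b⁆, z⁆ = ⁅a, ⁅b, z⁆⁆ - ⁅b, ⁅a, z⁆⁆ := by
  simp only [Ring.lie_def]
  noncomm_ring

variable [Algebra ℚ C]

/-- The commutator with `a`, as a linear map. -/
def commL (a : C) : C →ₗ[ℚ] C := LinearMap.mulLeft ℚ a - LinearMap.mulRight ℚ a

theorem commL_apply (a z : C) : commL a z = ⁅a, z⁆ := rfl

theorem three_smul_rat {V : Type*} [AddCommGroup V] [Module ℚ V] (x : V) :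
    (3 : ℚ) • x = x + x + x := by
  rw [show (3 : ℚ) = 1 + 1 + 1 by norm_num, add_smul, add_smul, one_smul]

theorem lie_eq_neg_smul (a b : C) : ⁅a, b⁆ = (-1 : ℚ) • ⁅b, a⁆ := by
  rw [neg_smul, one_smul, Ring.lie_def, Ring.lie_def, neg_sub]

theorem lie_lie_of_serre {a b : C}
    (h : a * (a * b) - (2 : ℚ) • (a * (b * a)) + b * (a * a) = 0) : ⁅a, ⁅a, b⁆⁆ = 0 := by
  rw [two_smul] at h
  rw [← h]
  simp only [Ring.lie_def]
  noncomm_ring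

theorem lie_lie_of_serre' {a b : C}
    (h : a * (a * b) - (2 : ℚ) • (a * (b * a)) + b * (a * a) = 0) : ⁅a, ⁅b, a⁆⁆ = 0 := by
  rw [← neg_eq_zero, ← lie_lie_of_serre h]
  simp only [Ring.lie_def]
  noncomm_ring

theorem lie_of_quartic {a b : C}
    (h : a * (a * (a * b)) - (3 : ℚ) • (a * (a * (b * a))) + (3 : ℚ) • (a * (b * (a * a))) -
      b * (a * (a * a)) = 0) : ⁅a, ⁅a, ⁅a, b⁆⁆⁆ = 0 := by
  rw [three_smul_rat, three_smul_rat] at h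
  rw [← h]
  simp only [Ring.lie_def]
  noncomm_ring

theorem commL_comm {a b : C} (h : a * b = b * a) (z : C) :
    commL a (commL b z) = commL b (commL a z) := by
  simp only [commL_apply]
  rw [← sub_eq_zero, ← lie_lie_left, Ring.lie_def a b, h, sub_self]
  simp [Ring.lie_def]

theorem commL_serre {a b : C}
    (h : a * (a * b) - (2 : ℚ) • (a * (b * a)) + b * (a * a) = 0) (z : C) :
    commL a (commL a (commL b z)) - (2 : ℚ) • commL a (commL b (commL a z)) +
      commL b (commL a (commL a z)) = 0 := by
  have h1 : ⁅⁅a, ⁅a, b⁆⁆, z⁆ = 0 := by rw [lie_lie_of_serre h]; simp [Ring.lie_def]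
  rw [two_smul, ← h1]
  simp only [commL_apply, Ring.lie_def]
  noncomm_ring

theorem commL_quartic {a b : C}
    (h : a * (a * (a * b)) - (3 : ℚ) • (a * (a * (b * a))) + (3 : ℚ) • (a * (b * (a * a))) -
      b * (a * (a * a)) = 0) (z : C) :
    commL a (commL a (commL a (commL b z))) - (3 : ℚ) • commL a (commL a (commL b (commL a z))) +
      (3 : ℚ) • commL a (commL b (commL a (commL a z))) -
      commL b (commL a (commL a (commL a z))) = 0 := by
  have h1 : ⁅⁅a, ⁅a, ⁅a, b⁆⁆⁆, z⁆ = 0 := by rw [lie_of_quartic h]; simp [Ring.lie_def]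
  rw [three_smul_rat, three_smul_rat, ← h1]
  simp only [lie_lie_left, commL_apply]
  simp only [Ring.lie_def]
  noncomm_ring

variable {e : Fin 4 → C}

/-- The input of `adCoeff_spec` comes from three sources: the definition of the iterated commutators
(`one_smul`), antisymmetry, and the relations rewritten as vanishing commutators. -/
theorem lie_rootVector
    (h02 : e 0 * e 2 = e 2 * e 0) (h03 : e 0 * e 3 = e 3 * e 0) (h13 : e 1 * e 3 = e 3 * e 1)
    (h01 : e 0 * (e 0 * e 1) - (2 : ℚ) • (e 0 * (e 1 * e 0)) + e 1 * (e 0 * e 0) = 0)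
    (h10 : e 1 * (e 1 * e 0) - (2 : ℚ) • (e 1 * (e 0 * e 1)) + e 0 * (e 1 * e 1) = 0)
    (h21 : e 2 * (e 2 * e 1) - (2 : ℚ) • (e 2 * (e 1 * e 2)) + e 1 * (e 2 * e 2) = 0)
    (h23 : e 2 * (e 2 * e 3) - (2 : ℚ) • (e 2 * (e 3 * e 2)) + e 3 * (e 2 * e 2) = 0)
    (h32 : e 3 * (e 3 * e 2) - (2 : ℚ) • (e 3 * (e 2 * e 3)) + e 2 * (e 3 * e 3) = 0)
    (h12 : e 1 * (e 1 * (e 1 * e 2)) - (3 : ℚ) • (e 1 * (e 1 * (e 2 * e 1))) +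
      (3 : ℚ) • (e 1 * (e 2 * (e 1 * e 1))) - e 2 * (e 1 * (e 1 * e 1)) = 0)
    (i : Fin 4) (b : Fin 24) :
    ⁅e i, rootVector e b⁆ = adCoeff i b • rootVector e (adTarget i b) := by
  have h := adCoeff_spec (fun i => commL (e i)) (commL_comm h02) (commL_comm h03)
      (commL_comm h13) (commL_serre h01) (commL_serre h10) (commL_serre h21) (commL_serre h23)
      (commL_serre h32) (commL_quartic h12) (rootVector e)
      ((sub_self _).trans (zero_smul ℚ _).symm)
      ((lie_lie_of_serre h01).trans (zero_smul ℚ _).symm) (one_smul ℚ _).symm (one_smul ℚ _).symm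
      (one_smul ℚ _).symm ((sub_eq_zero.2 h02).trans (zero_smul ℚ _).symm) (one_smul ℚ _).symm
      (one_smul ℚ _).symm ((sub_eq_zero.2 h03).trans (zero_smul ℚ _).symm) (lie_eq_neg_smul _ _)
      ((lie_lie_of_serre' h10).trans (zero_smul ℚ _).symm)
      ((sub_self _).trans (zero_smul ℚ _).symm) (one_smul ℚ _).symm
      ((lie_of_quartic h12).trans (zero_smul ℚ _).symm) (one_smul ℚ _).symm (one_smul ℚ _).symm
      (one_smul ℚ _).symm (one_smul ℚ _).symm (one_smul ℚ _).symm (one_smul ℚ _).symm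
      (one_smul ℚ _).symm (one_smul ℚ _).symm ((sub_eq_zero.2 h13).trans (zero_smul ℚ _).symm)
      ((sub_eq_zero.2 h02.symm).trans (zero_smul ℚ _).symm) (lie_eq_neg_smul _ _)
      ((lie_lie_of_serre' h21).trans (zero_smul ℚ _).symm)
      ((sub_self _).trans (zero_smul ℚ _).symm) (one_smul ℚ _).symm (one_smul ℚ _).symm
      (one_smul ℚ _).symm (one_smul ℚ _).symm ((lie_lie_of_serre h23).trans (zero_smul ℚ _).symm)
      (one_smul ℚ _).symm ((sub_eq_zero.2 h03.symm).trans (zero_smul ℚ _).symm)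
      ((sub_eq_zero.2 h13.symm).trans (zero_smul ℚ _).symm) (lie_eq_neg_smul _ _)
      (one_smul ℚ _).symm ((lie_lie_of_serre' h32).trans (zero_smul ℚ _).symm)
      ((sub_self _).trans (zero_smul ℚ _).symm) i b
  exact h

/-- The span of the root vectors of a weight. -/
def rootSpan (e : Fin 4 → C) (ν : Fin 4 → ℕ) : Submodule ℚ C :=
  Submodule.span ℚ {y | ∃ c, rootWeight c = ν ∧ y = rootVector e c}

theorem lie_mem_rootSpan
    (h : ∀ i b, ⁅e i, rootVector e b⁆ = adCoeff i b • rootVector e (adTarget i b))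
    (i : Fin 4) {ν : Fin 4 → ℕ} {y : C} (hy : y ∈ rootSpan e ν) :
    ⁅e i, y⁆ ∈ rootSpan e (weight [i] + ν) := by
  change commL (e i) y ∈ _
  induction hy using Submodule.span_induction with
  | mem y hy =>
    obtain ⟨c, rfl, rfl⟩ := hy
    rw [commL_apply, h]
    rcases adCoeff_eq_zero_or i c with h0 | h0
    · rw [h0, zero_smul]
      exact Submodule.zero_mem _
    · exact Submodule.smul_mem _ _ (Submodule.subset_span ⟨_, h0, rfl⟩)
  | zero => rw [map_zero]; exact Submodule.zero_mem _
  | add y z _ _ hy hz => rw [map_add]; exact Submodule.add_mem _ hy hz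
  | smul r y _ hy => rw [map_smul]; exact Submodule.smul_mem _ _ hy

/-- By the Jacobi identity, the commutator with an iterated commutator is a combination of
successive commutators with generators. So the span of the root vectors is closed under commutators,
and the structure constants between arbitrary root vectors are not needed. -/
theorem nestedBracket_lie_mem
    (h : ∀ i b, ⁅e i, rootVector e b⁆ = adCoeff i b • rootVector e (adTarget i b))
    (p : List (Fin 4)) (hp : p ≠ []) {ν : Fin 4 → ℕ} {y : C} (hy : y ∈ rootSpan e ν) :
    ⁅nestedBracket e p, y⁆ ∈ rootSpan e (weight p + ν) := by
  induction p generalizing ν y with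
  | nil => exact absurd rfl hp
  | cons i p ih =>
    rcases eq_or_ne p [] with rfl | hp'
    · exact lie_mem_rootSpan h i hy
    · rw [nestedBracket_cons _ _ hp', lie_lie_left, weight_cons, add_assoc]
      refine Submodule.sub_mem _ (lie_mem_rootSpan h i (ih hp' hy)) ?_
      rw [add_left_comm]
      exact ih hp' (lie_mem_rootSpan h i hy)

theorem rootPath_ne_nil (b : Fin 24) : rootPath b ≠ [] := by
  revert b
  decide +kernel

theorem prod_mem_span_rootVector
    (h : ∀ i b, ⁅e i, rootVector e b⁆ = adCoeff i b • rootVector e (adTarget i b))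
    (u : List (Fin 4)) : (u.map e).prod ∈ Submodule.span ℚ
      {y | ∃ m : List (Fin 24), m.Pairwise (· ≤ ·) ∧ (m.map rootWeight).sum = weight u ∧
        y = (m.map (rootVector e)).prod} := by
  have h1 := prod_mem_span_sorted (k := ℚ) (x := rootVector e) (wt := rootWeight)
    (fun a b => by
      have := nestedBracket_lie_mem h (rootPath a) (rootPath_ne_nil a) (ν := rootWeight b)
        (y := rootVector e b) (Submodule.subset_span ⟨b, rfl, rfl⟩)
      rw [weight_rootPath] at this
      exact this) (u.map simpleIndex)
  have h2 : rootVector e ∘ simpleIndex = e := by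
    funext i
    simp [rootVector, rootPath_simpleIndex, nestedBracket]
  have h3 : ∀ u : List (Fin 4), ((u.map simpleIndex).map rootWeight).sum = weight u := by
    intro u
    induction u with
    | nil => rfl
    | cons i u ih =>
      rw [List.map_cons, List.map_cons, List.sum_cons, ih, weight_cons i u, ← weight_rootPath,
        rootPath_simpleIndex]
  rw [h3, List.map_map, h2] at h1
  exact h1

end Brackets

end QuantumShuffle

namespace QuantumShuffle

open ShuffleAlgebra Polynomial

/-! ### The grading by weights -/

section Homogeneous

/-- The homogeneous elements of a weight. -/
noncomputable def homogeneous (ν : Fin 4 → ℕ) : Submodule K ShuffleF4 :=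
  Submodule.span K {f | ∃ u, weight u = ν ∧ f = word formF4 u}

theorem word_mem_homogeneous (u : List (Fin 4)) : word formF4 u ∈ homogeneous (weight u) :=
  Submodule.subset_span ⟨u, rfl, rfl⟩

theorem consL_mem_homogeneous (i : Fin 4) {ν : Fin 4 → ℕ} {f : ShuffleF4}
    (hf : f ∈ homogeneous ν) : consL formF4 i f ∈ homogeneous (weight [i] + ν) := by
  induction hf using Submodule.span_induction with
  | mem f hf =>
    obtain ⟨u, rfl, rfl⟩ := hf
    rw [consL_word, ← weight_cons]
    exact word_mem_homogeneous _
  | zero => rw [map_zero]; exact Submodule.zero_mem _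
  | add f g _ _ hf hg => rw [map_add]; exact Submodule.add_mem _ hf hg
  | smul r f _ hf => rw [map_smul]; exact Submodule.smul_mem _ r hf

theorem shuffleList_mem_homogeneous (u v : List (Fin 4)) :
    shuffleList formF4 u v ∈ homogeneous (weight u + weight v) := by
  induction u generalizing v with
  | nil =>
    rw [shuffleList_nil_left, ← weight_append]
    exact word_mem_homogeneous v
  | cons i u ihu =>
    induction v with
    | nil =>
      rw [shuffleList_nil_right, ← weight_append, List.append_nil]
      exact word_mem_homogeneous _
    | cons j v ihv =>
      rw [shuffleList_cons_cons]
      refine Submodule.add_mem _ ?_ (Submodule.smul_mem _ _ ?_)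
      · rw [weight_cons i u, add_assoc]
        exact consL_mem_homogeneous i (ihu _)
      · rw [weight_cons j v, add_left_comm]
        exact consL_mem_homogeneous j ihv

theorem mul_mem_homogeneous {μ ν : Fin 4 → ℕ} {f g : ShuffleF4} (hf : f ∈ homogeneous μ)
    (hg : g ∈ homogeneous ν) : f * g ∈ homogeneous (μ + ν) := by
  have h := Submodule.mul_mem_mul hf hg
  rw [homogeneous, homogeneous, Submodule.span_mul_span] at h
  refine Submodule.span_le.2 ?_ h
  rintro _ ⟨_, ⟨u, rfl, rfl⟩, _, ⟨v, rfl, rfl⟩, rfl⟩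
  change word formF4 u * word formF4 v ∈ _
  rw [word_mul_word]
  exact shuffleList_mem_homogeneous u v

theorem one_mem_homogeneous : (1 : ShuffleF4) ∈ homogeneous 0 := word_mem_homogeneous []

theorem prod_mem_homogeneous {ι : Type*} {x : ι → ShuffleF4} {wt : ι → Fin 4 → ℕ}
    (h : ∀ a, x a ∈ homogeneous (wt a)) (l : List ι) :
    (l.map x).prod ∈ homogeneous (l.map wt).sum := by
  induction l with
  | nil => exact one_mem_homogeneous
  | cons a l ih =>
    rw [List.map_cons, List.map_cons, List.prod_cons, List.sum_cons]
    exact mul_mem_homogeneous (h a) ih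

/-- The letters as elements of the shuffle algebra. -/
noncomputable def letter (i : Fin 4) : ShuffleF4 := word formF4 [i]

theorem letter_mem_homogeneous (i : Fin 4) : letter i ∈ homogeneous (weight [i]) :=
  word_mem_homogeneous [i]

theorem nestedBracket_mem_homogeneous (p : List (Fin 4)) :
    nestedBracket letter p ∈ homogeneous (weight p) := by
  induction p with
  | nil => exact Submodule.zero_mem _
  | cons i p ih =>
    rcases eq_or_ne p [] with rfl | hp
    · exact letter_mem_homogeneous i
    · rw [nestedBracket_cons _ _ hp, weight_cons, Ring.lie_def]
      refine Submodule.sub_mem _ (mul_mem_homogeneous (letter_mem_homogeneous i) ih) ?_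
      rw [add_comm]
      exact mul_mem_homogeneous ih (letter_mem_homogeneous i)

theorem rootVector_mem_homogeneous (b : Fin 24) :
    rootVector letter b ∈ homogeneous (rootWeight b) := by
  rw [← weight_rootPath]
  exact nestedBracket_mem_homogeneous _

theorem sum_map_weight (u : List (Fin 4)) : (u.map fun i => weight [i]).sum = weight u := by
  induction u with
  | nil => rfl
  | cons i u ih => rw [List.map_cons, List.sum_cons, ih, ← weight_cons]

theorem prod_letter_mem_homogeneous (u : List (Fin 4)) :
    (u.map letter).prod ∈ homogeneous (weight u) := by
  rw [← sum_map_weight]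
  exact prod_mem_homogeneous letter_mem_homogeneous u

/-- The projection to the homogeneous elements of a weight. -/
noncomputable def project (ν : Fin 4 → ℕ) : ShuffleF4 →ₗ[K] ShuffleF4 :=
  ShuffleAlgebra.lift formF4 fun u => if weight u = ν then word formF4 u else 0

theorem project_of_mem {μ ν : Fin 4 → ℕ} {f : ShuffleF4} (hf : f ∈ homogeneous μ) :
    project ν f = if μ = ν then f else 0 := by
  induction hf using Submodule.span_induction with
  | mem f hf =>
    obtain ⟨u, rfl, rfl⟩ := hf
    rw [project, lift_word]
  | zero => rw [map_zero, ite_self]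
  | add f g _ _ hf hg => rw [map_add, hf, hg]; split_ifs <;> simp
  | smul r f _ hf => rw [map_smul, hf]; split_ifs <;> simp

theorem mem_homogeneous_iff {ν : Fin 4 → ℕ} {f : ShuffleF4} :
    f ∈ homogeneous ν ↔ ∀ u, coeff formF4 u f ≠ 0 → weight u = ν := by
  constructor
  · intro hf
    induction hf using Submodule.span_induction with
    | mem f hf =>
      obtain ⟨u, rfl, rfl⟩ := hf
      intro v hv
      rw [coeff_word] at hv
      split_ifs at hv with h
      · rw [h]
      · exact absurd rfl hv
    | zero => intro u hu; simp at hu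
    | add f g _ _ hf hg =>
      intro u hu
      rw [map_add] at hu
      by_cases h : coeff formF4 u f = 0
      · exact hg u (by simpa [h] using hu)
      · exact hf u h
    | smul r f _ hf =>
      intro u hu
      rw [map_smul] at hu
      exact hf u fun h => hu (by rw [h, smul_zero])
  · intro h
    have e : f = Finsupp.sum (α := List (Fin 4)) (M := K) f fun u c => c • word formF4 u := by
      conv_lhs => rw [← Finsupp.sum_single (α := List (Fin 4)) (M := K) f]
      refine Finsupp.sum_congr fun u _ => ?_
      exact (Finsupp.smul_single_one u _).symm
    rw [e]
    refine Submodule.sum_mem _ fun u hu => Submodule.smul_mem _ _ (Submodule.subset_span ⟨u, ?_, rfl⟩)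
    exact h u (Finsupp.mem_support_iff.1 hu)

theorem finite_weight_eq (ν : Fin 4 → ℕ) : {u : List (Fin 4) | weight u = ν}.Finite := by
  refine (List.finite_length_le (Fin 4) (∑ i, ν i)).subset fun u hu => ?_
  have hu' : weight u = ν := hu
  have h := List.sum_toFinset_count_eq_length u
  have h2 : ∑ i ∈ u.toFinset, u.count i ≤ ∑ i, u.count i :=
    Finset.sum_le_sum_of_subset (Finset.subset_univ _)
  rw [h] at h2
  change u.length ≤ ∑ i, ν i
  rw [← hu']
  exact h2

end Homogeneous

/-! ### Specialization at `q = 1` and lifting by Nakayama's lemma -/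

section Integral

noncomputable instance : Module ℚ[X] ShuffleF4 :=
  inferInstanceAs (Module ℚ[X] (List (Fin 4) →₀ K))

noncomputable instance : IsScalarTower ℚ[X] K ShuffleF4 :=
  inferInstanceAs (IsScalarTower ℚ[X] K (List (Fin 4) →₀ K))

noncomputable instance : Algebra ℚ[X] ShuffleF4 :=
  Algebra.ofModule
    (fun r x y => by
      rw [← algebraMap_smul K r x, ← algebraMap_smul K r (x * y), smul_mul_assoc])
    (fun r x y => by
      rw [← algebraMap_smul K r y, ← algebraMap_smul K r (x * y), mul_smul_comm])

/-- The `ℚ[q]`-form of the algebra generated by the letters. -/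
noncomputable def integralForm : Subalgebra ℚ[X] ShuffleF4 :=
  Algebra.adjoin ℚ[X] (Set.range letter)

/-- The letters as elements of the integral form. -/
noncomputable def integralLetter (i : Fin 4) : integralForm :=
  ⟨letter i, Algebra.subset_adjoin ⟨i, rfl⟩⟩

/-- The ideal `(q - 1)` of the integral form. -/
noncomputable def specialIdeal : Ideal integralForm :=
  Ideal.span {algebraMap ℚ[X] integralForm (X - 1)}

theorem mem_specialIdeal {x : integralForm} :
    x ∈ specialIdeal ↔ ∃ y : integralForm, x = (X - 1 : ℚ[X]) • y := by
  rw [specialIdeal, Ideal.mem_span_singleton']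
  constructor
  · rintro ⟨y, rfl⟩
    exact ⟨y, by rw [Algebra.smul_def, Algebra.commutes]⟩
  · rintro ⟨y, rfl⟩
    exact ⟨y, by rw [Algebra.smul_def, Algebra.commutes]⟩

instance : specialIdeal.IsTwoSided where
  mul_mem_of_left b ha := by
    obtain ⟨y, rfl⟩ := mem_specialIdeal.1 ha
    exact mem_specialIdeal.2 ⟨y * b, by rw [smul_mul_assoc]⟩

/-- The specialization of the integral form at `q = 1`. -/
abbrev Specialized : Type := integralForm ⧸ specialIdeal

noncomputable instance : Algebra ℚ Specialized :=
  Algebra.compHom Specialized (Polynomial.C : ℚ →+* ℚ[X])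

theorem rat_smul_specialized (r : ℚ) (x : Specialized) : r • x = (C r : ℚ[X]) • x := rfl

theorem X_smul_specialized (x : Specialized) : (X : ℚ[X]) • x = x := by
  obtain ⟨y, rfl⟩ := Ideal.Quotient.mk_surjective x
  have h : (Ideal.Quotient.mk specialIdeal) ((X - 1 : ℚ[X]) • y) = 0 :=
    Ideal.Quotient.eq_zero_iff_mem.2 (mem_specialIdeal.2 ⟨y, rfl⟩)
  have h2 : (Ideal.Quotient.mk specialIdeal) ((X - 1 : ℚ[X]) • y) =
      (X - 1 : ℚ[X]) • (Ideal.Quotient.mk specialIdeal y) := rfl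
  rw [h2, sub_smul, one_smul, sub_eq_zero] at h
  exact h

/-- Since `q` acts as the identity modulo `q - 1`, polynomials act through their value at 1; this
turns quantum Serre relations into classical ones. -/
theorem smul_specialized (p : ℚ[X]) (x : Specialized) : p • x = p.eval 1 • x := by
  induction p using Polynomial.induction_on' with
  | add p q hp hq => rw [add_smul, hp, hq, eval_add, add_smul]
  | monomial n a =>
    rw [eval_monomial, one_pow, mul_one, rat_smul_specialized, ← C_mul_X_pow_eq_monomial, mul_smul]
    congr 1
    induction n with
    | zero => rw [pow_zero, one_smul]
    | succ n ih => rw [pow_succ, mul_smul, X_smul_specialized, ih]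

/-- The Chevalley generators of the specialization. -/
noncomputable def specialLetter (i : Fin 4) : Specialized :=
  Ideal.Quotient.mk specialIdeal (integralLetter i)

theorem algebraMap_smul_shuffle (p : ℚ[X]) (f : ShuffleF4) :
    algebraMap ℚ[X] K p • f = p • f := algebraMap_smul K p f

theorem algebraMap_X_eq : algebraMap ℚ[X] K X = RatFunc.X := RatFunc.algebraMap_X

theorem specialLetter_comm {i j : Fin 4}
    (h : collectTerms (letterTerms [i, j] ++ scaleTerms 0 (-1) (letterTerms [j, i])) = []) :
    specialLetter i * specialLetter j = specialLetter j * specialLetter i := by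
  have h1 : integralLetter i * integralLetter j = integralLetter j * integralLetter i :=
    Subtype.ext (word_mul_comm_of_terms h)
  rw [specialLetter, specialLetter, ← map_mul, h1, map_mul]

theorem specialLetter_serre {i j : Fin 4} (d : ℕ)
    (h : collectTerms (scaleTerms d 1 (letterTerms [i, i, j]) ++
      (scaleTerms (2 * d : ℕ) (-1) (letterTerms [i, j, i]) ++
      (scaleTerms 0 (-1) (letterTerms [i, j, i]) ++
      scaleTerms d 1 (letterTerms [j, i, i])))) = []) :
    specialLetter i * (specialLetter i * specialLetter j) -
      (2 : ℚ) • (specialLetter i * (specialLetter j * specialLetter i)) +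
      specialLetter j * (specialLetter i * specialLetter i) = 0 := by
  have h1 : (X ^ d : ℚ[X]) • (integralLetter i * (integralLetter i * integralLetter j)) -
      (X ^ (2 * d) + 1 : ℚ[X]) • (integralLetter i * (integralLetter j * integralLetter i)) +
      (X ^ d : ℚ[X]) • (integralLetter j * (integralLetter i * integralLetter i)) = 0 := by
    refine Subtype.ext ?_
    have := quantumSerre_of_terms d h
    simp only [← algebraMap_X_eq, ← map_pow, ← map_one (algebraMap ℚ[X] K), ← map_add,
      algebraMap_smul_shuffle] at this
    exact this
  have h2 := congrArg (Ideal.Quotient.mkₐ ℚ[X] specialIdeal) h1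
  simp only [map_add, map_sub, map_smul, map_mul, map_zero, smul_specialized] at h2
  simp only [eval_add, eval_pow, eval_X, eval_one, one_pow, one_smul] at h2
  rw [show (2 : ℚ) = 1 + 1 by norm_num]
  exact h2

theorem specialLetter_quartic :
    specialLetter 1 * (specialLetter 1 * (specialLetter 1 * specialLetter 2)) -
      (3 : ℚ) • (specialLetter 1 * (specialLetter 1 * (specialLetter 2 * specialLetter 1))) +
      (3 : ℚ) • (specialLetter 1 * (specialLetter 2 * (specialLetter 1 * specialLetter 1))) -
      specialLetter 2 * (specialLetter 1 * (specialLetter 1 * specialLetter 1)) = 0 := by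
  have h1 : (X ^ 2 : ℚ[X]) • (integralLetter 1 * (integralLetter 1 * (integralLetter 1 *
        integralLetter 2))) -
      (X ^ 4 + X ^ 2 + 1 : ℚ[X]) • (integralLetter 1 * (integralLetter 1 * (integralLetter 2 *
        integralLetter 1))) +
      (X ^ 4 + X ^ 2 + 1 : ℚ[X]) • (integralLetter 1 * (integralLetter 2 * (integralLetter 1 *
        integralLetter 1))) -
      (X ^ 2 : ℚ[X]) • (integralLetter 2 * (integralLetter 1 * (integralLetter 1 *
        integralLetter 1))) = 0 := by
    refine Subtype.ext ?_
    have := quantumSerre_quartic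
    simp only [← algebraMap_X_eq, ← map_pow, ← map_one (algebraMap ℚ[X] K), ← map_add,
      algebraMap_smul_shuffle] at this
    exact this
  have h2 := congrArg (Ideal.Quotient.mkₐ ℚ[X] specialIdeal) h1
  simp only [map_add, map_sub, map_smul, map_mul, map_zero, smul_specialized] at h2
  simp only [eval_add, eval_pow, eval_X, eval_one, one_pow, one_smul] at h2
  rw [show (3 : ℚ) = 1 + 1 + 1 by norm_num]
  exact h2

theorem lie_rootVector_specialLetter (i : Fin 4) (b : Fin 24) :
    ⁅specialLetter i, rootVector specialLetter b⁆ =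
      adCoeff i b • rootVector specialLetter (adTarget i b) :=
  lie_rootVector (specialLetter_comm (by decide +kernel)) (specialLetter_comm (by decide +kernel))
    (specialLetter_comm (by decide +kernel)) (specialLetter_serre 1 (by decide +kernel))
    (specialLetter_serre 1 (by decide +kernel)) (specialLetter_serre 2 (by decide +kernel))
    (specialLetter_serre 2 (by decide +kernel)) (specialLetter_serre 2 (by decide +kernel))
    specialLetter_quartic i b

/-- The span of the ordered products of root vectors, over `ℚ[q]`. -/
noncomputable def orderedSpan (ν : Fin 4 → ℕ) : Submodule ℚ[X] ShuffleF4 :=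
  Submodule.span ℚ[X] {y | ∃ m : List (Fin 24), m.Pairwise (· ≤ ·) ∧
    (m.map rootWeight).sum = ν ∧ y = (m.map (rootVector letter)).prod}

/-- The span of the products of letters, over `ℚ[q]`. -/
noncomputable def monomialSpan (ν : Fin 4 → ℕ) : Submodule ℚ[X] ShuffleF4 :=
  Submodule.span ℚ[X] {y | ∃ u : List (Fin 4), weight u = ν ∧ y = (u.map letter).prod}

theorem exists_integral_lift {ν : Fin 4 → ℕ} {x : Specialized} (hx : x ∈ Submodule.span ℚ
      {y | ∃ m : List (Fin 24), m.Pairwise (· ≤ ·) ∧ (m.map rootWeight).sum = ν ∧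
        y = (m.map (rootVector specialLetter)).prod}) :
    ∃ y : integralForm, Ideal.Quotient.mk specialIdeal y = x ∧ (y : ShuffleF4) ∈ orderedSpan ν := by
  induction hx using Submodule.span_induction with
  | mem x hx =>
    obtain ⟨m, h1, h2, rfl⟩ := hx
    refine ⟨(m.map (rootVector integralLetter)).prod, ?_, Submodule.subset_span ⟨m, h1, h2, ?_⟩⟩
    · rw [map_list_prod, List.map_map]
      congr 2
      funext b
      exact map_nestedBracket _ _ _
    · change integralForm.val _ = _
      rw [map_list_prod, List.map_map]
      congr 2
      funext b
      exact map_nestedBracket integralForm.val.toRingHom _ _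
  | zero => exact ⟨0, map_zero _, Submodule.zero_mem _⟩
  | add x y _ _ hx hy =>
    obtain ⟨a, rfl, ha⟩ := hx
    obtain ⟨b, rfl, hb⟩ := hy
    exact ⟨a + b, map_add _ _ _, Submodule.add_mem _ ha hb⟩
  | smul r x _ hx =>
    obtain ⟨a, rfl, ha⟩ := hx
    exact ⟨(C r : ℚ[X]) • a, rfl, Submodule.smul_mem _ (C r : ℚ[X]) ha⟩

/-- Lifts the spanning statement for the specialization: a product of letters is a combination of
ordered products, up to a multiple of `q - 1`. -/
theorem exists_prod_letter_eq (u : List (Fin 4)) : ∃ n ∈ orderedSpan (weight u),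
    ∃ z ∈ integralForm, (u.map letter).prod = n + (X - 1 : ℚ[X]) • z := by
  obtain ⟨y, hy, hyN⟩ := exists_integral_lift
    (prod_mem_span_rootVector lie_rootVector_specialLetter u)
  have h1 : (u.map specialLetter).prod =
      Ideal.Quotient.mk specialIdeal (u.map integralLetter).prod := by
    rw [map_list_prod, List.map_map]; rfl
  rw [h1] at hy
  obtain ⟨z, hz⟩ := mem_specialIdeal.1 (Ideal.Quotient.eq.1 hy.symm)
  refine ⟨y, hyN, z, z.2, ?_⟩
  have h2 : ((u.map integralLetter).prod : ShuffleF4) = (u.map letter).prod := by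
    change integralForm.val _ = _
    rw [map_list_prod, List.map_map]; rfl
  have h3 := congrArg (Subtype.val : integralForm → ShuffleF4) hz
  rw [← h2, ← sub_eq_iff_eq_add']
  exact h3

theorem project_smul (ν : Fin 4 → ℕ) (p : ℚ[X]) (f : ShuffleF4) :
    project ν (p • f) = p • project ν f := by
  rw [← algebraMap_smul_shuffle, map_smul, algebraMap_smul_shuffle]

theorem exists_prod_letter_of_mem_closure {x : ShuffleF4}
    (hx : x ∈ Submonoid.closure (Set.range letter)) :
    ∃ u : List (Fin 4), x = (u.map letter).prod := by
  induction hx using Submonoid.closure_induction with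
  | mem x hx =>
    obtain ⟨i, rfl⟩ := hx
    exact ⟨[i], by simp⟩
  | one => exact ⟨[], rfl⟩
  | mul x y _ _ hx hy =>
    obtain ⟨u, rfl⟩ := hx
    obtain ⟨v, rfl⟩ := hy
    exact ⟨u ++ v, by simp⟩

theorem project_prod_letter (ν : Fin 4 → ℕ) (u : List (Fin 4)) :
    project ν (u.map letter).prod = if weight u = ν then (u.map letter).prod else 0 :=
  project_of_mem (prod_letter_mem_homogeneous u)

theorem project_mem_monomialSpan (ν : Fin 4 → ℕ) {z : ShuffleF4} (hz : z ∈ integralForm) :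
    project ν z ∈ monomialSpan ν := by
  rw [integralForm, ← Subalgebra.mem_toSubmodule, Algebra.adjoin_eq_span] at hz
  induction hz using Submodule.span_induction with
  | mem x hx =>
    obtain ⟨u, rfl⟩ := exists_prod_letter_of_mem_closure hx
    rw [project_prod_letter]
    split_ifs with h
    · exact Submodule.subset_span ⟨u, h, rfl⟩
    · exact Submodule.zero_mem _
  | zero => rw [map_zero]; exact Submodule.zero_mem _
  | add x y _ _ hx hy => rw [map_add]; exact Submodule.add_mem _ hx hy
  | smul r x _ hx => rw [project_smul]; exact Submodule.smul_mem _ r hx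

theorem orderedSpan_project {ν : Fin 4 → ℕ} {n : ShuffleF4} (hn : n ∈ orderedSpan ν) :
    project ν n = n := by
  induction hn using Submodule.span_induction with
  | mem x hx =>
    obtain ⟨m, -, rfl, rfl⟩ := hx
    rw [project_of_mem (prod_mem_homogeneous rootVector_mem_homogeneous m), if_pos rfl]
  | zero => rw [map_zero]
  | add x y _ _ hx hy => rw [map_add, hx, hy]
  | smul r x _ hx => rw [project_smul, hx]

/-- The error term in `exists_prod_letter_eq` lies in the integral form, but possibly not in weight
`ν`. Projecting puts it into `monomialSpan ν`, which is finitely generated, as Nakayama's lemma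
requires. -/
theorem monomialSpan_le (ν : Fin 4 → ℕ) :
    monomialSpan ν ≤ orderedSpan ν ⊔ Ideal.span {(X - 1 : ℚ[X])} • monomialSpan ν := by
  refine Submodule.span_le.2 ?_
  rintro _ ⟨u, rfl, rfl⟩
  obtain ⟨n, hn, z, hz, he⟩ := exists_prod_letter_eq u
  have h := congrArg (project (weight u)) he
  rw [project_prod_letter, if_pos rfl, map_add, orderedSpan_project hn, project_smul] at h
  rw [h]
  exact Submodule.add_mem_sup hn
    (Submodule.smul_mem_smul (Ideal.mem_span_singleton_self _) (project_mem_monomialSpan _ hz))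

theorem monomialSpan_fg (ν : Fin 4 → ℕ) : (monomialSpan ν).FG := by
  have : {y | ∃ u : List (Fin 4), weight u = ν ∧ y = (u.map letter).prod} =
      (fun u : List (Fin 4) => (u.map letter).prod) '' {u | weight u = ν} := by
    ext y
    simp only [Set.mem_ofPred_eq, Set.mem_image, eq_comm]
  rw [monomialSpan, this]
  exact Submodule.fg_span ((finite_weight_eq ν).image _)

theorem exists_smul_monomialSpan_le (ν : Fin 4 → ℕ) : ∃ r : ℚ[X], r ≠ 0 ∧
    ∀ x ∈ monomialSpan ν, r • x ∈ orderedSpan ν := by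
  -- Nakayama's lemma gives `r ≡ 1` modulo `q - 1`. Hence `r` has value 1 at `q = 1`, is non-zero,
  -- and becomes invertible in `ℚ(q)`.
  obtain ⟨r, hr, h⟩ := Submodule.exists_sub_one_mem_and_smul_le_of_fg_of_le_sup
    (monomialSpan_fg ν) le_rfl (monomialSpan_le ν)
  refine ⟨r, ?_, fun x hx => h (Submodule.smul_mem_pointwise_smul x r _ hx)⟩
  rintro rfl
  obtain ⟨p, hp⟩ := Ideal.mem_span_singleton'.1 hr
  have := congrArg (Polynomial.eval 1) hp
  simp at this

/-- The homogeneous elements of the algebra generated by the letters are linear combinations of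
the ordered products of root vectors. -/
theorem mem_span_ordered {ν : Fin 4 → ℕ} {f : ShuffleF4} (hf : f ∈ letters formF4)
    (hν : f ∈ homogeneous ν) : f ∈ Submodule.span K
      {y | ∃ m : List (Fin 24), m.Pairwise (· ≤ ·) ∧ (m.map rootWeight).sum = ν ∧
        y = (m.map (rootVector letter)).prod} := by
  have hord : ∀ x ∈ orderedSpan ν, x ∈ Submodule.span K
      {y | ∃ m : List (Fin 24), m.Pairwise (· ≤ ·) ∧ (m.map rootWeight).sum = ν ∧
        y = (m.map (rootVector letter)).prod} := by
    intro x hx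
    induction hx using Submodule.span_induction with
    | mem x hx => exact Submodule.subset_span hx
    | zero => exact Submodule.zero_mem _
    | add x y _ _ hx hy => exact Submodule.add_mem _ hx hy
    | smul r x _ hx =>
      rw [← algebraMap_smul_shuffle]
      exact Submodule.smul_mem _ _ hx
  obtain ⟨r, hr, hrle⟩ := exists_smul_monomialSpan_le ν
  have hr' : algebraMap ℚ[X] K r ≠ 0 := RatFunc.algebraMap_ne_zero hr
  have hproj : ∀ g ∈ letters formF4, project ν g ∈ Submodule.span K
      {y | ∃ m : List (Fin 24), m.Pairwise (· ≤ ·) ∧ (m.map rootWeight).sum = ν ∧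
        y = (m.map (rootVector letter)).prod} := by
    intro g hg
    have hl : (Set.range fun i => word formF4 [i]) = Set.range letter := rfl
    rw [letters, ← Subalgebra.mem_toSubmodule, Algebra.adjoin_eq_span, hl] at hg
    induction hg using Submodule.span_induction with
    | mem x hx =>
      obtain ⟨u, rfl⟩ := exists_prod_letter_of_mem_closure hx
      rw [project_prod_letter]
      split_ifs with h
      · have h1 := hord _ (hrle _ (Submodule.subset_span ⟨u, h, rfl⟩))
        rw [← algebraMap_smul_shuffle] at h1
        exact (Submodule.smul_mem_iff _ hr').1 h1
      · exact Submodule.zero_mem _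
    | zero => rw [map_zero]; exact Submodule.zero_mem _
    | add x y _ _ hx hy => rw [map_add]; exact Submodule.add_mem _ hx hy
    | smul r x _ hx => rw [map_smul]; exact Submodule.smul_mem _ r hx
  have := hproj f hf
  rwa [project_of_mem hν, if_pos rfl] at this

end Integral

end QuantumShuffle

namespace QuantumShuffle

open ShuffleAlgebra Polynomial

/-! ### Comparison of the two orders on words -/

section WordOrder

/-- A word, with the order of the letters reversed. -/
def dualWord (u : List (Fin 4)) : List (Fin 4)ᵒᵈ := u.map OrderDual.toDual

theorem dualWord_injective : Function.Injective dualWord :=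
  List.map_injective_iff.2 OrderDual.toDual.injective

theorem dualWord_append (u v : List (Fin 4)) : dualWord (u ++ v) = dualWord u ++ dualWord v :=
  List.map_append

theorem length_dualWord (u : List (Fin 4)) : (dualWord u).length = u.length := List.length_map _

theorem lt_iff_exists {α : Type*} [LinearOrder α] {x y : List α} :
    x < y ↔ (∃ t, t ≠ [] ∧ y = x ++ t) ∨
      ∃ (s t t' : List α) (a b : α), a < b ∧ x = s ++ a :: t ∧ y = s ++ b :: t' := by
  constructor
  · intro h
    induction x generalizing y with
    | nil => exact Or.inl ⟨y, by rintro rfl; exact absurd h (lt_irrefl _), rfl⟩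
    | cons a x ih =>
      rcases y with _ | ⟨b, y⟩
      · exact absurd h (List.not_lt_nil _)
      · rcases List.cons_lt_cons_iff.1 h with h | ⟨rfl, h⟩
        · exact Or.inr ⟨[], x, y, a, b, h, rfl, rfl⟩
        · rcases ih (by assumption) with ⟨t, ht, rfl⟩ | ⟨s, t, t', c, d, hcd, rfl, rfl⟩
          · exact Or.inl ⟨t, ht, rfl⟩
          · exact Or.inr ⟨a :: s, t, t', c, d, hcd, rfl, rfl⟩
  · rintro (⟨t, ht, rfl⟩ | ⟨s, t, t', a, b, hab, rfl, rfl⟩)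
    · refine lt_of_le_of_ne (le_append_right x t) fun h => ht ?_
      simpa using h
    · exact append_lt_append_left s (List.cons_lt_cons_iff.2 (Or.inl hab))

/-- Right factors become prefixes after reversal. In the usual order a proper prefix is smaller,
while `WordLT` makes a right factor larger; together with the dual order on letters this exchanges
the two sides. -/
theorem wordLT_iff {u v : List (Fin 4)} :
    WordLT u v ↔ dualWord v.reverse < dualWord u.reverse := by
  rw [lt_iff_exists]
  constructor
  · rintro (⟨p, hp, rfl⟩ | ⟨p, p', s, a, b, hab, rfl, rfl⟩)
    · exact Or.inl ⟨dualWord p.reverse, by simpa [dualWord] using hp, by simp [dualWord]⟩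
    · exact Or.inr ⟨dualWord s.reverse, dualWord p'.reverse, dualWord p.reverse,
        OrderDual.toDual b, OrderDual.toDual a, hab, by simp [dualWord], by simp [dualWord]⟩
  · rintro (⟨t, ht, h⟩ | ⟨s, t, t', a, b, hab, h1, h2⟩)
    · refine Or.inl ⟨(t.map OrderDual.ofDual).reverse, by simpa using ht, ?_⟩
      have := congrArg (fun w : List (Fin 4)ᵒᵈ => (w.map OrderDual.ofDual).reverse) h
      simpa [dualWord, Function.comp_def] using this
    · refine Or.inr ⟨(t'.map OrderDual.ofDual).reverse, (t.map OrderDual.ofDual).reverse,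
        (s.map OrderDual.ofDual).reverse, OrderDual.ofDual b, OrderDual.ofDual a, hab, ?_, ?_⟩
      · have := congrArg (fun w : List (Fin 4)ᵒᵈ => (w.map OrderDual.ofDual).reverse) h2
        simpa [dualWord, Function.comp_def] using this
      · have := congrArg (fun w : List (Fin 4)ᵒᵈ => (w.map OrderDual.ofDual).reverse) h1
        simpa [dualWord, Function.comp_def] using this

theorem isLyndonWord_dualWord_iff {w : List (Fin 4)} : IsLyndonWord (dualWord w) ↔
    w ≠ [] ∧ ∀ p s, p ≠ [] → s ≠ [] → w = p ++ s → dualWord w < dualWord s := by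
  constructor
  · rintro ⟨h1, h2⟩
    refine ⟨by rintro rfl; exact h1 rfl, fun p s hp hs he => ?_⟩
    refine h2 (dualWord p) (dualWord s) (by simpa [dualWord] using hp)
      (by simpa [dualWord] using hs) ?_
    rw [← dualWord_append, ← he]
  · rintro ⟨h1, h2⟩
    refine ⟨by simpa [dualWord] using h1, fun p s hp hs he => ?_⟩
    obtain ⟨p', s', rfl, rfl, rfl⟩ := List.map_eq_append_iff.1 he
    exact h2 p' s' (by simpa using hp) (by simpa using hs) rfl

theorem isLyndon_iff {l : List (Fin 4)} : IsLyndon l ↔ IsLyndonWord (dualWord l.reverse) := by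
  rw [isLyndonWord_dualWord_iff, IsLyndon]
  refine and_congr (by simp) ⟨fun h p s hp hs he => ?_, fun h p s hp hs he => ?_⟩
  · have := wordLT_iff.1 (h s.reverse p.reverse (by simpa using hs) (by simpa using hp)
      (by rw [← List.reverse_append, ← he, List.reverse_reverse]))
    rwa [List.reverse_reverse] at this
  · exact wordLT_iff.2 (h s.reverse p.reverse (by simpa using hs) (by simpa using hp)
      (by rw [he, List.reverse_append]))

/-- The lexicographic comparison of words, with the order of the letters reversed. -/
def dualLtb : List (Fin 4) → List (Fin 4) → Bool
  | _, [] => false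
  | [], _ :: _ => true
  | a :: u, b :: v => decide (b < a) || (decide (a = b) && dualLtb u v)

theorem dualLtb_iff (u v : List (Fin 4)) : dualLtb u v = true ↔ dualWord u < dualWord v := by
  induction u generalizing v with
  | nil =>
    cases v with
    | nil => simp [dualLtb]
    | cons b v => simp [dualLtb, dualWord]
  | cons a u ih =>
    cases v with
    | nil => simp [dualLtb, dualWord]
    | cons b v =>
      simp only [dualLtb, Bool.or_eq_true, decide_eq_true_eq, Bool.and_eq_true, ih]
      exact (List.cons_lt_cons_iff (a := OrderDual.toDual a) (b := OrderDual.toDual b)).symm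

end WordOrder

/-! ### Coefficients of shuffles do not cancel -/

section ShuffleCoefficients

/-- The element is, up to a power of `q`, a polynomial in `q` that is positive at `q = 1`. -/
def PositiveAtOne (x : K) : Prop :=
  ∃ (N : ℕ) (p : ℚ[X]), (RatFunc.X : K) ^ N * x = algebraMap ℚ[X] K p ∧ 0 < p.eval 1

theorem PositiveAtOne.ne_zero {x : K} (h : PositiveAtOne x) : x ≠ 0 := by
  rintro rfl
  obtain ⟨N, p, h1, h2⟩ := h
  rw [mul_zero, eq_comm, map_eq_zero_iff _ (RatFunc.algebraMap_injective ℚ)] at h1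
  simp [h1] at h2

theorem PositiveAtOne.add {x y : K} (hx : PositiveAtOne x) (hy : PositiveAtOne y) :
    PositiveAtOne (x + y) := by
  obtain ⟨N, p, h1, h2⟩ := hx
  obtain ⟨M, r, h3, h4⟩ := hy
  refine ⟨N + M, X ^ M * p + X ^ N * r, ?_, by simpa using add_pos h2 h4⟩
  rw [map_add, map_mul, map_mul, ← h1, ← h3, map_pow, map_pow, RatFunc.algebraMap_X]
  ring

theorem positiveAtOne_smul_zpow {c : ℚ} (hc : 0 < c) (e : ℤ) :
    PositiveAtOne ((c : K) * (RatFunc.X : K) ^ e) := by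
  -- Multiplication by `q ^ |e|` removes a negative exponent.
  refine ⟨e.natAbs, C c * X ^ (e + e.natAbs).toNat, ?_, by simpa using hc⟩
  have h : (RatFunc.X : K) ^ e.natAbs * RatFunc.X ^ e =
      RatFunc.X ^ (e + e.natAbs).toNat := by
    rw [← zpow_natCast, ← zpow_natCast, ← X_zpow_add]
    congr 1
    omega
  rw [mul_left_comm, h, map_mul, map_pow, RatFunc.algebraMap_X, RatFunc.algebraMap_C]
  simp

theorem PositiveAtOne.mul {x y : K} (hx : PositiveAtOne x) (hy : PositiveAtOne y) :
    PositiveAtOne (x * y) := by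
  obtain ⟨N, p, h1, h2⟩ := hx
  obtain ⟨M, r, h3, h4⟩ := hy
  refine ⟨N + M, p * r, ?_, by simpa using mul_pos h2 h4⟩
  rw [map_mul, ← h1, ← h3]
  ring

theorem coeff_consL (i : Fin 4) (s : List (Fin 4)) (f : ShuffleF4) :
    coeff formF4 s (consL formF4 i f) =
      match s with
      | [] => 0
      | a :: s => if i = a then coeff formF4 s f else 0 := by
  induction f using induction_words with
  | h0 => rcases s with _ | ⟨a, s⟩ <;> simp
  | hadd f g hf hg =>
    rw [map_add, map_add, hf, hg]
    rcases s with _ | ⟨a, s⟩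
    · simp
    · simp only [map_add]; split_ifs <;> simp
  | hword c u =>
    rw [map_smul, consL_word, map_smul, coeff_word]
    rcases s with _ | ⟨a, s⟩
    · simp
    · simp only [map_smul, coeff_word, List.cons.injEq]
      split_ifs <;> simp_all

/-- The element vanishes, or is positive at `q = 1`, according to whether a condition fails or
holds. -/
def PositiveIff (x : K) (P : Prop) : Prop := (PositiveAtOne x ∧ P) ∨ (x = 0 ∧ ¬ P)

theorem PositiveIff.add {x y : K} {P Q : Prop} (hx : PositiveIff x P) (hy : PositiveIff y Q) :
    PositiveIff (x + y) (P ∨ Q) := by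
  rcases hx with ⟨hx, hP⟩ | ⟨rfl, hP⟩ <;> rcases hy with ⟨hy, hQ⟩ | ⟨rfl, hQ⟩
  · exact Or.inl ⟨hx.add hy, Or.inl hP⟩
  · exact Or.inl ⟨by rwa [add_zero], Or.inl hP⟩
  · exact Or.inl ⟨by rwa [zero_add], Or.inr hQ⟩
  · exact Or.inr ⟨add_zero 0, by tauto⟩

theorem PositiveIff.ite {x : K} {P c : Prop} [Decidable c] (hx : PositiveIff x P) :
    PositiveIff (if c then x else 0) (c ∧ P) := by
  split_ifs with h
  · simpa [h] using hx
  · exact Or.inr ⟨rfl, fun h' => h h'.1⟩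

theorem positiveAtOne_zpow (e : ℤ) : PositiveAtOne ((RatFunc.X : K) ^ e) := by
  simpa using positiveAtOne_smul_zpow one_pos e

theorem PositiveIff.zpow_mul {x : K} {P : Prop} (hx : PositiveIff x P) (e : ℤ) :
    PositiveIff ((RatFunc.X : K) ^ e * x) P := by
  rcases hx with ⟨hx, hP⟩ | ⟨rfl, hP⟩
  · exact Or.inl ⟨(positiveAtOne_zpow e).mul hx, hP⟩
  · exact Or.inr ⟨mul_zero _, hP⟩

theorem positiveIff_coeff_word (s u : List (Fin 4)) :
    PositiveIff (coeff formF4 s (word formF4 u)) (u = s) := by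
  rw [coeff_word]
  split_ifs with h
  · exact Or.inl ⟨by simpa using positiveAtOne_zpow 0, h⟩
  · exact Or.inr ⟨rfl, h⟩

theorem interleave_cons_iff {β : Type*} {i j a : β} {u v s : List β} :
    Interleave (i :: u) (j :: v) (a :: s) ↔
      (i = a ∧ Interleave u (j :: v) s) ∨ (j = a ∧ Interleave (i :: u) v s) := by
  constructor
  · intro h
    cases h with
    | left _ h => exact Or.inl ⟨rfl, h⟩
    | right _ h => exact Or.inr ⟨rfl, h⟩
  · rintro (⟨rfl, h⟩ | ⟨rfl, h⟩)
    · exact .left _ h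
    · exact .right _ h

/-- Each way of obtaining `s` as a shuffle contributes a power of `q`, and a non-empty sum of such
powers is positive at `q = 1`. So exactly the combinatorial shuffles occur. -/
theorem positiveIff_coeff_shuffleList (u v s : List (Fin 4)) :
    PositiveIff (coeff formF4 s (shuffleList formF4 u v)) (Interleave u v s) := by
  induction u generalizing v s with
  | nil =>
    rw [shuffleList_nil_left,
      show Interleave [] v s ↔ v = s from ⟨fun h => h.eq_right, fun h => h ▸ interleave_nil_left v⟩]
    exact positiveIff_coeff_word s v
  | cons i u ihu =>
    induction v generalizing s with
    | nil =>
      rw [shuffleList_nil_right, show Interleave (i :: u) [] s ↔ i :: u = s from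
        ⟨fun h => h.symm.eq_right, fun h => h ▸ interleave_nil_right _⟩]
      exact positiveIff_coeff_word s _
    | cons j v ihv =>
      rw [shuffleList_cons_cons, map_add, map_smul, coeff_consL, coeff_consL, smul_eq_mul]
      rcases s with _ | ⟨a, s⟩
      · exact Or.inr ⟨by simp, fun h => by cases h⟩
      · rw [interleave_cons_iff]
        exact (ihu (j :: v) s).ite.add ((ihv s).ite.zpow_mul _)

end ShuffleCoefficients

end QuantumShuffle

namespace QuantumShuffle

open ShuffleAlgebra Polynomial

/-! ### Leading words of products and linear independence -/

section LeadingWords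

/-- `l` is the leading word of `f`: the largest word that occurs in `f`, all of them being of the
same length. -/
def IsLeading (f : ShuffleF4) (l : List (Fin 4)) : Prop :=
  coeff formF4 l f ≠ 0 ∧
    ∀ u, coeff formF4 u f ≠ 0 → u.length = l.length ∧ dualWord u ≤ dualWord l

theorem eq_sum_coeff_smul (f : ShuffleF4) :
    f = ∑ u ∈ Finsupp.support (α := List (Fin 4)) (M := K) f, coeff formF4 u f • word formF4 u := by
  conv_lhs => rw [← Finsupp.sum_single (α := List (Fin 4)) (M := K) f]
  exact Finset.sum_congr rfl fun u _ => (Finsupp.smul_single_one u _).symm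

theorem coeff_mul (s : List (Fin 4)) (f g : ShuffleF4) : coeff formF4 s (f * g) =
    ∑ u ∈ Finsupp.support (α := List (Fin 4)) (M := K) f,
      ∑ v ∈ Finsupp.support (α := List (Fin 4)) (M := K) g,
        coeff formF4 u f * coeff formF4 v g * coeff formF4 s (shuffleList formF4 u v) := by
  conv_lhs => rw [eq_sum_coeff_smul f, eq_sum_coeff_smul g, Finset.sum_mul_sum]
  rw [map_sum]
  refine Finset.sum_congr rfl fun u _ => ?_
  rw [map_sum]
  refine Finset.sum_congr rfl fun v _ => ?_
  rw [smul_mul_smul_comm, word_mul_word, map_smul, smul_eq_mul]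

theorem mem_support_iff {u : List (Fin 4)} {f : ShuffleF4} :
    u ∈ Finsupp.support (α := List (Fin 4)) (M := K) f ↔ coeff formF4 u f ≠ 0 :=
  Finsupp.mem_support_iff

/-- The leading word of a product is the concatenation, if the first factor has a Lyndon word and
the second one a non-increasing product of smaller Lyndon words as leading words. -/
theorem IsLeading.mul {f g : ShuffleF4} {l w : List (Fin 4)} {L : List (List (Fin 4)ᵒᵈ)}
    (hf : IsLeading f l) (hg : IsLeading g w) (hL : IsLyndonChain (dualWord l :: L))
    (hw : L.flatten = dualWord w) : IsLeading (f * g) (l ++ w) := by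
  -- Every word of the product is a shuffle of words of the factors. None exceeds `l ++ w`, and `l
  -- ++ w` arises only from the pair `l`, `w`; so its coefficient is a single product of non-zero
  -- elements.
  have key : ∀ u v s, coeff formF4 u f ≠ 0 → coeff formF4 v g ≠ 0 →
      coeff formF4 s (shuffleList formF4 u v) ≠ 0 → s.length = (l ++ w).length ∧
        dualWord s ≤ dualWord (l ++ w) ∧ (s = l ++ w → u = l ∧ v = w) := by
    intro u v s hu hv hs
    rcases positiveIff_coeff_shuffleList u v s with ⟨-, h⟩ | ⟨h, -⟩
    · obtain ⟨hu1, hu2⟩ := hf.2 u hu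
      obtain ⟨hv1, hv2⟩ := hg.2 v hv
      have h1 := (h.map OrderDual.toDual).le_append hL
        (by rw [List.length_map, length_dualWord, hu1])
        (by rw [hw, List.length_map, length_dualWord, hv1]) hu2 (hw ▸ hv2)
      rw [hw, ← dualWord_append] at h1
      refine ⟨by rw [h.perm.length_eq, List.length_append, List.length_append, hu1, hv1], h1.1,
        fun he => ?_⟩
      obtain ⟨h2, h3⟩ := h1.2 (by rw [he]; rfl)
      exact ⟨dualWord_injective h2, dualWord_injective h3⟩
    · exact absurd h hs
  constructor
  · rw [coeff_mul, Finset.sum_eq_single l, Finset.sum_eq_single w]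
    · refine mul_ne_zero (mul_ne_zero hf.1 hg.1) ?_
      rcases positiveIff_coeff_shuffleList l w (l ++ w) with ⟨h, -⟩ | ⟨-, h⟩
      · exact h.ne_zero
      · exact absurd (interleave_append l w) h
    · intro v hv hvw
      by_contra h
      exact hvw ((key l v _ hf.1 (mem_support_iff.1 hv) (right_ne_zero_of_mul h)).2.2 rfl).2
    · intro h
      exact absurd (mem_support_iff.2 hg.1) h
    · intro u hu hul
      refine Finset.sum_eq_zero fun v hv => ?_
      by_contra h
      exact hul ((key u v _ (mem_support_iff.1 hu) (mem_support_iff.1 hv)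
        (right_ne_zero_of_mul h)).2.2 rfl).1
    · intro h
      exact absurd (mem_support_iff.2 hf.1) h
  · intro s hs
    rw [coeff_mul] at hs
    obtain ⟨u, hu, hs⟩ := Finset.exists_ne_zero_of_sum_ne_zero hs
    obtain ⟨v, hv, hs⟩ := Finset.exists_ne_zero_of_sum_ne_zero hs
    have h := key u v s (mem_support_iff.1 hu) (mem_support_iff.1 hv) (right_ne_zero_of_mul hs)
    exact ⟨h.1, h.2.1⟩

/-- Triangularity: in a vanishing combination, the largest leading word among the terms with
non-zero coefficient occurs in only one of them. -/
theorem linearIndependent_of_isLeading {ι : Type*} {f : ι → ShuffleF4} {l : ι → List (Fin 4)}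
    (hl : Function.Injective l) (h : ∀ i, IsLeading (f i) (l i)) : LinearIndependent K f := by
  classical
  rw [linearIndependent_iff']
  intro s g hg
  by_contra! hne
  obtain ⟨i, hi, hgi⟩ := hne
  obtain ⟨i, hi, hmax⟩ := Finset.exists_max_image (s.filter fun i => g i ≠ 0)
    (fun i => dualWord (l i)) ⟨i, Finset.mem_filter.2 ⟨hi, hgi⟩⟩
  have hi' := Finset.mem_filter.1 hi
  have h1 := congrArg (coeff formF4 (l i)) hg
  rw [map_sum, map_zero, Finset.sum_eq_single i] at h1
  · rw [map_smul, smul_eq_mul] at h1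
    exact (mul_ne_zero hi'.2 (h i).1) h1
  · intro j hj hji
    rw [map_smul, smul_eq_mul]
    by_contra hne
    have h2 := (h j).2 _ (right_ne_zero_of_mul hne)
    have h3 := hmax j (Finset.mem_filter.2 ⟨hj, left_ne_zero_of_mul hne⟩)
    exact hji (hl (dualWord_injective (le_antisymm h3 h2.2)))
  · exact fun h => absurd hi'.1 h

end LeadingWords

/-! ### The good elements lie in the subalgebra and have the table as leading words -/

section GoodElements

/-- The good elements of the algebra generated by the letters. -/
noncomputable def goodElement (b : Fin 24) : ShuffleF4 := evalTerms (goodTerms b)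

theorem evalTerms_mem_homogeneous {t : List Term} {ν : Fin 4 → ℕ}
    (h : ∀ x ∈ t, weight x.1.1 = ν) : evalTerms t ∈ homogeneous ν := by
  induction t with
  | nil => exact Submodule.zero_mem _
  | cons x t ih =>
    rw [evalTerms_cons]
    refine Submodule.add_mem _ (Submodule.smul_mem _ _ ?_)
      (ih fun y hy => h y (List.mem_cons_of_mem _ hy))
    rw [← h x List.mem_cons_self]
    exact word_mem_homogeneous _

theorem evalTerms_commTerms (k : ℤ) (s t : List Term) : evalTerms (commTerms k s t) =
    evalTerms s * evalTerms t - (RatFunc.X : K) ^ k • (evalTerms t * evalTerms s) := by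
  rw [commTerms, evalTerms_append, evalTerms_scaleTerms, evalTerms_mulTerms, evalTerms_mulTerms,
    sub_eq_add_neg, ← neg_smul]
  simp

theorem goodTableTerms_weight (b : Fin 24) :
    ∀ x ∈ goodTableTerms b, weight x.1.1 = rootWeight b := by
  revert b
  decide +kernel

theorem goodElement_mem_homogeneous (b : Fin 24) :
    goodElement b ∈ homogeneous (rootWeight b) := by
  have h := fun b => evalTerms_mem_homogeneous (goodTableTerms_weight b)
  by_cases hb : b = 16
  · subst hb
    have e1 : rootWeight 16 = rootWeight 15 + rootWeight 17 := by decide +kernel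
    rw [goodElement, goodTerms, if_pos rfl, evalTerms_commTerms]
    refine Submodule.sub_mem _ ?_ (Submodule.smul_mem _ _ ?_)
    · rw [e1]
      exact mul_mem_homogeneous (h 15) (h 17)
    · rw [e1, add_comm]
      exact mul_mem_homogeneous (h 17) (h 15)
  · rw [goodElement, goodTerms, if_neg hb]
    exact h b

theorem X_pow_ne_one {n : ℕ} (hn : n ≠ 0) : (RatFunc.X : K) ^ n ≠ 1 := by
  intro h
  rw [← RatFunc.algebraMap_X, ← map_pow, ← map_one (algebraMap ℚ[X] K)] at h
  have h2 := congrArg (Polynomial.eval 0) (RatFunc.algebraMap_injective ℚ h)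
  simp [hn] at h2

theorem X_zpow_sub_ne_zero {a : ℤ} (ha : 0 < a) :
    (RatFunc.X : K) ^ a - RatFunc.X ^ (-a) ≠ 0 := by
  intro h
  have hX : (RatFunc.X : K) ^ a ≠ 0 := zpow_ne_zero a RatFunc.X_ne_zero
  obtain ⟨n, rfl⟩ := Int.eq_ofNat_of_zero_le ha.le
  have h1 : (RatFunc.X : K) ^ (n + n) = 1 := by
    rw [sub_eq_zero, zpow_neg] at h
    have h1 := congrArg ((RatFunc.X : K) ^ (n : ℤ) * ·) h
    simp only [mul_inv_cancel₀ hX] at h1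
    rw [pow_add, ← h1]
    rfl
  exact X_pow_ne_one (by omega) h1

theorem goodRec_cases (b : Fin 24) (hb : b ≠ 16) : (∃ i, goodTableTerms b = letterTerm i) ∨
    (0 < (goodRec b).2.2.2 ∧ (goodRec b).1 ≠ 16 ∧ (goodRec b).2.1 ≠ 16 ∧
      (lyndonTable (goodRec b).1).length < (lyndonTable b).length ∧
      (lyndonTable (goodRec b).2.1).length < (lyndonTable b).length) := by
  revert b
  decide +kernel

/-- Induction on the height along `goodRec`: a non-zero multiple of the element is a `q`-commutator
of elements of smaller height, and the scalar is invertible in `ℚ(q)`. -/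
theorem evalTerms_goodTableTerms_mem (b : Fin 24) (hb : b ≠ 16) :
    evalTerms (goodTableTerms b) ∈ letters formF4 := by
  induction hn : (lyndonTable b).length using Nat.strong_induction_on generalizing b with
  | _ n ih =>
    rcases goodRec_cases b hb with ⟨i, hi⟩ | ⟨ha, h1, h2, h3, h4⟩
    · rw [hi]
      have : evalTerms (letterTerm i) = word formF4 [i] := by simp [letterTerm, evalTerms]
      rw [this]
      exact Algebra.subset_adjoin ⟨i, rfl⟩
    · have hx := ih _ (hn ▸ h3) _ h1 rfl
      have hy := ih _ (hn ▸ h4) _ h2 rfl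
      have h := evalTerms_eq_zero (goodRec_spec b hb)
      rw [evalTerms_append, evalTerms_append, evalTerms_scaleTerms, evalTerms_scaleTerms,
        evalTerms_commTerms, ← add_smul, ← eq_neg_iff_add_eq_zero, ← neg_smul] at h
      have hc := X_zpow_sub_ne_zero ha
      have e : -(((-1 : ℤ) : K) * (RatFunc.X : K) ^ (goodRec b).2.2.2 +
          ((1 : ℤ) : K) * RatFunc.X ^ (-(goodRec b).2.2.2)) =
          (RatFunc.X : K) ^ (goodRec b).2.2.2 - RatFunc.X ^ (-(goodRec b).2.2.2) := by
        push_cast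
        ring
      rw [e] at h
      have hmem : ((RatFunc.X : K) ^ (goodRec b).2.2.2 - RatFunc.X ^ (-(goodRec b).2.2.2)) •
          evalTerms (goodTableTerms b) ∈ Subalgebra.toSubmodule (letters formF4) := by
        rw [← h]
        exact (letters formF4).sub_mem ((letters formF4).mul_mem hx hy)
          ((letters formF4).smul_mem ((letters formF4).mul_mem hy hx) _)
      exact (Submodule.smul_mem_iff _ hc).1 hmem

theorem goodElement_mem_letters (b : Fin 24) : goodElement b ∈ letters formF4 := by
  by_cases hb : b = 16
  · rw [goodElement, goodTerms, if_pos hb, evalTerms_commTerms]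
    have h1 := evalTerms_goodTableTerms_mem 15 (by decide)
    have h2 := evalTerms_goodTableTerms_mem 17 (by decide)
    exact (letters formF4).sub_mem ((letters formF4).mul_mem h1 h2)
      ((letters formF4).smul_mem ((letters formF4).mul_mem h2 h1) _)
  · rw [goodElement, goodTerms, if_neg hb]
    exact evalTerms_goodTableTerms_mem b hb

/-- The monomials of a sum whose words are not smaller than `l`, collected. -/
def topTerms (l : List (Fin 4)) (t : List Term) : List Term :=
  collectTerms (t.filter fun x => !dualLtb x.1.1 l)

/-- No word above the table word survives, and the coefficient of the table word is visibly
non-zero: a sum of positive monomials, or `q ^ 2 - q ^ (-2)`. The second form can only arise for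
index 16, the one element built with negative coefficients. Discarding smaller words first keeps the
collection of terms short. -/
theorem goodTerms_top (b : Fin 24) :
    (∀ x ∈ topTerms (lyndonTable b).reverse (goodTerms b), x.1.1 = (lyndonTable b).reverse) ∧
      ((topTerms (lyndonTable b).reverse (goodTerms b) ≠ [] ∧
        ∀ x ∈ topTerms (lyndonTable b).reverse (goodTerms b), 0 < x.2) ∨
      (topTerms (lyndonTable b).reverse (goodTerms b)).map (fun x => (x.1.2, x.2)) =
        [(2, 1), (-2, -1)] ∨
      (topTerms (lyndonTable b).reverse (goodTerms b)).map (fun x => (x.1.2, x.2)) =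
        [(-2, -1), (2, 1)]) := by
  revert b
  decide +kernel

theorem coeff_evalTerms_filter {l u : List (Fin 4)} (hu : ¬ dualWord u < dualWord l)
    (t : List Term) :
    coeff formF4 u (evalTerms (t.filter fun x => !dualLtb x.1.1 l)) =
      coeff formF4 u (evalTerms t) := by
  induction t with
  | nil => rfl
  | cons x t ih =>
    rw [List.filter_cons]
    split_ifs with h
    · rw [evalTerms_cons, evalTerms_cons, map_add, map_add, ih]
    · have h1 : dualWord x.1.1 < dualWord l := by
        rw [← dualLtb_iff]
        simpa using h
      have h2 : x.1.1 ≠ u := by rintro rfl; exact hu h1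
      rw [ih, evalTerms_cons, map_add, map_smul, coeff_word, if_neg h2, smul_zero, zero_add]

theorem coeff_evalTerms_topTerms {l u : List (Fin 4)} (hu : ¬ dualWord u < dualWord l)
    (t : List Term) :
    coeff formF4 u (evalTerms t) = coeff formF4 u (evalTerms (topTerms l t)) := by
  rw [topTerms, evalTerms_collectTerms, coeff_evalTerms_filter hu]

theorem evalTerms_of_forall_word_eq {l : List (Fin 4)} {t : List Term}
    (h : ∀ x ∈ t, x.1.1 = l) : evalTerms t =
      ((t.map fun x => (x.1.2, x.2)).map fun y : ℤ × ℤ =>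
        ((y.2 : K) * (RatFunc.X : K) ^ y.1)).sum • word formF4 l := by
  induction t with
  | nil => simp
  | cons x t ih =>
    rw [evalTerms_cons, ih fun y hy => h y (List.mem_cons_of_mem _ hy), h x List.mem_cons_self,
      List.map_cons, List.map_cons, List.sum_cons, add_smul]

theorem positiveAtOne_sum {t : List (ℤ × ℤ)} (ht : t ≠ []) (h : ∀ y ∈ t, 0 < y.2) :
    PositiveAtOne (t.map fun y : ℤ × ℤ => ((y.2 : K) * (RatFunc.X : K) ^ y.1)).sum := by
  have h1 : ∀ y : ℤ × ℤ, 0 < y.2 → PositiveAtOne ((y.2 : K) * (RatFunc.X : K) ^ y.1) := by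
    intro y hy
    have := positiveAtOne_smul_zpow (c := (y.2 : ℚ)) (by exact_mod_cast hy) y.1
    simpa using this
  induction t with
  | nil => exact absurd rfl ht
  | cons y t ih =>
    rw [List.map_cons, List.sum_cons]
    rcases eq_or_ne t [] with rfl | ht'
    · simpa using h1 y (h y List.mem_cons_self)
    · exact (h1 y (h y List.mem_cons_self)).add
        (ih ht' fun z hz => h z (List.mem_cons_of_mem _ hz))

theorem length_eq_of_weight_eq {u v : List (Fin 4)} (h : weight u = weight v) :
    u.length = v.length :=
  (List.perm_iff_count.2 fun i => congrFun h i).length_eq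

theorem goodElement_isLeading (b : Fin 24) :
    IsLeading (goodElement b) (lyndonTable b).reverse := by
  obtain ⟨h1, h2⟩ := goodTerms_top b
  have e := evalTerms_of_forall_word_eq h1
  constructor
  · rw [goodElement, coeff_evalTerms_topTerms (lt_irrefl _), e, map_smul, coeff_word, if_pos rfl,
      smul_eq_mul, mul_one]
    rcases h2 with ⟨h3, h4⟩ | h3 | h3
    · refine (positiveAtOne_sum (by simpa using h3) fun y hy => ?_).ne_zero
      obtain ⟨x, hx, rfl⟩ := List.mem_map.1 hy
      exact h4 x hx
    · rw [h3]
      simpa [sub_eq_add_neg] using X_zpow_sub_ne_zero (a := 2) (by norm_num)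
    · rw [h3]
      simpa [sub_eq_neg_add] using X_zpow_sub_ne_zero (a := 2) (by norm_num)
  · intro u hu
    have hw := mem_homogeneous_iff.1 (goodElement_mem_homogeneous b) u hu
    refine ⟨length_eq_of_weight_eq (hw.trans (weight_reverse _).symm), ?_⟩
    by_contra! hlt
    rw [goodElement, coeff_evalTerms_topTerms hlt.not_gt, e, map_smul, coeff_word,
      if_neg (by rintro rfl; exact absurd hlt (lt_irrefl _)), smul_zero] at hu
    exact hu rfl

end GoodElements

end QuantumShuffle

namespace QuantumShuffle

open ShuffleAlgebra

/-! ### Counting root partitions, and the classification -/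

section Classification

theorem lyndonTable_dualLtb (b : Fin 24) : lyndonTable b ≠ [] ∧
    ∀ n ∈ Finset.Ico 1 (lyndonTable b).length,
      dualLtb (lyndonTable b).reverse ((lyndonTable b).reverse.drop n) = true := by
  revert b
  decide +kernel

/-- A good Lyndon word, spelled backwards and with the order of the letters reversed. -/
def lyndonDual (b : Fin 24) : List (Fin 4)ᵒᵈ := dualWord (lyndonTable b).reverse

theorem isLyndonWord_lyndonDual (b : Fin 24) : IsLyndonWord (lyndonDual b) := by
  obtain ⟨h1, h2⟩ := lyndonTable_dualLtb b
  refine isLyndonWord_dualWord_iff.2 ⟨by simpa using h1, fun p s hp hs he => ?_⟩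
  have h3 := List.length_pos_iff.2 hp
  have h4 := List.length_pos_iff.2 hs
  have h5 := congrArg List.length he
  rw [List.length_reverse, List.length_append] at h5
  have h6 := h2 p.length (Finset.mem_Ico.2 (by omega))
  have h7 : (lyndonTable b).reverse.drop p.length = s := by rw [he, List.drop_left]
  rwa [h7, dualLtb_iff] at h6

theorem lyndonDual_lt {b c : Fin 24} (h : b < c) : lyndonDual c < lyndonDual b := by
  refine (dualLtb_iff _ _).1 ?_
  revert b c
  decide +kernel

theorem lyndonDual_injective : Function.Injective lyndonDual := by
  intro b c h
  rcases lt_trichotomy b c with hbc | rfl | hbc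
  · exact absurd h (lyndonDual_lt hbc).ne'
  · rfl
  · exact absurd h (lyndonDual_lt hbc).ne

theorem isLyndonChain_map {m : List (Fin 24)} (hm : m.Pairwise (· ≤ ·)) :
    IsLyndonChain (m.map lyndonDual) := by
  refine ⟨List.pairwise_map.2 (hm.imp fun {b c} h => ?_), fun l hl => ?_⟩
  · rcases h.lt_or_eq with h | rfl
    · exact (lyndonDual_lt h).le
    · exact le_rfl
  · obtain ⟨b, -, rfl⟩ := List.mem_map.1 hl
    exact isLyndonWord_lyndonDual b

/-- The concatenation of good Lyndon words, spelled backwards. -/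
def goodWord (m : List (Fin 24)) : List (Fin 4) :=
  (m.map fun b => (lyndonTable b).reverse).flatten

theorem dualWord_goodWord (m : List (Fin 24)) :
    dualWord (goodWord m) = (m.map lyndonDual).flatten := by
  induction m with
  | nil => rfl
  | cons b m ih =>
    rw [List.map_cons, List.flatten_cons, ← ih, lyndonDual, ← dualWord_append]
    rfl

theorem isLeading_prod {m : List (Fin 24)} (hm : m.Pairwise (· ≤ ·)) :
    IsLeading (m.map goodElement).prod (goodWord m) := by
  induction m with
  | nil =>
    rw [List.map_nil, List.prod_nil, one_def]
    refine ⟨by rw [coeff_word]; simp [goodWord], fun u hu => ?_⟩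
    rw [coeff_word] at hu
    split_ifs at hu with h
    · subst h
      exact ⟨rfl, le_rfl⟩
    · exact absurd rfl hu
  | cons b m ih =>
    rw [List.map_cons, List.prod_cons]
    exact (goodElement_isLeading b).mul (ih hm.of_cons) (isLyndonChain_map hm)
      (dualWord_goodWord m).symm

theorem one_le_sum_rootWeight (b : Fin 24) : 1 ≤ ∑ i, rootWeight b i := by
  revert b
  decide +kernel

/-- Every root has positive height, so a partition of a weight has boundedly many parts; this makes
the set of partitions finite. -/
theorem length_le_sum (m : List (Fin 24)) : m.length ≤ ∑ i, (m.map rootWeight).sum i := by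
  induction m with
  | nil => simp
  | cons b m ih =>
    rw [List.map_cons, List.sum_cons, List.length_cons]
    simp only [Pi.add_apply, Finset.sum_add_distrib]
    have := one_le_sum_rootWeight b
    omega

/-- The partitions of a weight into positive roots. -/
def RootPartition (ν : Fin 4 → ℕ) : Type :=
  {m : List (Fin 24) // m.Pairwise (· ≤ ·) ∧ (m.map rootWeight).sum = ν}

instance (ν : Fin 4 → ℕ) : Finite (RootPartition ν) := by
  refine Set.Finite.to_subtype
    (s := {m : List (Fin 24) | m.Pairwise (· ≤ ·) ∧ (m.map rootWeight).sum = ν}) ?_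
  refine (List.finite_length_le (Fin 24) (∑ i, ν i)).subset ?_
  rintro m ⟨-, rfl⟩
  exact length_le_sum m

/-- A Lyndon word that is the leading word of a homogeneous element of the algebra generated by
the letters belongs to the table. -/
theorem exists_eq_of_isLeading {f : ShuffleF4} {ν : Fin 4 → ℕ} {l : List (Fin 4)}
    (hf : f ∈ letters formF4) (hν : f ∈ homogeneous ν) (hl : IsLeading f l)
    (hlyn : IsLyndonWord (dualWord l)) : ∃ b, l = (lyndonTable b).reverse := by
  classical
  by_contra! hne
  -- The value at `none` is the supposed additional element `f`; the others are the ordered products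
  -- of good elements of weight `ν`.
  let F : Option (RootPartition ν) → ShuffleF4 := fun o =>
    o.elim f fun m => (m.1.map goodElement).prod
  let W : Option (RootPartition ν) → List (Fin 4) := fun o => o.elim l fun m => goodWord m.1
  have hsingle : IsLyndonChain [dualWord l] :=
    isLyndonChain_cons.2 ⟨hlyn, by simp, IsLyndonChain.nil⟩
  -- A Lyndon word is its own Lyndon factorization, so equality would force the partition to consist
  -- of one root, with `l` as its table word.
  have hword : ∀ m : RootPartition ν, l ≠ goodWord m.1 := by
    intro m h
    have h1 := congrArg dualWord h
    rw [dualWord_goodWord] at h1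
    have h2 := hsingle.ext (isLyndonChain_map m.2.1) (by simpa using h1)
    obtain ⟨b, -, hb⟩ := List.mem_map.1 (h2 ▸ List.mem_singleton_self (dualWord l))
    exact hne b (dualWord_injective hb.symm)
  have hW : Function.Injective W := by
    rintro (_ | m) (_ | m') h
    · rfl
    · exact absurd h (hword m')
    · exact absurd h.symm (hword m)
    · have h1 : dualWord (goodWord m.1) = dualWord (goodWord m'.1) := congrArg dualWord h
      rw [dualWord_goodWord, dualWord_goodWord] at h1
      have h2 := (isLyndonChain_map m.2.1).ext (isLyndonChain_map m'.2.1) h1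
      exact congrArg some (Subtype.ext (List.map_injective_iff.2 lyndonDual_injective h2))
  have hlead : ∀ o, IsLeading (F o) (W o) := by
    rintro (_ | m)
    · exact hl
    · exact isLeading_prod m.2.1
  have hind := linearIndependent_of_isLeading hW hlead
  have hmem : ∀ o, F o ∈ Submodule.span K (Set.range fun m : RootPartition ν =>
      (m.1.map (rootVector letter)).prod) := by
    have h1 : ∀ g ∈ letters formF4, g ∈ homogeneous ν → g ∈ Submodule.span K (Set.range
        fun m : RootPartition ν => (m.1.map (rootVector letter)).prod) := by
      intro g hg hgν
      refine Submodule.span_mono ?_ (mem_span_ordered hg hgν)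
      rintro _ ⟨m, hm1, hm2, rfl⟩
      exact ⟨⟨m, hm1, hm2⟩, rfl⟩
    rintro (_ | m)
    · exact h1 f hf hν
    · refine h1 _ ((letters formF4).list_prod_mem fun x hx => ?_) ?_
      · obtain ⟨b, -, rfl⟩ := List.mem_map.1 hx
        exact goodElement_mem_letters b
      · have := prod_mem_homogeneous goodElement_mem_homogeneous m.1
        rwa [m.2.2] at this
  have : Fintype (RootPartition ν) := Fintype.ofFinite _
  -- If `ν` has `n` partitions, there are `n + 1` independent elements in a space spanned by `n`.
  have h1 := finrank_span_eq_card hind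
  have h2 : Module.finrank K (Submodule.span K (Set.range F)) ≤
      Module.finrank K (Submodule.span K (Set.range fun m : RootPartition ν =>
        (m.1.map (rootVector letter)).prod)) := by
    have := FiniteDimensional.span_of_finite K (Set.finite_range fun m : RootPartition ν =>
      (m.1.map (rootVector letter)).prod)
    refine Submodule.finrank_mono (Submodule.span_le.2 ?_)
    rintro _ ⟨o, rfl⟩
    exact hmem o
  have h3 := finrank_range_le_card (R := K) fun m : RootPartition ν =>
    (m.1.map (rootVector letter)).prod
  rw [Set.finrank] at h3
  rw [h1, Fintype.card_option] at h2
  omega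

theorem reverseEquiv_mem_homogeneous {w : FreeSpace (Fin 4)} {ν : Fin 4 → ℕ} :
    reverseEquiv formF4 w ∈ homogeneous ν ↔ IsHomogeneous w ν := by
  rw [mem_homogeneous_iff]
  constructor
  · intro h u hu i
    have := h u.reverse (by
      rw [coeff_reverseEquiv, List.reverse_reverse]
      exact Finsupp.mem_support_iff.1 hu)
    rw [← this, weight_reverse]
    rfl
  · intro h u hu
    rw [coeff_reverseEquiv] at hu
    rw [← weight_reverse]
    funext i
    exact h _ (Finsupp.mem_support_iff.2 hu) i

/-- Passage from smallest to leading words. The equality of lengths in `IsLeading` comes from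
homogeneity. -/
theorem isGood_iff {g : List (Fin 4)} : IsGood formF4 g ↔
    ∃ f ∈ letters formF4, (∃ ν, f ∈ homogeneous ν) ∧ IsLeading f g.reverse := by
  constructor
  · rintro ⟨w, hw, ⟨ν, hν⟩, hg, hmin⟩
    refine ⟨reverseEquiv formF4 w, mem_letterSubalgebra.1 hw,
      ⟨ν, reverseEquiv_mem_homogeneous.2 hν⟩, ?_, fun u hu => ?_⟩
    · rw [coeff_reverseEquiv, List.reverse_reverse]
      exact Finsupp.mem_support_iff.1 hg
    · rw [coeff_reverseEquiv] at hu
      have hu' := Finsupp.mem_support_iff.2 hu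
      refine ⟨?_, ?_⟩
      · have : weight u.reverse = weight g := funext fun i => (hν _ hu' i).trans (hν _ hg i).symm
        simpa using length_eq_of_weight_eq this
      · rcases eq_or_ne u.reverse g with h | h
        · rw [← h, List.reverse_reverse]
        · have := wordLT_iff.1 (hmin _ hu' h)
          rw [List.reverse_reverse] at this
          exact this.le
  · rintro ⟨f, hf, ⟨ν, hν⟩, h1, h2⟩
    obtain ⟨w, rfl⟩ := (reverseEquiv formF4).surjective f
    rw [coeff_reverseEquiv, List.reverse_reverse] at h1
    refine ⟨w, mem_letterSubalgebra.2 hf, ⟨ν, reverseEquiv_mem_homogeneous.1 hν⟩,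
      Finsupp.mem_support_iff.2 h1, fun v hv hvg => wordLT_iff.2 ?_⟩
    refine lt_of_le_of_ne (h2 v.reverse ?_).2 fun he => hvg ?_
    · rw [coeff_reverseEquiv, List.reverse_reverse]
      exact Finsupp.mem_support_iff.1 hv
    · exact List.reverse_injective (dualWord_injective he)

theorem mem_goodLyndon_iff {d : ℕ} {l : List (Fin 4)} :
    l ∈ goodLyndon formF4 d ↔ ∃ b, lyndonTable b = l ∧ (lyndonTable b).length = d := by
  constructor
  · rintro ⟨hg, hl, rfl⟩
    obtain ⟨f, hf, ⟨ν, hν⟩, hlead⟩ := isGood_iff.1 hg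
    obtain ⟨b, hb⟩ := exists_eq_of_isLeading hf hν hlead (isLyndon_iff.1 hl)
    obtain rfl := List.reverse_injective hb
    exact ⟨b, rfl, rfl⟩
  · rintro ⟨b, rfl, rfl⟩
    exact ⟨isGood_iff.2 ⟨_, goodElement_mem_letters b, ⟨_, goodElement_mem_homogeneous b⟩,
      goodElement_isLeading b⟩, isLyndon_iff.2 (isLyndonWord_lyndonDual b), rfl⟩

theorem goodLyndon_eq {d : ℕ} {S : List (List (Fin 4))}
    (h1 : ∀ b, (lyndonTable b).length = d → lyndonTable b ∈ S)
    (h2 : ∀ l ∈ S, ∃ b, lyndonTable b = l ∧ (lyndonTable b).length = d) :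
    goodLyndon formF4 d = {l | l ∈ S} := by
  ext l
  rw [mem_goodLyndon_iff]
  constructor
  · rintro ⟨b, rfl, hb⟩
    exact h1 b hb
  · exact h2 l

theorem length_lyndonTable (b : Fin 24) :
    0 < (lyndonTable b).length ∧ (lyndonTable b).length ≤ 11 := by
  revert b
  decide +kernel

end Classification

end QuantumShuffle

theorem proposition5p3p1 :
    QuantumShuffle.goodLyndon QuantumShuffle.formF4 1 = {[0], [1], [2], [3]} ∧
    QuantumShuffle.goodLyndon QuantumShuffle.formF4 2 = {[0, 1], [1, 2], [2, 3]} ∧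
    QuantumShuffle.goodLyndon QuantumShuffle.formF4 3 = {[0, 1, 2], [1, 2, 3], [1, 1, 2]} ∧
    QuantumShuffle.goodLyndon QuantumShuffle.formF4 4 =
      {[0, 1, 2, 3], [1, 0, 1, 2], [1, 1, 2, 3]} ∧
    QuantumShuffle.goodLyndon QuantumShuffle.formF4 5 =
      {[0, 1, 0, 1, 2], [2, 1, 1, 2, 3], [1, 0, 1, 2, 3]} ∧
    QuantumShuffle.goodLyndon QuantumShuffle.formF4 6 =
      {[0, 1, 0, 1, 2, 3], [2, 1, 0, 1, 2, 3]} ∧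
    QuantumShuffle.goodLyndon QuantumShuffle.formF4 7 =
      {[1, 2, 1, 0, 1, 2, 3], [2, 0, 1, 0, 1, 2, 3]} ∧
    QuantumShuffle.goodLyndon QuantumShuffle.formF4 8 = {[1, 2, 0, 1, 0, 1, 2, 3]} ∧
    QuantumShuffle.goodLyndon QuantumShuffle.formF4 9 = {[1, 1, 2, 0, 1, 0, 1, 2, 3]} ∧
    QuantumShuffle.goodLyndon QuantumShuffle.formF4 10 = {[2, 1, 1, 2, 0, 1, 0, 1, 2, 3]} ∧
    QuantumShuffle.goodLyndon QuantumShuffle.formF4 11 = {[2, 1, 0, 1, 2, 3, 1, 0, 1, 2, 3]} ∧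
    ∀ d : ℕ, d = 0 ∨ 11 < d → QuantumShuffle.goodLyndon QuantumShuffle.formF4 d = ∅ := by

  -- By the classification, each height is a finite comparison with the table, whose words have
  -- lengths from 1 to 11.
  refine ⟨?_, ?_, ?_, ?_, ?_, ?_, ?_, ?_, ?_, ?_, ?_, fun d hd => ?_⟩
  · rw [QuantumShuffle.goodLyndon_eq (S := [[0], [1], [2], [3]])
      (by decide +kernel) (by decide +kernel)]
    ext l; simp
  · rw [QuantumShuffle.goodLyndon_eq (S := [[0, 1], [1, 2], [2, 3]])
      (by decide +kernel) (by decide +kernel)]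
    ext l; simp
  · rw [QuantumShuffle.goodLyndon_eq (S := [[0, 1, 2], [1, 2, 3], [1, 1, 2]])
      (by decide +kernel) (by decide +kernel)]
    ext l; simp
  · rw [QuantumShuffle.goodLyndon_eq (S := [[0, 1, 2, 3], [1, 0, 1, 2], [1, 1, 2, 3]])
      (by decide +kernel) (by decide +kernel)]
    ext l; simp
  · rw [QuantumShuffle.goodLyndon_eq (S := [[0, 1, 0, 1, 2], [2, 1, 1, 2, 3], [1, 0, 1, 2, 3]])
      (by decide +kernel) (by decide +kernel)]
    ext l; simp
  · rw [QuantumShuffle.goodLyndon_eq (S := [[0, 1, 0, 1, 2, 3], [2, 1, 0, 1, 2, 3]])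
      (by decide +kernel) (by decide +kernel)]
    ext l; simp
  · rw [QuantumShuffle.goodLyndon_eq (S := [[1, 2, 1, 0, 1, 2, 3], [2, 0, 1, 0, 1, 2, 3]])
      (by decide +kernel) (by decide +kernel)]
    ext l; simp
  · rw [QuantumShuffle.goodLyndon_eq (S := [[1, 2, 0, 1, 0, 1, 2, 3]])
      (by decide +kernel) (by decide +kernel)]
    ext l; simp
  · rw [QuantumShuffle.goodLyndon_eq (S := [[1, 1, 2, 0, 1, 0, 1, 2, 3]])
      (by decide +kernel) (by decide +kernel)]
    ext l; simp
  · rw [QuantumShuffle.goodLyndon_eq (S := [[2, 1, 1, 2, 0, 1, 0, 1, 2, 3]])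
      (by decide +kernel) (by decide +kernel)]
    ext l; simp
  · rw [QuantumShuffle.goodLyndon_eq (S := [[2, 1, 0, 1, 2, 3, 1, 0, 1, 2, 3]])
      (by decide +kernel) (by decide +kernel)]
    ext l; simp
  · refine Set.eq_empty_of_forall_notMem fun l hl => ?_
    obtain ⟨b, -, rfl⟩ := QuantumShuffle.mem_goodLyndon_iff.1 hl
    have := QuantumShuffle.length_lyndonTable b
    omega
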